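/- Let $K$ be an algebraically closed field of characteristic $0$ and let $\mathcal F_d$ be the space of homogeneous forms of degree $d$ in $x_0,\dots,x_3$ over $K$. Let $\mathbb X=\mathbb G(2,\mathcal F_2)$ be the Grassmannian of pencils of quadrics in $\mathbb P^3$, and let $Z\subset\mathbb X$ be the locus of pencils with a fixed plane, i.e. pencils $H\cdot L$ with $H\subset\mathcal F_1$ of dimension $1$ and $L\subset\mathcal F_1$ of dimension $2$. Let $\widetilde{\mathbb X}\subset\mathbb X\times\mathbb G(8,\mathcal F_3)$ be the blow-up of $\mathbb X$ along $Z$, realized as the closure of the graph of the map $\kappa:\mathbb X\setminus Z\to\mathbb G(8,\mathcal F_3)$, $A\mapsto A\cdot\mathcal F_1$. Let $\mathcal A\subset\mathcal F_2\times\widetilde{\mathbb X}$ and $\mathcal B\subset\mathcal F_3\times\widetilde{\mathbb X}$ be the pullbacks of the tautological subbundles of ranks $2$ and $8$, and let $$\nu:\mathcal A\otimes\mathcal B\longrightarrow\mathcal F_5\times\widetilde{\mathbb X}$$ be the map given by multiplication of forms. Let $\mathbb M\subset\widetilde{\mathbb X}$ be the closed subvariety of triples $(H,L,C)$, where $H\subset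 L\subset\mathcal F_1$ with $\dim H=1$, $\dim L=2$ (a line in a plane), and $C$ is the class of a cubic form $(H')^2H''$ with $H'\in L\setminus H$ and $H''\in\mathcal F_1\setminus H$; such a triple is the point $(A,B)$ of $\widetilde{\mathbb X}$ with $A=H\cdot L$ and $B=H\cdot L\cdot\mathcal F_1+\langle (H')^2H''\rangle$. Then $\nu$ has rank $12$ at every point of $\widetilde{\mathbb X}\setminus\mathbb M$, and $\mathbb M$ is the scheme of zeros of $\bigwedge^{12}\nu$; that is, on $\widetilde{\mathbb X}$ the ideal sheaf of the variety $\mathbb M$ is the ideal generated by the entries of $\bigwedge^{12}\nu$. -/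

import Mathlib

open scoped TensorProduct

noncomputable section

namespace EllipticQuartics

/-! ## Forms in four variables and multiplication of forms -/

/-- Forms of degree `d` in `x₀, …, x₃` with coefficients in `R`.  This is a free `R`-module; over a
`K`-algebra `R` it is `R ⊗ 𝓕_d`, the trivial bundle with fibre the space `𝓕_d` of forms over `K`. -/
def Forms (R : Type*) [CommRing R] (d : ℕ) : Type _ :=
  MvPolynomial.homogeneousSubmodule (Fin 4) R d

instance (R : Type*) [CommRing R] (d : ℕ) : AddCommGroup (Forms R d) :=
  inferInstanceAs (AddCommGroup (MvPolynomial.homogeneousSubmodule (Fin 4) R d))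

instance (R : Type*) [CommRing R] (d : ℕ) : Module R (Forms R d) :=
  inferInstanceAs (Module R (MvPolynomial.homogeneousSubmodule (Fin 4) R d))

/-- Multiplication of forms, as a bilinear map. -/
def mulForms (R : Type*) [CommRing R] (d e : ℕ) :
    Forms R d →ₗ[R] Forms R e →ₗ[R] Forms R (d + e) :=
  LinearMap.mk₂ R
    (fun f g => ⟨f.1 * g.1, MvPolynomial.IsHomogeneous.mul f.2 g.2⟩)
    (fun _ _ _ => Subtype.ext (add_mul _ _ _))
    (fun _ _ _ => Subtype.ext (smul_mul_assoc _ _ _))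
    (fun _ _ _ => Subtype.ext (mul_add _ _ _))
    (fun _ _ _ => Subtype.ext (mul_smul_comm _ _ _))

/-- The span of all products `f * g`, `f ∈ U`, `g ∈ W`. -/
def mulSpan {R : Type*} [CommRing R] {d e : ℕ} (U : Submodule R (Forms R d))
    (W : Submodule R (Forms R e)) : Submodule R (Forms R (d + e)) :=
  Submodule.map₂ (mulForms R d e) U W

/-- Extension of scalars of a form from `K` to a `K`-algebra `R`. -/
def extend {K : Type*} [Field K] (R : Type*) [CommRing R] [Algebra K R] {d : ℕ}
    (f : Forms K d) : Forms R d :=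
  ⟨MvPolynomial.map (algebraMap K R) f.1, MvPolynomial.IsHomogeneous.map f.2 _⟩

/-- The multiplication map `ν : A ⊗ B → 𝓕₅` for a module `A` of quadrics and a module `B` of cubics
with coefficients in `R`.  For `R = K` this is the map `ν` on a fibre; for `R` a coordinate ring it
is the map `ν` over an affine open set. -/
def nu {R : Type*} [CommRing R] (A : Submodule R (Forms R 2)) (B : Submodule R (Forms R 3)) :
    A ⊗[R] B →ₗ[R] Forms R 5 :=
  TensorProduct.lift ((mulForms R 2 3).domRestrict₁₂ A B)

/-- The exterior power `⋀¹² ν`. -/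
def wedgeNu {R : Type*} [CommRing R] (A : Submodule R (Forms R 2)) (B : Submodule R (Forms R 3)) :
    ⋀[R]^12 (A ⊗[R] B) →ₗ[R] ⋀[R]^12 (Forms R 5) :=
  exteriorPower.map 12 (nu A B)

/-- The ideal of the scheme of zeros of a linear map `φ : P → Q`: it is generated by all the values
`l (φ p)` with `p ∈ P` and `l` a linear form on `Q` (for free `Q` of finite rank: by the coordinates
of the vectors `φ p`). -/
def zeroIdeal {R P Q : Type*} [CommRing R] [AddCommGroup P] [Module R P] [AddCommGroup Q]
    [Module R Q] (φ : P →ₗ[R] Q) : Ideal R :=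
  Ideal.span {r | ∃ (p : P) (l : Module.Dual R Q), l (φ p) = r}

/-! ## Grassmannians and their affine charts -/

/-- The points of the Grassmannian `𝔾(r, 𝓕_d)` of `r`-dimensional spaces of forms of degree `d`. -/
def Gr (K : Type*) [Field K] (d r : ℕ) : Type _ :=
  {W : Submodule K (Forms K d) // Module.finrank K W = r}

/-- The `R`-module spanned by the rows of the matrix `(1 | a)`, written in the basis `v`. -/
def chartSpan {K : Type*} [Field K] (R : Type*) [CommRing R] [Algebra K R] {d r m : ℕ}
    (v : Module.Basis (Fin r ⊕ Fin m) K (Forms K d)) (a : Fin r → Fin m → R) :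
    Submodule R (Forms R d) :=
  Submodule.span R (Set.range fun i : Fin r =>
    extend R (v (Sum.inl i)) + ∑ j : Fin m, a i j • extend R (v (Sum.inr j)))

theorem extend_self {K : Type*} [Field K] {d : ℕ} (f : Forms K d) : extend K f = f :=
  Subtype.ext (by simp [extend, MvPolynomial.map_id])

theorem finrank_chartSpan {K : Type*} [Field K] {d r m : ℕ}
    (v : Module.Basis (Fin r ⊕ Fin m) K (Forms K d)) (a : Fin r → Fin m → K) :
    Module.finrank K (chartSpan K v a) = r := by
  have h : LinearIndependent K (fun i : Fin r =>
      extend K (v (Sum.inl i)) + ∑ j : Fin m, a i j • extend K (v (Sum.inr j))) := by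
    simp only [extend_self]
    rw [Fintype.linearIndependent_iff]
    intro g hg i
    have := congrArg (fun z => v.repr z (Sum.inl i)) hg
    simpa [Finsupp.single_apply, map_sum, Finsupp.finsetSum_apply] using this
  exact (finrank_span_eq_card h).trans (Fintype.card_fin r)

/-- The standard affine chart `𝔸^(r m) → 𝔾(r, 𝓕_d)` attached to a basis `v` of `𝓕_d`: its image
consists of the spaces complementary to the span of the last `m` basis vectors. -/
def chart {K : Type*} [Field K] {d r m : ℕ}
    (v : Module.Basis (Fin r ⊕ Fin m) K (Forms K d)) (a : Fin r → Fin m → K) : Gr K d r :=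
  ⟨chartSpan K v a, finrank_chartSpan v a⟩

/-- Bases of `𝓕₂` (dimension 10), giving the charts of `𝔾(2, 𝓕₂)`. -/
abbrev Basis2 (K : Type*) [Field K] := Module.Basis (Fin 2 ⊕ Fin 8) K (Forms K 2)

/-- Bases of `𝓕₃` (dimension 20), giving the charts of `𝔾(8, 𝓕₃)`. -/
abbrev Basis3 (K : Type*) [Field K] := Module.Basis (Fin 8 ⊕ Fin 12) K (Forms K 3)

/-- Index set for the affine coordinates on a chart of `𝔾(2, 𝓕₂) × 𝔾(8, 𝓕₃)`. -/
abbrev Coord : Type := (Fin 2 × Fin 8) ⊕ (Fin 8 × Fin 12)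

/-- The affine chart of `𝔾(2, 𝓕₂) × 𝔾(8, 𝓕₃)` attached to a basis of `𝓕₂` and a basis of `𝓕₃`. -/
def chart₂ {K : Type*} [Field K] (v : Basis2 K) (w : Basis3 K) (x : Coord → K) :
    Gr K 2 2 × Gr K 3 8 :=
  (chart v fun i j => x (Sum.inl (i, j)), chart w fun i j => x (Sum.inr (i, j)))

/-- The part of a set of points of `𝔾(2, 𝓕₂) × 𝔾(8, 𝓕₃)` that lies in a chart. -/
def inChart {K : Type*} [Field K] (T : Set (Gr K 2 2 × Gr K 3 8)) (v : Basis2 K) (w : Basis3 K) :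
    Set (Coord → K) :=
  {x | chart₂ v w x ∈ T}

/-- Zariski-closed subsets of `𝔾(2, 𝓕₂) × 𝔾(8, 𝓕₃)`: those given by polynomial equations in every
affine chart. -/
def IsZariskiClosed {K : Type*} [Field K] (T : Set (Gr K 2 2 × Gr K 3 8)) : Prop :=
  ∀ (v : Basis2 K) (w : Basis3 K), ∃ I : Ideal (MvPolynomial Coord K),
    inChart T v w = MvPolynomial.zeroLocus K I

/-! ## The varieties -/

/-- The set `Z` of pencils of quadrics with a fixed plane: pencils `H · L` with `H` spanned by the
equation of a plane and `L` the space of linear forms vanishing on a line. -/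
def Z (K : Type*) [Field K] : Set (Gr K 2 2) :=
  {A | ∃ (H : Gr K 1 1) (L : Gr K 1 2), A.1 = mulSpan H.1 L.1}

/-- The graph of the map `κ : 𝔾(2, 𝓕₂) ∖ Z → 𝔾(8, 𝓕₃)`, `A ↦ A · 𝓕₁`. -/
def graphKappa (K : Type*) [Field K] : Set (Gr K 2 2 × Gr K 3 8) :=
  {p | p.1 ∉ Z K ∧ p.2.1 = mulSpan p.1.1 (⊤ : Submodule K (Forms K 1))}

/-- The variety `X̃`, the blow-up of `𝔾(2, 𝓕₂)` along `Z`, realized as the Zariski closure of the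
graph of `κ` in `𝔾(2, 𝓕₂) × 𝔾(8, 𝓕₃)`. -/
def Xtilde (K : Type*) [Field K] : Set (Gr K 2 2 × Gr K 3 8) :=
  ⋂₀ {T | IsZariskiClosed T ∧ graphKappa K ⊆ T}

/-- The variety `𝕄` of triples `(H, L, C)`: a plane `H`, a line `L = ⟨H, H'⟩` in it, and the class
of a cubic form `C = (H')² H''` with `H''` not a multiple of the equation of `H`.  The triple is the
pair `(A, B)` with `A = H · L` and `B = H · L · 𝓕₁ + ⟨C⟩`. -/
def MM (K : Type*) [Field K] : Set (Gr K 2 2 × Gr K 3 8) :=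
  {p | ∃ (H : Gr K 1 1) (L : Gr K 1 2) (h' h'' : Forms K 1),
    H.1 ≤ L.1 ∧ h' ∈ L.1 ∧ h' ∉ H.1 ∧ h'' ∉ H.1 ∧
    p.1.1 = mulSpan H.1 L.1 ∧
    p.2.1 = mulSpan p.1.1 (⊤ : Submodule K (Forms K 1)) ⊔
      Submodule.span K {mulForms K 2 1 (mulForms K 1 1 h' h') h''}}

/-! ## Coordinate rings, the tautological bundles and `ν` over a chart -/

section Chart

variable {K : Type*} [Field K] (v : Basis2 K) (w : Basis3 K)

/-- The coordinate ring of the affine variety `X̃ ∩ (chart)`. -/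
abbrev coordRing : Type _ :=
  MvPolynomial Coord K ⧸ MvPolynomial.vanishingIdeal K (inChart (Xtilde K) v w)

/-- The class in the coordinate ring of a coordinate function. -/
def coordFun (s : Coord) : coordRing v w :=
  Ideal.Quotient.mk _ (MvPolynomial.X s)

/-- The tautological rank 2 subbundle `𝒜` over the chart. -/
def bundleA : Submodule (coordRing v w) (Forms (coordRing v w) 2) :=
  chartSpan (coordRing v w) v fun i j => coordFun v w (Sum.inl (i, j))

/-- The tautological rank 8 subbundle `ℬ` over the chart. -/
def bundleB : Submodule (coordRing v w) (Forms (coordRing v w) 3) :=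
  chartSpan (coordRing v w) w fun i j => coordFun v w (Sum.inr (i, j))

/-- The ideal of `𝕄` in the coordinate ring: the regular functions on `X̃ ∩ (chart)` that vanish at
every point of `𝕄`. -/
def idealMM : Ideal (coordRing v w) :=
  (MvPolynomial.vanishingIdeal K (inChart (MM K) v w)).map (Ideal.Quotient.mk _)

end Chart

end EllipticQuartics

end

noncomputable section

namespace EllipticQuartics

open MvPolynomial Module

/-! ## Generalities on forms -/

section Basic

variable {R : Type*} [CommRing R] {d e : ℕ}

/-! `𝕄 ⊆ X̃`. Since `(h² + t l g) l - (h l) h = t l² g`, the pencil `⟨h² + t l g, h l⟩` with `t ≠ 0`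
has `l² g` among its multiples. Letting `t` go to `0` gives the point of `𝕄` with cubic `l² g`
(`MM_subset_Xtilde`).

Rank. A pencil `⟨q₁, q₂⟩` without fixed plane consists of coprime quadrics. Then `B = A · 𝓕₁`, and
the image of `ν` is the direct sum of `q₁² 𝓕₁`, `q₁ q₂ 𝓕₁` and `q₂² 𝓕₁`, of dimension 12
(`finrank_range_nu_of_not_mem_Z`). If `A = h L`, then `B = h L 𝓕₁ + ⟨c⟩`, and the image is that of a
14-dimensional space by a map with two Koszul relations in its kernel. A further relation has the
form `h (…) + l c = 0` with `0 ≠ l ∈ L`. Divisibility then makes `l` a multiple of `h` and `c`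
congruent to some `l'² g` modulo `A · 𝓕₁`, which is a point of `𝕄` (`finrank_range_nu_of_mem_Z`). On
`𝕄` this third relation exists, so the rank is at most 11.

Ideals. The minors of order 12 vanish on `𝕄` pointwise, hence lie in its ideal
(`zeroIdeal_le_idealMM`). The converse is checked at maximal ideals, which are points of `X̃` by the
Nullstellensatz. Outside `𝕄` some minor is a unit. At a point of `𝕄`, over the local ring, suitable
linear coordinates `h, l, y, z` give (`exists_blowup_normal_form`) `a = h (h + 2e) + t Q`, `b = h l
- t r`, `c = l Q + (h + 2e) r`, so that `a l - b (h + 2e) = t c`. Here `e` is linear in `y, z`, `r`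
is quadratic in `y, z`, and `Q` is quadratic in `l, y, z`. Nine parameters vanish at the point: `t`,
the coefficients of `e` and `r`, and the coefficients of `y², yz, z²` in `Q`. Let `N` be the ideal
they generate, `m` the maximal ideal and `I` the ideal of minors. Eleven products are independent at
the point, so modulo `I` the product `a c` is a combination of them (`exists_relation_of_minors`).
Comparing coefficients modulo `I + m N` gives `N ⊆ I + m N` (`first_order_vanishing`), and
Nakayama's lemma gives `N ⊆ I`. Modulo `I` the data therefore have the shape `h²`, `h l`, `l² g`.
They are a specialization of the universal family of such data, whose general members lie in `𝕄`, so
every function vanishing on `𝕄` lies in `I` (`map_idealMM_le`).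

Two properties of `X̃` drive the normal form: the inclusion `𝒜 · 𝓕₁ ⊆ ℬ`, and the density of the
graph of `κ`, which makes `t` a nonzerodivisor (`smul_eq_zero_of_relation`). Characteristic zero
enters only through `2 ≠ 0`. -/

@[simp] theorem Forms.coe_add (f g : Forms R d) : (f + g).1 = f.1 + g.1 := rfl
@[simp] theorem Forms.coe_sub (f g : Forms R d) : (f - g).1 = f.1 - g.1 := rfl
@[simp] theorem Forms.coe_neg (f : Forms R d) : (-f).1 = -f.1 := rfl
@[simp] theorem Forms.coe_zero : (0 : Forms R d).1 = 0 := rfl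
@[simp] theorem Forms.coe_smul (r : R) (f : Forms R d) : (r • f).1 = C r * f.1 :=
  MvPolynomial.smul_eq_C_mul f.1 r
@[simp] theorem coe_mulForms (f : Forms R d) (g : Forms R e) :
    (mulForms R d e f g).1 = f.1 * g.1 := rfl

theorem Forms.ext {f g : Forms R d} (h : f.1 = g.1) : f = g := Subtype.ext h

/-- The inclusion of the forms of degree `d` into the polynomial ring. -/
def toPoly (R : Type*) [CommRing R] (d : ℕ) : Forms R d →ₗ[R] MvPolynomial (Fin 4) R :=
  Submodule.subtype (homogeneousSubmodule (Fin 4) R d)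

@[simp] theorem Forms.coe_sum {ι : Type*} (s : Finset ι) (f : ι → Forms R d) :
    (∑ i ∈ s, f i).1 = ∑ i ∈ s, (f i).1 :=
  map_sum (toPoly R d) f s

/-- A polynomial that is homogeneous of degree `d`, as a form. -/
def mkForm (p : MvPolynomial (Fin 4) R) (hp : p.IsHomogeneous d) : Forms R d := ⟨p, hp⟩

@[simp] theorem coe_mkForm (p : MvPolynomial (Fin 4) R) (hp : p.IsHomogeneous d) :
    (mkForm p hp).1 = p := rfl

theorem Forms.isHomogeneous (f : Forms R d) : f.1.IsHomogeneous d := f.2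

/-- The exponents of the monomials of degree `d`. -/
abbrev Mon (d : ℕ) : Type := {m : Fin 4 →₀ ℕ // m ∈ Finset.univ.finsuppAntidiag d}

theorem mem_mon_iff (m : Fin 4 →₀ ℕ) : m ∈ Finset.univ.finsuppAntidiag d ↔ m.degree = d := by
  rw [Finset.mem_finsuppAntidiag, Finsupp.degree_eq_sum]
  simp

theorem card_mon (d : ℕ) : Fintype.card (Mon d) = (d + 3).choose d := by
  rw [Fintype.card_coe, Finset.card_finsuppAntidiag_nat_eq_choose, Finset.card_univ,
    Fintype.card_fin]
  congr 1
  omega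

/-- The basis of monomials. -/
def monBasis (R : Type*) [CommRing R] (d : ℕ) : Basis (Mon d) R (Forms R d) :=
  Basis.ofEquivFun
    { toFun := fun f m => coeff m.1 f.1
      invFun := fun c => mkForm (∑ m, monomial m.1 (c m))
        (IsHomogeneous.sum _ _ _ fun m _ => isHomogeneous_monomial _ ((mem_mon_iff _).1 m.2))
      map_add' := fun f g => by ext m; simp
      map_smul' := fun r f => by ext m; simp
      left_inv := fun f => by
        apply Forms.ext
        ext m
        simp only [coe_mkForm, coeff_sum, coeff_monomial]
        by_cases hm : m.degree = d
        · rw [Finset.sum_eq_single (⟨m, (mem_mon_iff _).2 hm⟩ : Mon d)]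
          · simp
          · intro b _ hb
            rw [if_neg fun h => hb (Subtype.ext h)]
          · simp
        · rw [f.isHomogeneous.coeff_eq_zero hm, Finset.sum_eq_zero]
          intro b _
          rw [if_neg]
          rintro rfl
          exact hm ((mem_mon_iff _).1 b.2)
      right_inv := fun c => by
        ext m
        simp only [coe_mkForm, coeff_sum, coeff_monomial]
        rw [Finset.sum_eq_single m]
        · simp
        · intro b _ hb
          rw [if_neg fun h => hb (Subtype.ext h)]
        · simp }

theorem monBasis_repr (f : Forms R d) (m : Mon d) : (monBasis R d).repr f m = coeff m.1 f.1 := by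
  rw [← Basis.equivFun_apply, monBasis, Basis.equivFun_ofEquivFun]
  rfl

theorem coe_monBasis (m : Mon d) : (monBasis R d m).1 = monomial m.1 1 := by
  classical
  rw [monBasis, Basis.coe_ofEquivFun]
  change (∑ m' : Mon d, monomial m'.1 (Pi.single m (1 : R) m')) = _
  rw [Finset.sum_eq_single m]
  · simp
  · intro b _ hb
    simp [Pi.single_eq_of_ne hb]
  · simp

instance : Module.Free R (Forms R d) := Module.Free.of_basis (monBasis R d)
instance : Module.Finite R (Forms R d) := Module.Finite.of_basis (monBasis R d)

theorem finrank_forms [Nontrivial R] : finrank R (Forms R d) = (d + 3).choose d := by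
  rw [finrank_eq_card_basis (monBasis R d), card_mon]

theorem Forms.eq_sum_mon (f : Forms R d) : f = ∑ m : Mon d, coeff m.1 f.1 • monBasis R d m := by
  conv_lhs => rw [← (monBasis R d).sum_repr f]
  simp only [monBasis_repr]

theorem Forms.ext_mon {f g : Forms R d} (h : ∀ m : Mon d, coeff m.1 f.1 = coeff m.1 g.1) :
    f = g := by
  rw [f.eq_sum_mon, g.eq_sum_mon]
  simp only [h]

/-- Change of coefficients of forms along a ring homomorphism. -/
def mapForms {S : Type*} [CommRing S] (φ : R →+* S) (f : Forms R d) : Forms S d :=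
  ⟨MvPolynomial.map φ f.1, MvPolynomial.IsHomogeneous.map f.2 _⟩

section Map

variable {S T : Type*} [CommRing S] [CommRing T] (φ : R →+* S) (ψ : S →+* T)

@[simp] theorem coe_mapForms (f : Forms R d) : (mapForms φ f).1 = MvPolynomial.map φ f.1 := rfl

@[simp] theorem mapForms_add (f g : Forms R d) :
    mapForms φ (f + g) = mapForms φ f + mapForms φ g := Forms.ext (by simp)
@[simp] theorem mapForms_sub (f g : Forms R d) :
    mapForms φ (f - g) = mapForms φ f - mapForms φ g := Forms.ext (by simp)
@[simp] theorem mapForms_zero : mapForms φ (0 : Forms R d) = 0 := Forms.ext (by simp)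
@[simp] theorem mapForms_smul (r : R) (f : Forms R d) :
    mapForms φ (r • f) = φ r • mapForms φ f := Forms.ext (by simp)
@[simp] theorem mapForms_sum {ι : Type*} (s : Finset ι) (f : ι → Forms R d) :
    mapForms φ (∑ i ∈ s, f i) = ∑ i ∈ s, mapForms φ (f i) := Forms.ext (by simp)
@[simp] theorem mapForms_mulForms (f : Forms R d) (g : Forms R e) :
    mapForms φ (mulForms R d e f g) = mulForms S d e (mapForms φ f) (mapForms φ g) :=
  Forms.ext (by simp)
theorem mapForms_mapForms (f : Forms R d) :
    mapForms ψ (mapForms φ f) = mapForms (ψ.comp φ) f := Forms.ext (by simp [map_map])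

end Map

theorem mulSpan_le {U : Submodule R (Forms R d)} {W : Submodule R (Forms R e)}
    {V : Submodule R (Forms R (d + e))} :
    mulSpan U W ≤ V ↔ ∀ f ∈ U, ∀ g ∈ W, mulForms R d e f g ∈ V :=
  Submodule.map₂_le

theorem mul_mem_mulSpan {U : Submodule R (Forms R d)} {W : Submodule R (Forms R e)}
    {f : Forms R d} {g : Forms R e} (hf : f ∈ U) (hg : g ∈ W) :
    mulForms R d e f g ∈ mulSpan U W :=
  Submodule.apply_mem_map₂ _ hf hg

theorem mulSpan_span (s : Set (Forms R d)) (t : Set (Forms R e)) :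
    mulSpan (Submodule.span R s) (Submodule.span R t) =
      Submodule.span R (Set.image2 (fun f g => mulForms R d e f g) s t) :=
  Submodule.map₂_span_span _ _ _ _

theorem range_nu (A : Submodule R (Forms R 2)) (B : Submodule R (Forms R 3)) :
    LinearMap.range (nu A B) = mulSpan A B := by
  apply le_antisymm
  · rintro _ ⟨z, rfl⟩
    induction z with
    | zero => simp
    | add x y hx hy => rw [map_add]; exact add_mem hx hy
    | tmul a b => exact mul_mem_mulSpan a.2 b.2
  · rw [mulSpan_le]
    intro f hf g hg
    exact ⟨(⟨f, hf⟩ : A) ⊗ₜ (⟨g, hg⟩ : B), rfl⟩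

end Basic

/-! ## Extension of scalars of bases and the standard charts -/

section Extend

variable {K : Type*} [Field K] {R : Type*} [CommRing R] [Algebra K R]
  {S : Type*} [CommRing S] [Algebra K S] {d : ℕ} {ι : Type*}

theorem extend_eq_mapForms (f : Forms K d) : extend R f = mapForms (algebraMap K R) f := rfl

theorem mapForms_extend (φ : R →ₐ[K] S) (f : Forms K d) :
    mapForms (φ : R →+* S) (extend R f) = extend S f := by
  rw [extend_eq_mapForms, mapForms_mapForms, AlgHom.comp_algebraMap, extend_eq_mapForms]

/-- Extension of scalars, as a `K`-linear isomorphism after base change. -/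
def baseChangeEquiv (R : Type*) [CommRing R] [Algebra K R] (d : ℕ) :
    R ⊗[K] Forms K d ≃ₗ[R] Forms R d :=
  ((monBasis K d).baseChange R).equiv (monBasis R d) (Equiv.refl _)

theorem baseChangeEquiv_tmul (f : Forms K d) :
    baseChangeEquiv R d (1 ⊗ₜ f) = extend R f := by
  conv_lhs => rw [f.eq_sum_mon]
  conv_rhs => rw [f.eq_sum_mon]
  simp only [extend_eq_mapForms, mapForms_sum, mapForms_smul, TensorProduct.tmul_sum, map_sum,
    TensorProduct.tmul_smul]
  refine Finset.sum_congr rfl fun m _ => ?_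
  have h : (1 : R) ⊗ₜ[K] (monBasis K d m) = (monBasis K d).baseChange R m := by simp
  rw [← algebraMap_smul R, LinearEquiv.map_smul, h, baseChangeEquiv, Basis.equiv_apply]
  congr 1
  apply Forms.ext
  simp [coe_monBasis]

/-- The basis over `R` obtained by extension of scalars. -/
def extBasis (R : Type*) [CommRing R] [Algebra K R] (v : Basis ι K (Forms K d)) :
    Basis ι R (Forms R d) :=
  (v.baseChange R).map (baseChangeEquiv R d)

@[simp] theorem extBasis_apply (v : Basis ι K (Forms K d)) (i : ι) :
    extBasis R v i = extend R (v i) := by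
  simp [extBasis, baseChangeEquiv_tmul]

theorem mapForms_extBasis (φ : R →ₐ[K] S) (v : Basis ι K (Forms K d)) (i : ι) :
    mapForms (φ : R →+* S) (extBasis R v i) = extBasis S v i := by
  simp [mapForms_extend]

theorem extBasis_repr_map [Fintype ι] (φ : R →ₐ[K] S) (v : Basis ι K (Forms K d))
    (f : Forms R d) (i : ι) :
    (extBasis S v).repr (mapForms (φ : R →+* S) f) i = φ ((extBasis R v).repr f i) := by
  classical
  conv_lhs => rw [← (extBasis R v).sum_repr f]
  simp [-extBasis_apply, -Basis.sum_repr, mapForms_extBasis, Finsupp.single_apply]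

variable {r m : ℕ}

/-- The rows of the matrix `(1 | a)` in the basis `v`. -/
def chartRow (R : Type*) [CommRing R] [Algebra K R]
    (v : Basis (Fin r ⊕ Fin m) K (Forms K d)) (a : Fin r → Fin m → R) (i : Fin r) : Forms R d :=
  extend R (v (Sum.inl i)) + ∑ j : Fin m, a i j • extend R (v (Sum.inr j))

variable (v : Basis (Fin r ⊕ Fin m) K (Forms K d)) (a : Fin r → Fin m → R)

theorem chartSpan_eq : chartSpan R v a = Submodule.span R (Set.range (chartRow R v a)) := rfl

theorem chartRow_mem (i : Fin r) : chartRow R v a i ∈ chartSpan R v a :=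
  Submodule.subset_span ⟨i, rfl⟩

theorem chartRow_repr_inl (i i' : Fin r) :
    (extBasis R v).repr (chartRow R v a i) (Sum.inl i') = if i = i' then 1 else 0 := by
  simp only [chartRow, ← extBasis_apply]
  simp [-extBasis_apply, Finsupp.single_apply]

theorem chartRow_repr_inr (i : Fin r) (j : Fin m) :
    (extBasis R v).repr (chartRow R v a i) (Sum.inr j) = a i j := by
  simp only [chartRow, ← extBasis_apply]
  simp [-extBasis_apply, Finsupp.single_apply]

/-- The left block of `(1 | a)` is the identity, so the coefficients of a combination of rows are
its first `r` coordinates. -/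
theorem eq_sum_chartRow {f : Forms R d} (hf : f ∈ chartSpan R v a) :
    f = ∑ i, (extBasis R v).repr f (Sum.inl i) • chartRow R v a i := by
  rw [chartSpan_eq, Submodule.mem_span_range_iff_exists_fun] at hf
  obtain ⟨c, rfl⟩ := hf
  refine Finset.sum_congr rfl fun i _ => ?_
  simp [chartRow_repr_inl]

theorem repr_inr_of_mem {f : Forms R d} (hf : f ∈ chartSpan R v a) (j : Fin m) :
    (extBasis R v).repr f (Sum.inr j) =
      ∑ i, (extBasis R v).repr f (Sum.inl i) * a i j := by
  conv_lhs => rw [eq_sum_chartRow v a hf]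
  simp [chartRow_repr_inr]

theorem mem_chartSpan_iff {f : Forms R d} :
    f ∈ chartSpan R v a ↔ ∀ j, (extBasis R v).repr f (Sum.inr j) =
      ∑ i, (extBasis R v).repr f (Sum.inl i) * a i j := by
  refine ⟨fun h j => repr_inr_of_mem v a h j, fun h => ?_⟩
  have : f = ∑ i, (extBasis R v).repr f (Sum.inl i) • chartRow R v a i := by
    apply (extBasis R v).repr.injective
    ext k
    rcases k with k | k
    · simp [chartRow_repr_inl]
    · simp [chartRow_repr_inr, h]
  rw [this]
  exact Submodule.sum_mem _ fun i _ => Submodule.smul_mem _ _ (chartRow_mem v a i)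

theorem mapForms_chartRow (φ : R →ₐ[K] S) (i : Fin r) :
    mapForms (φ : R →+* S) (chartRow R v a i) = chartRow S v (fun i j => φ (a i j)) i := by
  simp [chartRow, mapForms_extend]

theorem mapForms_mem_chartSpan (φ : R →ₐ[K] S) {f : Forms R d} (hf : f ∈ chartSpan R v a) :
    mapForms (φ : R →+* S) f ∈ chartSpan S v (fun i j => φ (a i j)) := by
  rw [eq_sum_chartRow v a hf, mapForms_sum]
  refine Submodule.sum_mem _ fun i _ => ?_
  rw [mapForms_smul, mapForms_chartRow]
  exact Submodule.smul_mem _ _ (chartRow_mem _ _ i)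

/-- The matrix of the first `r` coordinates of a family of forms. -/
def inlMatrix (R : Type*) [CommRing R] [Algebra K R] (v : Basis (Fin r ⊕ Fin m) K (Forms K d))
    (u : Fin r → Forms R d) : Matrix (Fin r) (Fin r) R :=
  Matrix.of fun i i' => (extBasis R v).repr (u i) (Sum.inl i')

/-- The matrix of the last `m` coordinates of a family of forms. -/
def inrMatrix (R : Type*) [CommRing R] [Algebra K R] (v : Basis (Fin r ⊕ Fin m) K (Forms K d))
    (u : Fin r → Forms R d) : Matrix (Fin r) (Fin m) R :=
  Matrix.of fun i j => (extBasis R v).repr (u i) (Sum.inr j)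

theorem inlMatrix_map (φ : R →ₐ[K] S) (u : Fin r → Forms R d) :
    inlMatrix S v (fun i => mapForms (φ : R →+* S) (u i)) = (inlMatrix R v u).map φ := by
  ext i j
  simp [inlMatrix, extBasis_repr_map]

theorem inrMatrix_map (φ : R →ₐ[K] S) (u : Fin r → Forms R d) :
    inrMatrix S v (fun i => mapForms (φ : R →+* S) (u i)) = (inrMatrix R v u).map φ := by
  ext i j
  simp [inrMatrix, extBasis_repr_map]

theorem inlMatrix_mul (u : Fin r → Forms R d) (hu : ∀ i, u i ∈ chartSpan R v a) :
    inlMatrix R v u * Matrix.of a = inrMatrix R v u := by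
  ext i j
  simp [Matrix.mul_apply, inlMatrix, inrMatrix, repr_inr_of_mem v a (hu i)]

/-- With `M` and `N` the two blocks of coordinates, `M a = N` puts every `u i` in the row span, and
`M⁻¹` recovers the rows from the `u i`. -/
theorem span_eq_chartSpan (u : Fin r → Forms R d) (hu : IsUnit (inlMatrix R v u).det)
    (h : inlMatrix R v u * Matrix.of a = inrMatrix R v u) :
    Submodule.span R (Set.range u) = chartSpan R v a := by
  have hmem : ∀ i, u i ∈ chartSpan R v a := fun i => by
    rw [mem_chartSpan_iff]
    intro j
    have := congrFun (congrFun h i) j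
    simp only [Matrix.mul_apply, inlMatrix, inrMatrix, Matrix.of_apply] at this
    exact this.symm
  apply le_antisymm
  · rw [Submodule.span_le]
    rintro _ ⟨i, rfl⟩
    exact hmem i
  · rw [chartSpan_eq, Submodule.span_le]
    rintro _ ⟨i, rfl⟩
    have : chartRow R v a i = ∑ k, (inlMatrix R v u)⁻¹ i k • u k := by
      have h1 : ∀ k, u k = ∑ l, inlMatrix R v u k l • chartRow R v a l := fun k =>
        eq_sum_chartRow v a (hmem k)
      calc chartRow R v a i
          = ∑ l, (1 : Matrix (Fin r) (Fin r) R) i l • chartRow R v a l := by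
            simp [Matrix.one_apply]
        _ = ∑ l, ((inlMatrix R v u)⁻¹ * inlMatrix R v u) i l • chartRow R v a l := by
            rw [Matrix.nonsing_inv_mul _ hu]
        _ = _ := by
            simp only [Matrix.mul_apply, Finset.sum_smul]
            rw [Finset.sum_comm]
            refine Finset.sum_congr rfl fun k _ => ?_
            conv_rhs => rw [h1 k]
            simp [Finset.smul_sum, smul_smul]
    rw [this]
    exact Submodule.sum_mem _ fun k _ => Submodule.smul_mem _ _ (Submodule.subset_span ⟨k, rfl⟩)

/-- Expressing the rows through the `u k` and reading the first `r` coordinates produces a left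
inverse of the matrix. -/
theorem isUnit_det_inlMatrix (u : Fin r → Forms R d)
    (h : Submodule.span R (Set.range u) = chartSpan R v a) : IsUnit (inlMatrix R v u).det := by
  have hmem : ∀ i, u i ∈ chartSpan R v a := fun i => h ▸ Submodule.subset_span ⟨i, rfl⟩
  have h2 : ∀ i, ∃ c : Fin r → R, ∑ k, c k • u k = chartRow R v a i := fun i => by
    rw [← Submodule.mem_span_range_iff_exists_fun, h]
    exact chartRow_mem v a i
  choose c hc using h2
  have : Matrix.of c * inlMatrix R v u = 1 := by
    ext i j
    have := congrArg (fun f => (extBasis R v).repr f (Sum.inl j)) (hc i)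
    simp only [chartRow_repr_inl, map_sum, map_smul, Finsupp.finsetSum_apply,
      Finsupp.smul_apply, smul_eq_mul] at this
    simp only [Matrix.mul_apply, Matrix.of_apply, inlMatrix, Matrix.one_apply, this]
  exact Matrix.isUnit_det_of_left_inverse this

end Extend

/-! ## Linear coordinates -/

section Coordinates

variable {R : Type*} [CommRing R]

/-- The matrix of coefficients of four linear forms. -/
def coeffMatrix (x : Fin 4 → Forms R 1) : Matrix (Fin 4) (Fin 4) R :=
  Matrix.of fun i j => coeff (Finsupp.single j 1) (x i).1

/-- Four linear forms that form a basis of the module of linear forms. -/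
def IsCoord (x : Fin 4 → Forms R 1) : Prop := IsUnit (coeffMatrix x).det

theorem exists_eq_sum_X_mul {n : ℕ} (q : Forms R (n + 1)) :
    ∃ g : Fin 4 → Forms R n, q.1 = ∑ i, X i * (g i).1 := by
  suffices key : ∀ p ∈ homogeneousSubmodule (Fin 4) R (n + 1),
      ∃ g : Fin 4 → Forms R n, p = ∑ i, X i * (g i).1 from key q.1 q.2
  intro p hq
  rw [← homogeneousSubmodule_one_pow, pow_succ', homogeneousSubmodule_one_pow] at hq
  refine Submodule.mul_induction_on hq ?_ ?_
  · intro m hm p hp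
    rw [homogeneousSubmodule_one_eq_span_X] at hm
    obtain ⟨c, rfl⟩ := (Submodule.mem_span_range_iff_exists_fun R).1 hm
    have hp' : p.IsHomogeneous n := hp
    refine ⟨fun i => c i • mkForm p hp', ?_⟩
    simp only [Finset.sum_mul, Forms.coe_smul, coe_mkForm, smul_eq_C_mul]
    exact Finset.sum_congr rfl fun i _ => by ring
  · rintro p q ⟨g, rfl⟩ ⟨g', rfl⟩
    refine ⟨fun i => g i + g' i, ?_⟩
    simp [mul_add, Finset.sum_add_distrib]

theorem linear_eq (f : Forms R 1) : f.1 = ∑ j, C (coeff (Finsupp.single j 1) f.1) * X j := by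
  suffices key : ∀ p ∈ homogeneousSubmodule (Fin 4) R 1,
      p = ∑ j, C (coeff (Finsupp.single j 1) p) * X j from key f.1 f.2
  intro p hf
  rw [homogeneousSubmodule_one_eq_span_X] at hf
  obtain ⟨c, hc⟩ := (Submodule.mem_span_range_iff_exists_fun R).1 hf
  rw [← hc]
  refine Finset.sum_congr rfl fun i _ => ?_
  simp [coeff_sum, coeff_X, Finsupp.single_left_inj, smul_eq_C_mul]

namespace IsCoord

variable {x : Fin 4 → Forms R 1}

theorem X_eq (hx : IsCoord x) (i : Fin 4) :
    (X i : MvPolynomial (Fin 4) R) = ∑ j, C ((coeffMatrix x)⁻¹ i j) * (x j).1 := by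
  have h1 : ∀ j, (x j).1 = ∑ k, C (coeffMatrix x j k) * X k := fun j => linear_eq (x j)
  calc (X i : MvPolynomial (Fin 4) R)
      = ∑ k, C ((1 : Matrix (Fin 4) (Fin 4) R) i k) * X k := by
        simp [Matrix.one_apply, apply_ite C]
    _ = ∑ k, C (((coeffMatrix x)⁻¹ * coeffMatrix x) i k) * X k := by
        rw [Matrix.nonsing_inv_mul _ hx]
    _ = _ := by
        simp only [Matrix.mul_apply, map_sum, map_mul, Finset.sum_mul]
        rw [Finset.sum_comm]
        refine Finset.sum_congr rfl fun k _ => ?_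
        conv_rhs => rw [h1 k]
        simp [Finset.mul_sum, mul_assoc]

theorem exists_eq_sum (hx : IsCoord x) {n : ℕ} (q : Forms R (n + 1)) :
    ∃ g : Fin 4 → Forms R n, q.1 = ∑ i, (x i).1 * (g i).1 := by
  obtain ⟨g, hg⟩ := exists_eq_sum_X_mul q
  refine ⟨fun j => ∑ i, (coeffMatrix x)⁻¹ i j • g i, ?_⟩
  rw [hg]
  simp only [Forms.coe_sum, Forms.coe_smul, Finset.mul_sum]
  rw [Finset.sum_comm]
  refine Finset.sum_congr rfl fun i _ => ?_
  rw [hx.X_eq i, Finset.sum_mul]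
  exact Finset.sum_congr rfl fun j _ => by ring

/-- The inverse of a linear change of coordinates. -/
theorem exists_inverse (hx : IsCoord x) :
    ∃ τ : MvPolynomial (Fin 4) R →ₐ[R] MvPolynomial (Fin 4) R, ∀ i, τ (x i).1 = X i := by
  refine ⟨aeval fun i => ∑ j, C ((coeffMatrix x)⁻¹ i j) * X j, fun i => ?_⟩
  have h1 : (x i).1 = ∑ k, C (coeffMatrix x i k) * X k := linear_eq (x i)
  calc _ = ∑ k, C ((coeffMatrix x * (coeffMatrix x)⁻¹) i k) * X k := by
        rw [h1]
        simp only [map_sum, map_mul, aeval_X, Matrix.mul_apply, Finset.sum_mul,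
          aeval_C, algebraMap_eq]
        rw [Finset.sum_comm]
        refine Finset.sum_congr rfl fun k _ => ?_
        simp [Finset.mul_sum, mul_assoc]
    _ = X i := by
        rw [Matrix.mul_nonsing_inv _ hx]
        simp [Matrix.one_apply, apply_ite C]

theorem exists_degree_one (hx : IsCoord x) (q : Forms R 1) :
    ∃ c : Fin 4 → R, q.1 = C (c 0) * (x 0).1 + C (c 1) * (x 1).1 + C (c 2) * (x 2).1 +
      C (c 3) * (x 3).1 := by
  obtain ⟨g, hg⟩ := hx.exists_eq_sum q
  have h0 : ∀ f : Forms R 0, ∃ c, f.1 = C c := fun f =>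
    ⟨_, totalDegree_eq_zero_iff_eq_C.1 (Nat.le_zero.1 f.isHomogeneous.totalDegree_le)⟩
  choose c hc using fun i => h0 (g i)
  refine ⟨c, ?_⟩
  rw [hg]
  simp only [Fin.sum_univ_four, hc]
  ring

/-- Peeling off one factor `x i` leaves linear forms, and mixed coefficients collect the
contributions of both orders. Degree three repeats the recursion. -/
theorem exists_degree_two (hx : IsCoord x) (q : Forms R 2) :
    ∃ c00 c01 c02 c03 c11 c12 c13 c22 c23 c33 : R, q.1 =
      C c00 * (x 0).1 ^ 2 + C c01 * ((x 0).1 * (x 1).1) + C c02 * ((x 0).1 * (x 2).1) +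
      C c03 * ((x 0).1 * (x 3).1) + C c11 * (x 1).1 ^ 2 + C c12 * ((x 1).1 * (x 2).1) +
      C c13 * ((x 1).1 * (x 3).1) + C c22 * (x 2).1 ^ 2 + C c23 * ((x 2).1 * (x 3).1) +
      C c33 * (x 3).1 ^ 2 := by
  obtain ⟨g, hg⟩ := hx.exists_eq_sum q
  choose c hc using fun i => hx.exists_degree_one (g i)
  refine ⟨c 0 0, c 0 1 + c 1 0, c 0 2 + c 2 0, c 0 3 + c 3 0, c 1 1, c 1 2 + c 2 1, c 1 3 + c 3 1,
    c 2 2, c 2 3 + c 3 2, c 3 3, ?_⟩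
  rw [hg]
  simp only [Fin.sum_univ_four, hc, map_add]
  ring

theorem exists_degree_three (hx : IsCoord x) (q : Forms R 3) :
    ∃ c000 c001 c002 c003 c011 c012 c013 c022 c023 c033
      c111 c112 c113 c122 c123 c133 c222 c223 c233 c333 : R, q.1 =
      C c000 * (x 0).1 ^ 3 + C c001 * ((x 0).1 ^ 2 * (x 1).1) + C c002 * ((x 0).1 ^ 2 * (x 2).1) +
      C c003 * ((x 0).1 ^ 2 * (x 3).1) + C c011 * ((x 0).1 * (x 1).1 ^ 2) +
      C c012 * ((x 0).1 * (x 1).1 * (x 2).1) + C c013 * ((x 0).1 * (x 1).1 * (x 3).1) +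
      C c022 * ((x 0).1 * (x 2).1 ^ 2) + C c023 * ((x 0).1 * (x 2).1 * (x 3).1) +
      C c033 * ((x 0).1 * (x 3).1 ^ 2) + C c111 * (x 1).1 ^ 3 +
      C c112 * ((x 1).1 ^ 2 * (x 2).1) + C c113 * ((x 1).1 ^ 2 * (x 3).1) +
      C c122 * ((x 1).1 * (x 2).1 ^ 2) + C c123 * ((x 1).1 * (x 2).1 * (x 3).1) +
      C c133 * ((x 1).1 * (x 3).1 ^ 2) + C c222 * (x 2).1 ^ 3 +
      C c223 * ((x 2).1 ^ 2 * (x 3).1) + C c233 * ((x 2).1 * (x 3).1 ^ 2) +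
      C c333 * (x 3).1 ^ 3 := by
  obtain ⟨g, hg⟩ := hx.exists_eq_sum q
  choose c00 c01 c02 c03 c11 c12 c13 c22 c23 c33 hc using fun i => hx.exists_degree_two (g i)
  refine ⟨c00 0, c01 0 + c00 1, c02 0 + c00 2, c03 0 + c00 3, c11 0 + c01 1,
    c12 0 + c02 1 + c01 2, c13 0 + c03 1 + c01 3, c22 0 + c02 2, c23 0 + c03 2 + c02 3,
    c33 0 + c03 3, c11 1, c12 1 + c11 2, c13 1 + c11 3, c22 1 + c12 2, c23 1 + c13 2 + c12 3,
    c33 1 + c13 3, c22 2, c23 2 + c22 3, c33 2 + c23 3, c33 3, ?_⟩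
  rw [hg]
  simp only [Fin.sum_univ_four, hc, map_add]
  ring

end IsCoord

theorem coeffMatrix_mapForms {S : Type*} [CommRing S] (φ : R →+* S) (x : Fin 4 → Forms R 1) :
    coeffMatrix (fun i => mapForms φ (x i)) = (coeffMatrix x).map φ := by
  ext i j
  simp [coeffMatrix, coeff_map]

theorem IsCoord.mapForms {S : Type*} [CommRing S] (φ : R →+* S) {x : Fin 4 → Forms R 1}
    (hx : IsCoord x) : IsCoord fun i => mapForms φ (x i) := by
  rw [IsCoord, coeffMatrix_mapForms, ← RingHom.mapMatrix_apply, ← RingHom.map_det]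
  exact hx.map φ

theorem isCoord_of_linearIndependent {K : Type*} [Field K] {x : Fin 4 → Forms K 1}
    (hx : LinearIndependent K x) : IsCoord x := by
  rw [IsCoord, isUnit_iff_ne_zero]
  intro h
  obtain ⟨c, hc0, hc⟩ := Matrix.exists_vecMul_eq_zero_iff.2 h
  apply hc0
  funext i
  refine Fintype.linearIndependent_iff.1 hx c ?_ i
  apply Forms.ext
  rw [linear_eq (∑ i, c i • x i), Forms.coe_zero]
  refine Finset.sum_eq_zero fun j _ => ?_
  have h1 : coeff (Finsupp.single j 1) (∑ i, c i • x i).1 = 0 := by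
    have := congrFun hc j
    simpa [Matrix.vecMul, dotProduct, coeffMatrix, coeff_sum] using this
  rw [h1]
  simp

/-! ### Comparison of coefficients -/

/-- The exponent `(i, j, k, l)`. -/
def expo (i j k l : ℕ) : Fin 4 →₀ ℕ := Finsupp.equivFunOnFinite.symm ![i, j, k, l]

/-- The monomial `x₀ⁱ x₁ʲ x₂ᵏ x₃ˡ`. -/
def mono (R : Type*) [CommRing R] (i j k l : ℕ) : MvPolynomial (Fin 4) R :=
  X 0 ^ i * X 1 ^ j * X 2 ^ k * X 3 ^ l

theorem coeff_mono (i j k l i' j' k' l' : ℕ) (a : R) :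
    coeff (expo i j k l) (C a * mono R i' j' k' l') =
      if i' = i ∧ j' = j ∧ k' = k ∧ l' = l then a else 0 := by
  have : mono R i' j' k' l' = monomial (expo i' j' k' l') 1 := by
    rw [mono, monomial_eq, C_1, one_mul, Finsupp.prod_fintype _ _ (by simp), Fin.prod_univ_four]
    rfl
  rw [this, coeff_C_mul, coeff_monomial]
  have h : expo i' j' k' l' = expo i j k l ↔ i' = i ∧ j' = j ∧ k' = k ∧ l' = l := by
    rw [expo, expo, Equiv.apply_eq_iff_eq]
    simp
  simp [h]

end Coordinates

/-- The linear equations satisfied to first order along the locus where `ν` drops rank. -/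
theorem first_order_vanishing {S : Type*} [CommRing S] (h2 : IsUnit (2 : S))
    (e₁ e₂ t r₁ r₂ r₃ s₄ s₅ s₆ β γ δ k₁ k₂ k₃ k₄ k₅ k₆ k₇ k₈ k₉ k₁₀ k₁₁ : S)
    (hu : IsUnit β ∨ IsUnit γ ∨ IsUnit δ) (a b c h l y z : MvPolynomial (Fin 4) S)
    (hh : h = X 0) (hl : l = X 1) (hy : y = X 2) (hz : z = X 3)
    (ha : a = h ^ 2 + 2 * h * (C e₁ * y + C e₂ * z) + C t * l * (C β * l + C γ * y + C δ * z))
    (hb : b = h * l)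
    (hc : c = l ^ 2 * (C β * l + C γ * y + C δ * z) +
      l * (C s₄ * y ^ 2 + C s₅ * y * z + C s₆ * z ^ 2) +
      h * (C r₁ * y ^ 2 + C r₂ * y * z + C r₃ * z ^ 2))
    (hrel : a * c = a ^ 2 * (C k₁ * h + C k₂ * y + C k₃ * z) +
      a * b * (C k₄ * h + C k₅ * y + C k₆ * z) +
      b ^ 2 * (C k₇ * h + C k₈ * l + C k₉ * y + C k₁₀ * z) + C k₁₁ * b * c) :
    (e₁ = 0 ∧ e₂ = 0 ∧ t = 0) ∧ (r₁ = 0 ∧ r₂ = 0 ∧ r₃ = 0) ∧ (s₄ = 0 ∧ s₅ = 0 ∧ s₆ = 0) := by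
  -- This is `hrel` expanded in the monomials of degree five. Only some of its coefficients are
  -- needed below.
  have key : C (-k₁) * mono S 5 0 0 0 +
      C (-k₄) * mono S 4 1 0 0 +
      C (-k₂ - 4 * e₁ * k₁) * mono S 4 0 1 0 +
      C (-k₃ - 4 * e₂ * k₁) * mono S 4 0 0 1 +
      C (-2 * k₁ * t * β - k₇) * mono S 3 2 0 0 +
      C (-2 * k₁ * t * γ - k₅ - 2 * e₁ * k₄) * mono S 3 1 1 0 +
      C (-2 * k₁ * t * δ - k₆ - 2 * e₂ * k₄) * mono S 3 1 0 1 +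
      C (r₁ - 4 * e₁ * k₂ - 4 * e₁ ^ 2 * k₁) * mono S 3 0 2 0 +
      C (r₂ - 4 * e₁ * k₃ - 4 * e₂ * k₂ - 8 * e₁ * e₂ * k₁) * mono S 3 0 1 1 +
      C (r₃ - 4 * e₂ * k₃ - 4 * e₂ ^ 2 * k₁) * mono S 3 0 0 2 +
      C (β - k₄ * t * β - k₈) * mono S 2 3 0 0 +
      C (γ - 2 * k₂ * t * β - 4 * e₁ * k₁ * t * β - k₄ * t * γ - k₉) * mono S 2 2 1 0 +
      C (δ - 2 * k₃ * t * β - 4 * e₂ * k₁ * t * β - k₄ * t * δ - k₁₀) * mono S 2 2 0 1 +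
      C (s₄ - 2 * k₂ * t * γ - 4 * e₁ * k₁ * t * γ - 2 * e₁ * k₅ - k₁₁ * r₁) * mono S 2 1 2 0 +
      C (s₅ - 2 * k₃ * t * γ - 2 * k₂ * t * δ - 4 * e₁ * k₁ * t * δ - 4 * e₂ * k₁ * t * γ - 2 * e₁ * k₆ - 2 * e₂ * k₅ - k₁₁ * r₂) * mono S 2 1 1 1 +
      C (s₆ - 2 * k₃ * t * δ - 4 * e₂ * k₁ * t * δ - 2 * e₂ * k₆ - k₁₁ * r₃) * mono S 2 1 0 2 +
      C (2 * e₁ * r₁ - 4 * e₁ ^ 2 * k₂) * mono S 2 0 3 0 +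
      C (2 * e₁ * r₂ + 2 * e₂ * r₁ - 4 * e₁ ^ 2 * k₃ - 8 * e₁ * e₂ * k₂) * mono S 2 0 2 1 +
      C (2 * e₁ * r₃ + 2 * e₂ * r₂ - 8 * e₁ * e₂ * k₃ - 4 * e₂ ^ 2 * k₂) * mono S 2 0 1 2 +
      C (2 * e₂ * r₃ - 4 * e₂ ^ 2 * k₃) * mono S 2 0 0 3 +
      C (-k₁ * t ^ 2 * β ^ 2 - k₁₁ * β) * mono S 1 4 0 0 +
      C (2 * e₁ * β - 2 * k₁ * t ^ 2 * β * γ - k₅ * t * β - k₁₁ * γ) * mono S 1 3 1 0 +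
      C (2 * e₂ * β - 2 * k₁ * t ^ 2 * β * δ - k₆ * t * β - k₁₁ * δ) * mono S 1 3 0 1 +
      C (2 * e₁ * γ + r₁ * t * β - 4 * e₁ * k₂ * t * β - k₁ * t ^ 2 * γ ^ 2 - k₅ * t * γ - k₁₁ * s₄) * mono S 1 2 2 0 +
      C (2 * e₁ * δ + 2 * e₂ * γ + r₂ * t * β - 4 * e₁ * k₃ * t * β - 4 * e₂ * k₂ * t * β - 2 * k₁ * t ^ 2 * γ * δ - k₆ * t * γ - k₅ * t * δ - k₁₁ * s₅) * mono S 1 2 1 1 +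
      C (2 * e₂ * δ + r₃ * t * β - 4 * e₂ * k₃ * t * β - k₁ * t ^ 2 * δ ^ 2 - k₆ * t * δ - k₁₁ * s₆) * mono S 1 2 0 2 +
      C (2 * e₁ * s₄ + r₁ * t * γ - 4 * e₁ * k₂ * t * γ) * mono S 1 1 3 0 +
      C (2 * e₁ * s₅ + 2 * e₂ * s₄ + r₂ * t * γ + r₁ * t * δ - 4 * e₁ * k₃ * t * γ - 4 * e₁ * k₂ * t * δ - 4 * e₂ * k₂ * t * γ) * mono S 1 1 2 1 +
      C (2 * e₁ * s₆ + 2 * e₂ * s₅ + r₃ * t * γ + r₂ * t * δ - 4 * e₁ * k₃ * t * δ - 4 * e₂ * k₃ * t * γ - 4 * e₂ * k₂ * t * δ) * mono S 1 1 1 2 +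
      C (2 * e₂ * s₆ + r₃ * t * δ - 4 * e₂ * k₃ * t * δ) * mono S 1 1 0 3 +
      C (t * β ^ 2) * mono S 0 5 0 0 +
      C (2 * t * β * γ - k₂ * t ^ 2 * β ^ 2) * mono S 0 4 1 0 +
      C (2 * t * β * δ - k₃ * t ^ 2 * β ^ 2) * mono S 0 4 0 1 +
      C (s₄ * t * β + t * γ ^ 2 - 2 * k₂ * t ^ 2 * β * γ) * mono S 0 3 2 0 +
      C (s₅ * t * β + 2 * t * γ * δ - 2 * k₃ * t ^ 2 * β * γ - 2 * k₂ * t ^ 2 * β * δ) * mono S 0 3 1 1 +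
      C (s₆ * t * β + t * δ ^ 2 - 2 * k₃ * t ^ 2 * β * δ) * mono S 0 3 0 2 +
      C (s₄ * t * γ - k₂ * t ^ 2 * γ ^ 2) * mono S 0 2 3 0 +
      C (s₅ * t * γ + s₄ * t * δ - k₃ * t ^ 2 * γ ^ 2 - 2 * k₂ * t ^ 2 * γ * δ) * mono S 0 2 2 1 +
      C (s₆ * t * γ + s₅ * t * δ - 2 * k₃ * t ^ 2 * γ * δ - k₂ * t ^ 2 * δ ^ 2) * mono S 0 2 1 2 +
      C (s₆ * t * δ - k₃ * t ^ 2 * δ ^ 2) * mono S 0 2 0 3 = 0 := by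
    subst ha hb hc hh hl hy hz
    simp only [mono, C_add, C_sub, C_mul, C_neg, C_pow, map_ofNat]
    linear_combination hrel
  have c5000 : -k₁ = 0 := by
    have := congrArg (coeff (expo 5 0 0 0)) key
    simpa only [coeff_add, coeff_mono, coeff_zero, Nat.reduceEqDiff, OfNat.ofNat_ne_zero, OfNat.zero_ne_ofNat, OfNat.ofNat_ne_one, OfNat.one_ne_ofNat, zero_ne_one, one_ne_zero, and_self, and_false, false_and, if_true, if_false, add_zero, zero_add] using this
  have c4100 : -k₄ = 0 := by
    have := congrArg (coeff (expo 4 1 0 0)) key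
    simpa only [coeff_add, coeff_mono, coeff_zero, Nat.reduceEqDiff, OfNat.ofNat_ne_zero, OfNat.zero_ne_ofNat, OfNat.ofNat_ne_one, OfNat.one_ne_ofNat, zero_ne_one, one_ne_zero, and_self, and_false, false_and, if_true, if_false, add_zero, zero_add] using this
  have c4010 : -k₂ - 4 * e₁ * k₁ = 0 := by
    have := congrArg (coeff (expo 4 0 1 0)) key
    simpa only [coeff_add, coeff_mono, coeff_zero, Nat.reduceEqDiff, OfNat.ofNat_ne_zero, OfNat.zero_ne_ofNat, OfNat.ofNat_ne_one, OfNat.one_ne_ofNat, zero_ne_one, one_ne_zero, and_self, and_false, false_and, if_true, if_false, add_zero, zero_add] using this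
  have c4001 : -k₃ - 4 * e₂ * k₁ = 0 := by
    have := congrArg (coeff (expo 4 0 0 1)) key
    simpa only [coeff_add, coeff_mono, coeff_zero, Nat.reduceEqDiff, OfNat.ofNat_ne_zero, OfNat.zero_ne_ofNat, OfNat.ofNat_ne_one, OfNat.one_ne_ofNat, zero_ne_one, one_ne_zero, and_self, and_false, false_and, if_true, if_false, add_zero, zero_add] using this
  have c3110 : -2 * k₁ * t * γ - k₅ - 2 * e₁ * k₄ = 0 := by
    have := congrArg (coeff (expo 3 1 1 0)) key
    simpa only [coeff_add, coeff_mono, coeff_zero, Nat.reduceEqDiff, OfNat.ofNat_ne_zero, OfNat.zero_ne_ofNat, OfNat.ofNat_ne_one, OfNat.one_ne_ofNat, zero_ne_one, one_ne_zero, and_self, and_false, false_and, if_true, if_false, add_zero, zero_add] using this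
  have c3101 : -2 * k₁ * t * δ - k₆ - 2 * e₂ * k₄ = 0 := by
    have := congrArg (coeff (expo 3 1 0 1)) key
    simpa only [coeff_add, coeff_mono, coeff_zero, Nat.reduceEqDiff, OfNat.ofNat_ne_zero, OfNat.zero_ne_ofNat, OfNat.ofNat_ne_one, OfNat.one_ne_ofNat, zero_ne_one, one_ne_zero, and_self, and_false, false_and, if_true, if_false, add_zero, zero_add] using this
  have c3020 : r₁ - 4 * e₁ * k₂ - 4 * e₁ ^ 2 * k₁ = 0 := by
    have := congrArg (coeff (expo 3 0 2 0)) key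
    simpa only [coeff_add, coeff_mono, coeff_zero, Nat.reduceEqDiff, OfNat.ofNat_ne_zero, OfNat.zero_ne_ofNat, OfNat.ofNat_ne_one, OfNat.one_ne_ofNat, zero_ne_one, one_ne_zero, and_self, and_false, false_and, if_true, if_false, add_zero, zero_add] using this
  have c3011 : r₂ - 4 * e₁ * k₃ - 4 * e₂ * k₂ - 8 * e₁ * e₂ * k₁ = 0 := by
    have := congrArg (coeff (expo 3 0 1 1)) key
    simpa only [coeff_add, coeff_mono, coeff_zero, Nat.reduceEqDiff, OfNat.ofNat_ne_zero, OfNat.zero_ne_ofNat, OfNat.ofNat_ne_one, OfNat.one_ne_ofNat, zero_ne_one, one_ne_zero, and_self, and_false, false_and, if_true, if_false, add_zero, zero_add] using this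
  have c3002 : r₃ - 4 * e₂ * k₃ - 4 * e₂ ^ 2 * k₁ = 0 := by
    have := congrArg (coeff (expo 3 0 0 2)) key
    simpa only [coeff_add, coeff_mono, coeff_zero, Nat.reduceEqDiff, OfNat.ofNat_ne_zero, OfNat.zero_ne_ofNat, OfNat.ofNat_ne_one, OfNat.one_ne_ofNat, zero_ne_one, one_ne_zero, and_self, and_false, false_and, if_true, if_false, add_zero, zero_add] using this
  have c2120 : s₄ - 2 * k₂ * t * γ - 4 * e₁ * k₁ * t * γ - 2 * e₁ * k₅ - k₁₁ * r₁ = 0 := by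
    have := congrArg (coeff (expo 2 1 2 0)) key
    simpa only [coeff_add, coeff_mono, coeff_zero, Nat.reduceEqDiff, OfNat.ofNat_ne_zero, OfNat.zero_ne_ofNat, OfNat.ofNat_ne_one, OfNat.one_ne_ofNat, zero_ne_one, one_ne_zero, and_self, and_false, false_and, if_true, if_false, add_zero, zero_add] using this
  have c2111 : s₅ - 2 * k₃ * t * γ - 2 * k₂ * t * δ - 4 * e₁ * k₁ * t * δ - 4 * e₂ * k₁ * t * γ - 2 * e₁ * k₆ - 2 * e₂ * k₅ - k₁₁ * r₂ = 0 := by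
    have := congrArg (coeff (expo 2 1 1 1)) key
    simpa only [coeff_add, coeff_mono, coeff_zero, Nat.reduceEqDiff, OfNat.ofNat_ne_zero, OfNat.zero_ne_ofNat, OfNat.ofNat_ne_one, OfNat.one_ne_ofNat, zero_ne_one, one_ne_zero, and_self, and_false, false_and, if_true, if_false, add_zero, zero_add] using this
  have c2102 : s₆ - 2 * k₃ * t * δ - 4 * e₂ * k₁ * t * δ - 2 * e₂ * k₆ - k₁₁ * r₃ = 0 := by
    have := congrArg (coeff (expo 2 1 0 2)) key
    simpa only [coeff_add, coeff_mono, coeff_zero, Nat.reduceEqDiff, OfNat.ofNat_ne_zero, OfNat.zero_ne_ofNat, OfNat.ofNat_ne_one, OfNat.one_ne_ofNat, zero_ne_one, one_ne_zero, and_self, and_false, false_and, if_true, if_false, add_zero, zero_add] using this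
  have c1400 : -k₁ * t ^ 2 * β ^ 2 - k₁₁ * β = 0 := by
    have := congrArg (coeff (expo 1 4 0 0)) key
    simpa only [coeff_add, coeff_mono, coeff_zero, Nat.reduceEqDiff, OfNat.ofNat_ne_zero, OfNat.zero_ne_ofNat, OfNat.ofNat_ne_one, OfNat.one_ne_ofNat, zero_ne_one, one_ne_zero, and_self, and_false, false_and, if_true, if_false, add_zero, zero_add] using this
  have c1310 : 2 * e₁ * β - 2 * k₁ * t ^ 2 * β * γ - k₅ * t * β - k₁₁ * γ = 0 := by
    have := congrArg (coeff (expo 1 3 1 0)) key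
    simpa only [coeff_add, coeff_mono, coeff_zero, Nat.reduceEqDiff, OfNat.ofNat_ne_zero, OfNat.zero_ne_ofNat, OfNat.ofNat_ne_one, OfNat.one_ne_ofNat, zero_ne_one, one_ne_zero, and_self, and_false, false_and, if_true, if_false, add_zero, zero_add] using this
  have c1301 : 2 * e₂ * β - 2 * k₁ * t ^ 2 * β * δ - k₆ * t * β - k₁₁ * δ = 0 := by
    have := congrArg (coeff (expo 1 3 0 1)) key
    simpa only [coeff_add, coeff_mono, coeff_zero, Nat.reduceEqDiff, OfNat.ofNat_ne_zero, OfNat.zero_ne_ofNat, OfNat.ofNat_ne_one, OfNat.one_ne_ofNat, zero_ne_one, one_ne_zero, and_self, and_false, false_and, if_true, if_false, add_zero, zero_add] using this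
  have c1220 : 2 * e₁ * γ + r₁ * t * β - 4 * e₁ * k₂ * t * β - k₁ * t ^ 2 * γ ^ 2 - k₅ * t * γ - k₁₁ * s₄ = 0 := by
    have := congrArg (coeff (expo 1 2 2 0)) key
    simpa only [coeff_add, coeff_mono, coeff_zero, Nat.reduceEqDiff, OfNat.ofNat_ne_zero, OfNat.zero_ne_ofNat, OfNat.ofNat_ne_one, OfNat.one_ne_ofNat, zero_ne_one, one_ne_zero, and_self, and_false, false_and, if_true, if_false, add_zero, zero_add] using this
  have c1211 : 2 * e₁ * δ + 2 * e₂ * γ + r₂ * t * β - 4 * e₁ * k₃ * t * β - 4 * e₂ * k₂ * t * β - 2 * k₁ * t ^ 2 * γ * δ - k₆ * t * γ - k₅ * t * δ - k₁₁ * s₅ = 0 := by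
    have := congrArg (coeff (expo 1 2 1 1)) key
    simpa only [coeff_add, coeff_mono, coeff_zero, Nat.reduceEqDiff, OfNat.ofNat_ne_zero, OfNat.zero_ne_ofNat, OfNat.ofNat_ne_one, OfNat.one_ne_ofNat, zero_ne_one, one_ne_zero, and_self, and_false, false_and, if_true, if_false, add_zero, zero_add] using this
  have c1202 : 2 * e₂ * δ + r₃ * t * β - 4 * e₂ * k₃ * t * β - k₁ * t ^ 2 * δ ^ 2 - k₆ * t * δ - k₁₁ * s₆ = 0 := by
    have := congrArg (coeff (expo 1 2 0 2)) key
    simpa only [coeff_add, coeff_mono, coeff_zero, Nat.reduceEqDiff, OfNat.ofNat_ne_zero, OfNat.zero_ne_ofNat, OfNat.ofNat_ne_one, OfNat.one_ne_ofNat, zero_ne_one, one_ne_zero, and_self, and_false, false_and, if_true, if_false, add_zero, zero_add] using this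
  have c0500 : t * β ^ 2 = 0 := by
    have := congrArg (coeff (expo 0 5 0 0)) key
    simpa only [coeff_add, coeff_mono, coeff_zero, Nat.reduceEqDiff, OfNat.ofNat_ne_zero, OfNat.zero_ne_ofNat, OfNat.ofNat_ne_one, OfNat.one_ne_ofNat, zero_ne_one, one_ne_zero, and_self, and_false, false_and, if_true, if_false, add_zero, zero_add] using this
  have c0320 : s₄ * t * β + t * γ ^ 2 - 2 * k₂ * t ^ 2 * β * γ = 0 := by
    have := congrArg (coeff (expo 0 3 2 0)) key
    simpa only [coeff_add, coeff_mono, coeff_zero, Nat.reduceEqDiff, OfNat.ofNat_ne_zero, OfNat.zero_ne_ofNat, OfNat.ofNat_ne_one, OfNat.one_ne_ofNat, zero_ne_one, one_ne_zero, and_self, and_false, false_and, if_true, if_false, add_zero, zero_add] using this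
  have c0302 : s₆ * t * β + t * δ ^ 2 - 2 * k₃ * t ^ 2 * β * δ = 0 := by
    have := congrArg (coeff (expo 0 3 0 2)) key
    simpa only [coeff_add, coeff_mono, coeff_zero, Nat.reduceEqDiff, OfNat.ofNat_ne_zero, OfNat.zero_ne_ofNat, OfNat.ofNat_ne_one, OfNat.one_ne_ofNat, zero_ne_one, one_ne_zero, and_self, and_false, false_and, if_true, if_false, add_zero, zero_add] using this
  -- The monomials divisible by `h³` kill `k₁, …, k₆` and then `r₁, r₂, r₃`; those of the form `h²
  -- l` times a quadric in `y, z` kill `s₄, s₅, s₆`.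
  have k1 : k₁ = 0 := by linear_combination -c5000
  subst k1
  have k4 : k₄ = 0 := by linear_combination -c4100
  subst k4
  have k2 : k₂ = 0 := by linear_combination -c4010
  subst k2
  have k3 : k₃ = 0 := by linear_combination -c4001
  subst k3
  have k5 : k₅ = 0 := by linear_combination -c3110
  subst k5
  have k6 : k₆ = 0 := by linear_combination -c3101
  subst k6
  have r1 : r₁ = 0 := by linear_combination c3020
  have r2 : r₂ = 0 := by linear_combination c3011
  have r3 : r₃ = 0 := by linear_combination c3002
  subst r1 r2 r3
  have s4 : s₄ = 0 := by linear_combination c2120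
  have s5 : s₅ = 0 := by linear_combination c2111
  have s6 : s₆ = 0 := by linear_combination c2102
  subst s4 s5 s6
  refine ⟨?_, ⟨rfl, rfl, rfl⟩, rfl, rfl, rfl⟩
  -- Put `G = β l + γ y + δ z` and `e = e₁ y + e₂ z`. What remains is `2 e G = k₁₁ l G` from the
  -- part linear in `h`, and `t G² = 0` from the part free of `h`. A unit coefficient of `G` then
  -- forces `e = 0` and `t = 0`.
  have hβ : k₁₁ * β = 0 := by linear_combination -c1400
  have b1 : 2 * e₁ * β = k₁₁ * γ := by linear_combination c1310
  have b2 : 2 * e₂ * β = k₁₁ * δ := by linear_combination c1301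
  have g1 : 2 * (e₁ * γ) = 0 := by linear_combination c1220
  have g2 : 2 * (e₁ * δ + e₂ * γ) = 0 := by linear_combination c1211
  have g3 : 2 * (e₂ * δ) = 0 := by linear_combination c1202
  rw [h2.mul_right_eq_zero] at g1 g2 g3
  have t1 : t * β ^ 2 = 0 := c0500
  have t2 : t * γ ^ 2 = 0 := by linear_combination c0320
  have t3 : t * δ ^ 2 = 0 := by linear_combination c0302
  rcases hu with hu | hu | hu
  · rw [hu.mul_left_eq_zero] at hβ
    rw [hβ, zero_mul, hu.mul_left_eq_zero, h2.mul_right_eq_zero] at b1 b2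
    exact ⟨b1, b2, ((hu.pow 2).mul_left_eq_zero).1 t1⟩
  · rw [hu.mul_left_eq_zero] at g1
    rw [g1, zero_mul, zero_add, hu.mul_left_eq_zero] at g2
    exact ⟨g1, g2, ((hu.pow 2).mul_left_eq_zero).1 t2⟩
  · rw [hu.mul_left_eq_zero] at g3
    rw [g3, zero_mul, add_zero, hu.mul_left_eq_zero] at g2
    exact ⟨g2, g3, ((hu.pow 2).mul_left_eq_zero).1 t3⟩

/-! ## Pencils and their frames -/

section Frames

variable {R : Type*} [CommRing R]

/-- The product of two linear forms. -/
def mul11 (f g : Forms R 1) : Forms R 2 := mulForms R 1 1 f g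

/-- The product of a quadric and a linear form. -/
def mul21 (f : Forms R 2) (g : Forms R 1) : Forms R 3 := mulForms R 2 1 f g

/-- The product of a quadric and a cubic. -/
def mul23 (f : Forms R 2) (g : Forms R 3) : Forms R 5 := mulForms R 2 3 f g

@[simp] theorem coe_mul11 (f g : Forms R 1) : (mul11 f g).1 = f.1 * g.1 := rfl
@[simp] theorem coe_mul21 (f : Forms R 2) (g : Forms R 1) : (mul21 f g).1 = f.1 * g.1 := rfl
@[simp] theorem coe_mul23 (f : Forms R 2) (g : Forms R 3) : (mul23 f g).1 = f.1 * g.1 := rfl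

@[simp] theorem mapForms_mul11 {S : Type*} [CommRing S] (φ : R →+* S) (f g : Forms R 1) :
    mapForms φ (mul11 f g) = mul11 (mapForms φ f) (mapForms φ g) := mapForms_mulForms φ f g
@[simp] theorem mapForms_mul21 {S : Type*} [CommRing S] (φ : R →+* S) (f : Forms R 2)
    (g : Forms R 1) : mapForms φ (mul21 f g) = mul21 (mapForms φ f) (mapForms φ g) :=
  mapForms_mulForms φ f g
@[simp] theorem mapForms_mul23 {S : Type*} [CommRing S] (φ : R →+* S) (f : Forms R 2)
    (g : Forms R 3) : mapForms φ (mul23 f g) = mul23 (mapForms φ f) (mapForms φ g) :=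
  mapForms_mulForms φ f g

/-- Eight cubics: seven of the products of the quadrics `a`, `b` with the linear forms `x i`,
and the cubic `c`. -/
def cubicFrame (a b : Forms R 2) (x : Fin 4 → Forms R 1) (c : Forms R 3) : Fin 8 → Forms R 3 :=
  ![mul21 a (x 0), mul21 a (x 2), mul21 a (x 3), mul21 b (x 0), mul21 b (x 1), mul21 b (x 2),
    mul21 b (x 3), c]

theorem mapForms_cubicFrame {S : Type*} [CommRing S] (φ : R →+* S) (a b : Forms R 2)
    (x : Fin 4 → Forms R 1) (c : Forms R 3) (i : Fin 8) :
    mapForms φ (cubicFrame a b x c i) =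
      cubicFrame (mapForms φ a) (mapForms φ b) (fun j => mapForms φ (x j)) (mapForms φ c) i := by
  fin_cases i <;> simp [cubicFrame]

end Frames

/-! ## Chart spans over a local ring -/

section Local

variable {K : Type*} [Field K] {O : Type*} [CommRing O] [Algebra K O] (ε : O →ₐ[K] K)

/-- For `r` in the kernel, `r y + 1` has residue `1`, hence is a unit. This is the hypothesis of
Nakayama's lemma. -/
theorem isUnit_of_residue (hε : ∀ r, ε r ≠ 0 → IsUnit r) :
    RingHom.ker (ε : O →+* K) ≤ Ideal.jacobson ⊥ := by
  intro r hr
  rw [Ideal.mem_jacobson_bot]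
  intro y
  apply hε
  have : ε r = 0 := hr
  simp [this]

/-- Nakayama's lemma for the row module: elements whose residues generate at the point generate over
the local ring. -/
theorem span_eq_chartSpan_of_residue (hε : ∀ r, ε r ≠ 0 → IsUnit r) {d r m : ℕ}
    (v : Basis (Fin r ⊕ Fin m) K (Forms K d)) (a : Fin r → Fin m → O) {ι : Type*} [Fintype ι]
    (u : ι → Forms O d)
    (hu : ∀ i, u i ∈ chartSpan O v a)
    (h : chartSpan K v (fun i j => ε (a i j)) ≤
      Submodule.span K (Set.range fun i => mapForms (ε : O →+* K) (u i))) :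
    Submodule.span O (Set.range u) = chartSpan O v a := by
  apply le_antisymm
  · rw [Submodule.span_le]
    rintro _ ⟨i, rfl⟩
    exact hu i
  · refine Submodule.le_of_le_smul_of_le_jacobson_bot (I := RingHom.ker (ε : O →+* K)) ?_
      (isUnit_of_residue ε hε) ?_
    · exact Submodule.fg_span (Set.finite_range _)
    · conv_lhs => rw [chartSpan_eq]
      rw [Submodule.span_le]
      rintro _ ⟨i, rfl⟩
      have h1 := h (mapForms_mem_chartSpan v a ε (chartRow_mem v a i))
      rw [Submodule.mem_span_range_iff_exists_fun] at h1
      obtain ⟨c, hc⟩ := h1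
      -- The constants that express the residue of the row are lifted to `O`. The difference from
      -- the row has zero residue, so its coordinates in the rows lie in the kernel of `ε`.
      set g := ∑ j, algebraMap K O (c j) • u j with hg
      have hgm : g ∈ Submodule.span O (Set.range u) :=
        Submodule.sum_mem _ fun j _ => Submodule.smul_mem _ _ (Submodule.subset_span ⟨j, rfl⟩)
      have hgm' : g ∈ chartSpan O v a :=
        Submodule.sum_mem _ fun j _ => Submodule.smul_mem _ _ (hu j)
      have h0 : mapForms (ε : O →+* K) (chartRow O v a i - g) = 0 := by
        rw [mapForms_sub, hg, mapForms_sum, ← hc, sub_eq_zero]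
        exact Finset.sum_congr rfl fun j _ => by simp
      have h2 : chartRow O v a i - g ∈ RingHom.ker (ε : O →+* K) • chartSpan O v a := by
        rw [eq_sum_chartRow v a (sub_mem (chartRow_mem v a i) hgm')]
        refine Submodule.sum_mem _ fun k _ => Submodule.smul_mem_smul ?_ (chartRow_mem v a k)
        rw [RingHom.mem_ker]
        have := extBasis_repr_map ε v (chartRow O v a i - g) (Sum.inl k)
        rw [h0] at this
        simpa using this.symm
      have : chartRow O v a i = g + (chartRow O v a i - g) := by abel
      rw [this]
      exact Submodule.add_mem_sup hgm h2

theorem exists_lift_mem_chartSpan {d r m : ℕ}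
    (v : Basis (Fin r ⊕ Fin m) K (Forms K d)) (a : Fin r → Fin m → O)
    {g : Forms K d} (hg : g ∈ chartSpan K v (fun i j => ε (a i j))) :
    ∃ f ∈ chartSpan O v a, mapForms (ε : O →+* K) f = g := by
  refine ⟨∑ i, algebraMap K O ((extBasis K v).repr g (Sum.inl i)) • chartRow O v a i,
    Submodule.sum_mem _ fun i _ => Submodule.smul_mem _ _ (chartRow_mem v a i), ?_⟩
  conv_rhs => rw [eq_sum_chartRow v _ hg]
  rw [mapForms_sum]
  refine Finset.sum_congr rfl fun i _ => ?_
  rw [mapForms_smul, mapForms_chartRow]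
  simp

theorem isCoord_of_residue (hε : ∀ r, ε r ≠ 0 → IsUnit r) {x : Fin 4 → Forms O 1}
    {x₀ : Fin 4 → Forms K 1} (hx₀ : IsCoord x₀)
    (hx : ∀ i, mapForms (ε : O →+* K) (x i) = x₀ i) : IsCoord x := by
  apply hε
  have h : (coeffMatrix x).map (ε : O →+* K) = coeffMatrix x₀ := by
    rw [← coeffMatrix_mapForms]
    simp only [hx]
  have h1 : (ε : O →+* K) (coeffMatrix x).det = (coeffMatrix x₀).det := by
    rw [RingHom.map_det, RingHom.mapMatrix_apply, h]
  intro h2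
  apply hx₀.ne_zero
  rw [← h1]
  exact h2

end Local

/-! ### Uniqueness of coefficients in linear coordinates -/

section Unique

variable {R : Type*} [CommRing R]

/-- The inverse substitution turns the `x i` into the variables, where coefficients of monomials can
be compared. -/
theorem IsCoord.degree_two_unique {x : Fin 4 → Forms R 1} (hx : IsCoord x)
    {c00 c01 c02 c03 c11 c12 c13 c22 c23 c33 : R}
    (h : C c00 * ((x 0).1 * (x 0).1) +
      C c01 * ((x 0).1 * (x 1).1) +
      C c02 * ((x 0).1 * (x 2).1) +
      C c03 * ((x 0).1 * (x 3).1) +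
      C c11 * ((x 1).1 * (x 1).1) +
      C c12 * ((x 1).1 * (x 2).1) +
      C c13 * ((x 1).1 * (x 3).1) +
      C c22 * ((x 2).1 * (x 2).1) +
      C c23 * ((x 2).1 * (x 3).1) +
      C c33 * ((x 3).1 * (x 3).1) = 0) :
    c00 = 0 ∧ c01 = 0 ∧ c02 = 0 ∧ c03 = 0 ∧ c11 = 0 ∧ c12 = 0 ∧ c13 = 0 ∧ c22 = 0 ∧ c23 = 0 ∧ c33 = 0 := by
  obtain ⟨τ, hτ⟩ := hx.exists_inverse
  have key : C c00 * mono R 2 0 0 0 +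
      C c01 * mono R 1 1 0 0 +
      C c02 * mono R 1 0 1 0 +
      C c03 * mono R 1 0 0 1 +
      C c11 * mono R 0 2 0 0 +
      C c12 * mono R 0 1 1 0 +
      C c13 * mono R 0 1 0 1 +
      C c22 * mono R 0 0 2 0 +
      C c23 * mono R 0 0 1 1 +
      C c33 * mono R 0 0 0 2 = 0 := by
    have := congrArg τ h
    simp only [map_add, map_mul, hτ, algHom_C, algebraMap_eq, map_zero] at this
    simp only [mono]
    linear_combination this
  refine ⟨?_, ?_, ?_, ?_, ?_, ?_, ?_, ?_, ?_, ?_⟩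
  · have := congrArg (coeff (expo 2 0 0 0)) key
    simpa only [coeff_add, coeff_mono, coeff_zero, Nat.reduceEqDiff, OfNat.ofNat_ne_zero, OfNat.zero_ne_ofNat,
      OfNat.ofNat_ne_one, OfNat.one_ne_ofNat, zero_ne_one, one_ne_zero, and_self, and_false, false_and, if_true,
      if_false, add_zero, zero_add] using this
  · have := congrArg (coeff (expo 1 1 0 0)) key
    simpa only [coeff_add, coeff_mono, coeff_zero, Nat.reduceEqDiff, OfNat.ofNat_ne_zero, OfNat.zero_ne_ofNat,
      OfNat.ofNat_ne_one, OfNat.one_ne_ofNat, zero_ne_one, one_ne_zero, and_self, and_false, false_and, if_true,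
      if_false, add_zero, zero_add] using this
  · have := congrArg (coeff (expo 1 0 1 0)) key
    simpa only [coeff_add, coeff_mono, coeff_zero, Nat.reduceEqDiff, OfNat.ofNat_ne_zero, OfNat.zero_ne_ofNat,
      OfNat.ofNat_ne_one, OfNat.one_ne_ofNat, zero_ne_one, one_ne_zero, and_self, and_false, false_and, if_true,
      if_false, add_zero, zero_add] using this
  · have := congrArg (coeff (expo 1 0 0 1)) key
    simpa only [coeff_add, coeff_mono, coeff_zero, Nat.reduceEqDiff, OfNat.ofNat_ne_zero, OfNat.zero_ne_ofNat,
      OfNat.ofNat_ne_one, OfNat.one_ne_ofNat, zero_ne_one, one_ne_zero, and_self, and_false, false_and, if_true,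
      if_false, add_zero, zero_add] using this
  · have := congrArg (coeff (expo 0 2 0 0)) key
    simpa only [coeff_add, coeff_mono, coeff_zero, Nat.reduceEqDiff, OfNat.ofNat_ne_zero, OfNat.zero_ne_ofNat,
      OfNat.ofNat_ne_one, OfNat.one_ne_ofNat, zero_ne_one, one_ne_zero, and_self, and_false, false_and, if_true,
      if_false, add_zero, zero_add] using this
  · have := congrArg (coeff (expo 0 1 1 0)) key
    simpa only [coeff_add, coeff_mono, coeff_zero, Nat.reduceEqDiff, OfNat.ofNat_ne_zero, OfNat.zero_ne_ofNat,
      OfNat.ofNat_ne_one, OfNat.one_ne_ofNat, zero_ne_one, one_ne_zero, and_self, and_false, false_and, if_true,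
      if_false, add_zero, zero_add] using this
  · have := congrArg (coeff (expo 0 1 0 1)) key
    simpa only [coeff_add, coeff_mono, coeff_zero, Nat.reduceEqDiff, OfNat.ofNat_ne_zero, OfNat.zero_ne_ofNat,
      OfNat.ofNat_ne_one, OfNat.one_ne_ofNat, zero_ne_one, one_ne_zero, and_self, and_false, false_and, if_true,
      if_false, add_zero, zero_add] using this
  · have := congrArg (coeff (expo 0 0 2 0)) key
    simpa only [coeff_add, coeff_mono, coeff_zero, Nat.reduceEqDiff, OfNat.ofNat_ne_zero, OfNat.zero_ne_ofNat,
      OfNat.ofNat_ne_one, OfNat.one_ne_ofNat, zero_ne_one, one_ne_zero, and_self, and_false, false_and, if_true,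
      if_false, add_zero, zero_add] using this
  · have := congrArg (coeff (expo 0 0 1 1)) key
    simpa only [coeff_add, coeff_mono, coeff_zero, Nat.reduceEqDiff, OfNat.ofNat_ne_zero, OfNat.zero_ne_ofNat,
      OfNat.ofNat_ne_one, OfNat.one_ne_ofNat, zero_ne_one, one_ne_zero, and_self, and_false, false_and, if_true,
      if_false, add_zero, zero_add] using this
  · have := congrArg (coeff (expo 0 0 0 2)) key
    simpa only [coeff_add, coeff_mono, coeff_zero, Nat.reduceEqDiff, OfNat.ofNat_ne_zero, OfNat.zero_ne_ofNat,
      OfNat.ofNat_ne_one, OfNat.one_ne_ofNat, zero_ne_one, one_ne_zero, and_self, and_false, false_and, if_true,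
      if_false, add_zero, zero_add] using this

theorem IsCoord.degree_three_unique {x : Fin 4 → Forms R 1} (hx : IsCoord x)
    {c000 c001 c002 c003 c011 c012 c013 c022 c023 c033 c111 c112 c113 c122 c123 c133 c222 c223 c233 c333 : R}
    (h : C c000 * ((x 0).1 * (x 0).1 * (x 0).1) +
      C c001 * ((x 0).1 * (x 0).1 * (x 1).1) +
      C c002 * ((x 0).1 * (x 0).1 * (x 2).1) +
      C c003 * ((x 0).1 * (x 0).1 * (x 3).1) +
      C c011 * ((x 0).1 * (x 1).1 * (x 1).1) +
      C c012 * ((x 0).1 * (x 1).1 * (x 2).1) +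
      C c013 * ((x 0).1 * (x 1).1 * (x 3).1) +
      C c022 * ((x 0).1 * (x 2).1 * (x 2).1) +
      C c023 * ((x 0).1 * (x 2).1 * (x 3).1) +
      C c033 * ((x 0).1 * (x 3).1 * (x 3).1) +
      C c111 * ((x 1).1 * (x 1).1 * (x 1).1) +
      C c112 * ((x 1).1 * (x 1).1 * (x 2).1) +
      C c113 * ((x 1).1 * (x 1).1 * (x 3).1) +
      C c122 * ((x 1).1 * (x 2).1 * (x 2).1) +
      C c123 * ((x 1).1 * (x 2).1 * (x 3).1) +
      C c133 * ((x 1).1 * (x 3).1 * (x 3).1) +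
      C c222 * ((x 2).1 * (x 2).1 * (x 2).1) +
      C c223 * ((x 2).1 * (x 2).1 * (x 3).1) +
      C c233 * ((x 2).1 * (x 3).1 * (x 3).1) +
      C c333 * ((x 3).1 * (x 3).1 * (x 3).1) = 0) :
    c000 = 0 ∧ c001 = 0 ∧ c002 = 0 ∧ c003 = 0 ∧ c011 = 0 ∧ c012 = 0 ∧ c013 = 0 ∧ c022 = 0 ∧ c023 = 0 ∧ c033 = 0 ∧ c111 = 0 ∧ c112 = 0 ∧ c113 = 0 ∧ c122 = 0 ∧ c123 = 0 ∧ c133 = 0 ∧ c222 = 0 ∧ c223 = 0 ∧ c233 = 0 ∧ c333 = 0 := by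
  obtain ⟨τ, hτ⟩ := hx.exists_inverse
  have key : C c000 * mono R 3 0 0 0 +
      C c001 * mono R 2 1 0 0 +
      C c002 * mono R 2 0 1 0 +
      C c003 * mono R 2 0 0 1 +
      C c011 * mono R 1 2 0 0 +
      C c012 * mono R 1 1 1 0 +
      C c013 * mono R 1 1 0 1 +
      C c022 * mono R 1 0 2 0 +
      C c023 * mono R 1 0 1 1 +
      C c033 * mono R 1 0 0 2 +
      C c111 * mono R 0 3 0 0 +
      C c112 * mono R 0 2 1 0 +
      C c113 * mono R 0 2 0 1 +
      C c122 * mono R 0 1 2 0 +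
      C c123 * mono R 0 1 1 1 +
      C c133 * mono R 0 1 0 2 +
      C c222 * mono R 0 0 3 0 +
      C c223 * mono R 0 0 2 1 +
      C c233 * mono R 0 0 1 2 +
      C c333 * mono R 0 0 0 3 = 0 := by
    have := congrArg τ h
    simp only [map_add, map_mul, hτ, algHom_C, algebraMap_eq, map_zero] at this
    simp only [mono]
    linear_combination this
  refine ⟨?_, ?_, ?_, ?_, ?_, ?_, ?_, ?_, ?_, ?_, ?_, ?_, ?_, ?_, ?_, ?_, ?_, ?_, ?_, ?_⟩
  · have := congrArg (coeff (expo 3 0 0 0)) key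
    simpa only [coeff_add, coeff_mono, coeff_zero, Nat.reduceEqDiff, OfNat.ofNat_ne_zero, OfNat.zero_ne_ofNat,
      OfNat.ofNat_ne_one, OfNat.one_ne_ofNat, zero_ne_one, one_ne_zero, and_self, and_false, false_and, if_true,
      if_false, add_zero, zero_add] using this
  · have := congrArg (coeff (expo 2 1 0 0)) key
    simpa only [coeff_add, coeff_mono, coeff_zero, Nat.reduceEqDiff, OfNat.ofNat_ne_zero, OfNat.zero_ne_ofNat,
      OfNat.ofNat_ne_one, OfNat.one_ne_ofNat, zero_ne_one, one_ne_zero, and_self, and_false, false_and, if_true,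
      if_false, add_zero, zero_add] using this
  · have := congrArg (coeff (expo 2 0 1 0)) key
    simpa only [coeff_add, coeff_mono, coeff_zero, Nat.reduceEqDiff, OfNat.ofNat_ne_zero, OfNat.zero_ne_ofNat,
      OfNat.ofNat_ne_one, OfNat.one_ne_ofNat, zero_ne_one, one_ne_zero, and_self, and_false, false_and, if_true,
      if_false, add_zero, zero_add] using this
  · have := congrArg (coeff (expo 2 0 0 1)) key
    simpa only [coeff_add, coeff_mono, coeff_zero, Nat.reduceEqDiff, OfNat.ofNat_ne_zero, OfNat.zero_ne_ofNat,
      OfNat.ofNat_ne_one, OfNat.one_ne_ofNat, zero_ne_one, one_ne_zero, and_self, and_false, false_and, if_true,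
      if_false, add_zero, zero_add] using this
  · have := congrArg (coeff (expo 1 2 0 0)) key
    simpa only [coeff_add, coeff_mono, coeff_zero, Nat.reduceEqDiff, OfNat.ofNat_ne_zero, OfNat.zero_ne_ofNat,
      OfNat.ofNat_ne_one, OfNat.one_ne_ofNat, zero_ne_one, one_ne_zero, and_self, and_false, false_and, if_true,
      if_false, add_zero, zero_add] using this
  · have := congrArg (coeff (expo 1 1 1 0)) key
    simpa only [coeff_add, coeff_mono, coeff_zero, Nat.reduceEqDiff, OfNat.ofNat_ne_zero, OfNat.zero_ne_ofNat,
      OfNat.ofNat_ne_one, OfNat.one_ne_ofNat, zero_ne_one, one_ne_zero, and_self, and_false, false_and, if_true,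
      if_false, add_zero, zero_add] using this
  · have := congrArg (coeff (expo 1 1 0 1)) key
    simpa only [coeff_add, coeff_mono, coeff_zero, Nat.reduceEqDiff, OfNat.ofNat_ne_zero, OfNat.zero_ne_ofNat,
      OfNat.ofNat_ne_one, OfNat.one_ne_ofNat, zero_ne_one, one_ne_zero, and_self, and_false, false_and, if_true,
      if_false, add_zero, zero_add] using this
  · have := congrArg (coeff (expo 1 0 2 0)) key
    simpa only [coeff_add, coeff_mono, coeff_zero, Nat.reduceEqDiff, OfNat.ofNat_ne_zero, OfNat.zero_ne_ofNat,
      OfNat.ofNat_ne_one, OfNat.one_ne_ofNat, zero_ne_one, one_ne_zero, and_self, and_false, false_and, if_true,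
      if_false, add_zero, zero_add] using this
  · have := congrArg (coeff (expo 1 0 1 1)) key
    simpa only [coeff_add, coeff_mono, coeff_zero, Nat.reduceEqDiff, OfNat.ofNat_ne_zero, OfNat.zero_ne_ofNat,
      OfNat.ofNat_ne_one, OfNat.one_ne_ofNat, zero_ne_one, one_ne_zero, and_self, and_false, false_and, if_true,
      if_false, add_zero, zero_add] using this
  · have := congrArg (coeff (expo 1 0 0 2)) key
    simpa only [coeff_add, coeff_mono, coeff_zero, Nat.reduceEqDiff, OfNat.ofNat_ne_zero, OfNat.zero_ne_ofNat,
      OfNat.ofNat_ne_one, OfNat.one_ne_ofNat, zero_ne_one, one_ne_zero, and_self, and_false, false_and, if_true,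
      if_false, add_zero, zero_add] using this
  · have := congrArg (coeff (expo 0 3 0 0)) key
    simpa only [coeff_add, coeff_mono, coeff_zero, Nat.reduceEqDiff, OfNat.ofNat_ne_zero, OfNat.zero_ne_ofNat,
      OfNat.ofNat_ne_one, OfNat.one_ne_ofNat, zero_ne_one, one_ne_zero, and_self, and_false, false_and, if_true,
      if_false, add_zero, zero_add] using this
  · have := congrArg (coeff (expo 0 2 1 0)) key
    simpa only [coeff_add, coeff_mono, coeff_zero, Nat.reduceEqDiff, OfNat.ofNat_ne_zero, OfNat.zero_ne_ofNat,
      OfNat.ofNat_ne_one, OfNat.one_ne_ofNat, zero_ne_one, one_ne_zero, and_self, and_false, false_and, if_true,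
      if_false, add_zero, zero_add] using this
  · have := congrArg (coeff (expo 0 2 0 1)) key
    simpa only [coeff_add, coeff_mono, coeff_zero, Nat.reduceEqDiff, OfNat.ofNat_ne_zero, OfNat.zero_ne_ofNat,
      OfNat.ofNat_ne_one, OfNat.one_ne_ofNat, zero_ne_one, one_ne_zero, and_self, and_false, false_and, if_true,
      if_false, add_zero, zero_add] using this
  · have := congrArg (coeff (expo 0 1 2 0)) key
    simpa only [coeff_add, coeff_mono, coeff_zero, Nat.reduceEqDiff, OfNat.ofNat_ne_zero, OfNat.zero_ne_ofNat,
      OfNat.ofNat_ne_one, OfNat.one_ne_ofNat, zero_ne_one, one_ne_zero, and_self, and_false, false_and, if_true,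
      if_false, add_zero, zero_add] using this
  · have := congrArg (coeff (expo 0 1 1 1)) key
    simpa only [coeff_add, coeff_mono, coeff_zero, Nat.reduceEqDiff, OfNat.ofNat_ne_zero, OfNat.zero_ne_ofNat,
      OfNat.ofNat_ne_one, OfNat.one_ne_ofNat, zero_ne_one, one_ne_zero, and_self, and_false, false_and, if_true,
      if_false, add_zero, zero_add] using this
  · have := congrArg (coeff (expo 0 1 0 2)) key
    simpa only [coeff_add, coeff_mono, coeff_zero, Nat.reduceEqDiff, OfNat.ofNat_ne_zero, OfNat.zero_ne_ofNat,
      OfNat.ofNat_ne_one, OfNat.one_ne_ofNat, zero_ne_one, one_ne_zero, and_self, and_false, false_and, if_true,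
      if_false, add_zero, zero_add] using this
  · have := congrArg (coeff (expo 0 0 3 0)) key
    simpa only [coeff_add, coeff_mono, coeff_zero, Nat.reduceEqDiff, OfNat.ofNat_ne_zero, OfNat.zero_ne_ofNat,
      OfNat.ofNat_ne_one, OfNat.one_ne_ofNat, zero_ne_one, one_ne_zero, and_self, and_false, false_and, if_true,
      if_false, add_zero, zero_add] using this
  · have := congrArg (coeff (expo 0 0 2 1)) key
    simpa only [coeff_add, coeff_mono, coeff_zero, Nat.reduceEqDiff, OfNat.ofNat_ne_zero, OfNat.zero_ne_ofNat,
      OfNat.ofNat_ne_one, OfNat.one_ne_ofNat, zero_ne_one, one_ne_zero, and_self, and_false, false_and, if_true,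
      if_false, add_zero, zero_add] using this
  · have := congrArg (coeff (expo 0 0 1 2)) key
    simpa only [coeff_add, coeff_mono, coeff_zero, Nat.reduceEqDiff, OfNat.ofNat_ne_zero, OfNat.zero_ne_ofNat,
      OfNat.ofNat_ne_one, OfNat.one_ne_ofNat, zero_ne_one, one_ne_zero, and_self, and_false, false_and, if_true,
      if_false, add_zero, zero_add] using this
  · have := congrArg (coeff (expo 0 0 0 3)) key
    simpa only [coeff_add, coeff_mono, coeff_zero, Nat.reduceEqDiff, OfNat.ofNat_ne_zero, OfNat.zero_ne_ofNat,
      OfNat.ofNat_ne_one, OfNat.one_ne_ofNat, zero_ne_one, one_ne_zero, and_self, and_false, false_and, if_true,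
      if_false, add_zero, zero_add] using this

end Unique

/-! ### Normal form of a pencil reducing to `⟨h², h l⟩` -/

section NormalForm

variable {K : Type*} [Field K] {O : Type*} [CommRing O] [Algebra K O] (ε : O →ₐ[K] K)

/-- In `b`, all terms divisible by `x₀` or `x₁` can be absorbed into the product `x₀ x₁` by changing
these two coordinates. In `a`, the term `x₀ x₁` can then be removed by adding a multiple of `b`. -/
theorem exists_normal_pencil (hε : ∀ r, ε r ≠ 0 → IsUnit r) (h2 : (2 : K) ≠ 0)
    {x₀ : Fin 4 → Forms K 1} (hx₀ : IsCoord x₀) (a b : Forms O 2)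
    (ha : mapForms (ε : O →+* K) a = mul11 (x₀ 0) (x₀ 0))
    (hb : mapForms (ε : O →+* K) b = mul11 (x₀ 0) (x₀ 1)) :
    ∃ (a' b' : Forms O 2) (x : Fin 4 → Forms O 1)
      (e₁ e₂ q₁₁ q₁₂ q₁₃ q₂₂ q₂₃ q₃₃ p₂₂ p₂₃ p₃₃ : O),
      a' ∈ Submodule.span O {a, b} ∧ b' ∈ Submodule.span O {a, b} ∧
      mapForms (ε : O →+* K) a' = mul11 (x₀ 0) (x₀ 0) ∧
      mapForms (ε : O →+* K) b' = mul11 (x₀ 0) (x₀ 1) ∧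
      (∀ i, mapForms (ε : O →+* K) (x i) = x₀ i) ∧
      (ε e₁ = 0 ∧ ε e₂ = 0) ∧
      (ε q₁₁ = 0 ∧ ε q₁₂ = 0 ∧ ε q₁₃ = 0 ∧ ε q₂₂ = 0 ∧ ε q₂₃ = 0 ∧ ε q₃₃ = 0) ∧
      (ε p₂₂ = 0 ∧ ε p₂₃ = 0 ∧ ε p₃₃ = 0) ∧
      a'.1 = (x 0).1 * ((x 0).1 + 2 * (C e₁ * (x 2).1 + C e₂ * (x 3).1)) +
        (C q₁₁ * (x 1).1 ^ 2 + C q₁₂ * ((x 1).1 * (x 2).1) + C q₁₃ * ((x 1).1 * (x 3).1) +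
          C q₂₂ * (x 2).1 ^ 2 + C q₂₃ * ((x 2).1 * (x 3).1) + C q₃₃ * (x 3).1 ^ 2) ∧
      b'.1 = (x 0).1 * (x 1).1 +
        (C p₂₂ * (x 2).1 ^ 2 + C p₂₃ * ((x 2).1 * (x 3).1) + C p₃₃ * (x 3).1 ^ 2) := by
  obtain ⟨X, hX⟩ : ∃ X : Fin 4 → Forms O 1, ∀ i, X i = extend O (x₀ i) := ⟨_, fun _ => rfl⟩
  have hεX : ∀ i, mapForms (ε : O →+* K) (X i) = x₀ i := fun i => by
    rw [hX, mapForms_extend, extend_self]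
  have hXc : IsCoord X := isCoord_of_residue ε hε hx₀ hεX
  have h2O : IsUnit (2 : O) := hε _ (by rwa [map_ofNat])
  have hεX' : ∀ i, MvPolynomial.map (ε : O →+* K) (X i).1 = (x₀ i).1 := fun i =>
    congrArg Subtype.val (hεX i)
  have ha' : MvPolynomial.map (ε : O →+* K) a.1 = (x₀ 0).1 * (x₀ 0).1 := congrArg Subtype.val ha
  have hb' : MvPolynomial.map (ε : O →+* K) b.1 = (x₀ 0).1 * (x₀ 1).1 := congrArg Subtype.val hb
  obtain ⟨a00, a01, a02, a03, a11, a12, a13, a22, a23, a33, hA⟩ := hXc.exists_degree_two a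
  obtain ⟨b00, b01, b02, b03, b11, b12, b13, b22, b23, b33, hB⟩ := hXc.exists_degree_two b
  obtain ⟨A00, A01, A02, A03, A11, A12, A13, A22, A23, A33⟩ :
      ε a00 - 1 = 0 ∧ ε a01 = 0 ∧ ε a02 = 0 ∧ ε a03 = 0 ∧ ε a11 = 0 ∧ ε a12 = 0 ∧ ε a13 = 0 ∧
        ε a22 = 0 ∧ ε a23 = 0 ∧ ε a33 = 0 := by
    apply hx₀.degree_two_unique
    rw [hA] at ha'
    simp only [map_add, map_mul, map_pow, map_C, hεX', RingHom.coe_coe] at ha'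
    simp only [map_sub, map_one]
    linear_combination ha'
  obtain ⟨B00, B01, B02, B03, B11, B12, B13, B22, B23, B33⟩ :
      ε b00 = 0 ∧ ε b01 - 1 = 0 ∧ ε b02 = 0 ∧ ε b03 = 0 ∧ ε b11 = 0 ∧ ε b12 = 0 ∧ ε b13 = 0 ∧
        ε b22 = 0 ∧ ε b23 = 0 ∧ ε b33 = 0 := by
    apply hx₀.degree_two_unique
    rw [hB] at hb'
    simp only [map_add, map_mul, map_pow, map_C, hεX', RingHom.coe_coe] at hb'
    simp only [map_sub, map_one]
    linear_combination hb'
  rw [sub_eq_zero] at A00 B01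
  -- The matrix of the coefficients of `x₀²`, `x₀ x₁` in `a`, `b` reduces to the identity. The
  -- functions `f` and `g` below give the coefficients of the pencil after multiplication by its
  -- inverse.
  obtain ⟨D, hD⟩ : ∃ D, D * (a00 * b01 - a01 * b00) = 1 := by
    have : IsUnit (a00 * b01 - a01 * b00) := hε _ (by simp [A00, A01, B00, B01])
    exact this.exists_left_inv
  have hεD : ε D = 1 := by
    have := congrArg ε hD
    simpa [A00, A01, B00, B01] using this
  obtain ⟨i2, hi2⟩ := h2O.exists_left_inv
  -- the pencil with normalised leading coefficients
  obtain ⟨f, hf⟩ : ∃ f : O → O → O, ∀ s t, f s t = D * (b01 * s - a01 * t) := ⟨_, fun _ _ => rfl⟩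
  obtain ⟨g, hg⟩ : ∃ g : O → O → O, ∀ s t, g s t = D * (a00 * t - b00 * s) := ⟨_, fun _ _ => rfl⟩
  have hf00 : f a00 b00 = 1 := by rw [hf]; linear_combination hD
  have hf01 : f a01 b01 = 0 := by rw [hf]; ring
  have hg00 : g a00 b00 = 0 := by rw [hg]; ring
  have hg01 : g a01 b01 = 1 := by rw [hg]; linear_combination hD
  have hfε : ∀ s t, ε s = 0 → ε t = 0 → ε (f s t) = 0 := fun s t hs ht => by simp [hf, hs, ht]
  have hgε : ∀ s t, ε s = 0 → ε t = 0 → ε (g s t) = 0 := fun s t hs ht => by simp [hg, hs, ht]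
  obtain ⟨a₁, ha₁⟩ : ∃ a₁ : Forms O 2, a₁ = D • (b01 • a - a01 • b) := ⟨_, rfl⟩
  obtain ⟨b₁, hb₁⟩ : ∃ b₁ : Forms O 2, b₁ = D • (a00 • b - b00 • a) := ⟨_, rfl⟩
  have hma : a ∈ Submodule.span O {a, b} := Submodule.subset_span (by simp)
  have hmb : b ∈ Submodule.span O {a, b} := Submodule.subset_span (by simp)
  have hm1 : a₁ ∈ Submodule.span O {a, b} := by
    rw [ha₁]
    exact Submodule.smul_mem _ _ (sub_mem (Submodule.smul_mem _ _ hma)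
      (Submodule.smul_mem _ _ hmb))
  have hm2 : b₁ ∈ Submodule.span O {a, b} := by
    rw [hb₁]
    exact Submodule.smul_mem _ _ (sub_mem (Submodule.smul_mem _ _ hmb)
      (Submodule.smul_mem _ _ hma))
  have hεa₁ : mapForms (ε : O →+* K) a₁ = mul11 (x₀ 0) (x₀ 0) := by
    rw [ha₁]; simp [ha, hb, hεD, B01, A01]
  have hεb₁ : mapForms (ε : O →+* K) b₁ = mul11 (x₀ 0) (x₀ 1) := by
    rw [hb₁]; simp [ha, hb, hεD, A00, B00]
  have hA₁ : a₁.1 = (X 0).1 ^ 2 + C (f a02 b02) * ((X 0).1 * (X 2).1) +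
      C (f a03 b03) * ((X 0).1 * (X 3).1) + C (f a11 b11) * (X 1).1 ^ 2 +
      C (f a12 b12) * ((X 1).1 * (X 2).1) + C (f a13 b13) * ((X 1).1 * (X 3).1) +
      C (f a22 b22) * (X 2).1 ^ 2 + C (f a23 b23) * ((X 2).1 * (X 3).1) +
      C (f a33 b33) * (X 3).1 ^ 2 := by
    have e00 := congrArg (C (σ := Fin 4)) hf00
    have e01 := congrArg (C (σ := Fin 4)) hf01
    rw [ha₁]
    simp only [Forms.coe_smul, Forms.coe_sub, hA, hB]
    simp only [hf, map_sub, map_mul, map_one, map_zero] at e00 e01 ⊢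
    linear_combination (X 0).1 ^ 2 * e00 + (X 0).1 * (X 1).1 * e01
  have hB₁ : b₁.1 = (X 0).1 * (X 1).1 + C (g a02 b02) * ((X 0).1 * (X 2).1) +
      C (g a03 b03) * ((X 0).1 * (X 3).1) + C (g a11 b11) * (X 1).1 ^ 2 +
      C (g a12 b12) * ((X 1).1 * (X 2).1) + C (g a13 b13) * ((X 1).1 * (X 3).1) +
      C (g a22 b22) * (X 2).1 ^ 2 + C (g a23 b23) * ((X 2).1 * (X 3).1) +
      C (g a33 b33) * (X 3).1 ^ 2 := by
    have e00 := congrArg (C (σ := Fin 4)) hg00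
    have e01 := congrArg (C (σ := Fin 4)) hg01
    rw [hb₁]
    simp only [Forms.coe_smul, Forms.coe_sub, hA, hB]
    simp only [hg, map_sub, map_mul, map_one, map_zero] at e00 e01 ⊢
    linear_combination (X 0).1 ^ 2 * e00 + (X 0).1 * (X 1).1 * e01
  -- Halving the coefficients of `x₀ x₂` and `x₀ x₃` in `a₁` requires `2` to be invertible.
  obtain ⟨u₁, hu₁⟩ : ∃ u, 2 * u = f a02 b02 :=
    ⟨i2 * f a02 b02, by linear_combination f a02 b02 * hi2⟩
  obtain ⟨u₂, hu₂⟩ : ∃ u, 2 * u = f a03 b03 :=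
    ⟨i2 * f a03 b03, by linear_combination f a03 b03 * hi2⟩
  have hεu : ∀ u s t, 2 * u = f s t → ε s = 0 → ε t = 0 → ε u = 0 := by
    intro u s t h hs ht
    have h1 := congrArg ε h
    rw [hfε s t hs ht, map_mul, map_ofNat] at h1
    exact (mul_eq_zero.1 h1).resolve_left h2
  have hεu₁ := hεu _ _ _ hu₁ A02 B02
  have hεu₂ := hεu _ _ _ hu₂ A03 B03
  rw [← hu₁, ← hu₂] at hA₁
  have z11 := hfε _ _ A11 B11
  have z12 := hfε _ _ A12 B12
  have z13 := hfε _ _ A13 B13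
  have z22 := hfε _ _ A22 B22
  have z23 := hfε _ _ A23 B23
  have z33 := hfε _ _ A33 B33
  have w02 := hgε _ _ A02 B02
  have w03 := hgε _ _ A03 B03
  have w11 := hgε _ _ A11 B11
  have w12 := hgε _ _ A12 B12
  have w13 := hgε _ _ A13 B13
  have w22 := hgε _ _ A22 B22
  have w23 := hgε _ _ A23 B23
  have w33 := hgε _ _ A33 B33
  clear hu₁ hu₂ hεu hf00 hf01 hg00 hg01 hfε hgε hf hg
  generalize f a11 b11 = a₁₁ at *
  generalize f a12 b12 = a₁₂ at *
  generalize f a13 b13 = a₁₃ at *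
  generalize f a22 b22 = a₂₂ at *
  generalize f a23 b23 = a₂₃ at *
  generalize f a33 b33 = a₃₃ at *
  generalize g a02 b02 = v₁ at *
  generalize g a03 b03 = v₂ at *
  generalize g a11 b11 = b₁₁ at *
  generalize g a12 b12 = b₁₂ at *
  generalize g a13 b13 = b₁₃ at *
  generalize g a22 b22 = b₂₂ at *
  generalize g a23 b23 = b₂₃ at *
  generalize g a33 b33 = b₃₃ at *
  -- The new `x₁` is `X₁ + v₁ X₂ + v₂ X₃`, and the new `x₀` is `X₀ + b₁₁ x₁ + (b₁₂ - 2 b₁₁ v₁) X₂ +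
  -- (b₁₃ - 2 b₁₁ v₂) X₃`, the cofactor of `x₁` in `b₁`. Substituting for `X₀` in `a₁` creates `-2
  -- b₁₁ x₀ x₁`, which `2 b₁₁ b₁` cancels.
  refine ⟨a₁ + (2 * b₁₁) • b₁, b₁,
    ![X 0 + u₁ • X 2 + u₂ • X 3 + b₁₁ • (X 1 + v₁ • X 2 + v₂ • X 3) +
        (-u₁ - 2 * b₁₁ * v₁ + b₁₂) • X 2 + (-u₂ - 2 * b₁₁ * v₂ + b₁₃) • X 3,
      X 1 + v₁ • X 2 + v₂ • X 3, X 2, X 3],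
    u₁ + 2 * b₁₁ * v₁ - b₁₂, u₂ + 2 * b₁₁ * v₂ - b₁₃,
    b₁₁ ^ 2 + a₁₁,
    -4 * b₁₁ ^ 2 * v₁ + 2 * b₁₁ * b₁₂ - 2 * b₁₁ * u₁ - 2 * a₁₁ * v₁ + a₁₂,
    -4 * b₁₁ ^ 2 * v₂ + 2 * b₁₁ * b₁₃ - 2 * b₁₁ * u₂ - 2 * a₁₁ * v₂ + a₁₃,
    6 * b₁₁ ^ 2 * v₁ ^ 2 - 6 * b₁₁ * b₁₂ * v₁ + b₁₂ ^ 2 + 4 * b₁₁ * u₁ * v₁ - 2 * b₁₂ * u₁ +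
      a₁₁ * v₁ ^ 2 - a₁₂ * v₁ + a₂₂ + 2 * b₁₁ * b₂₂,
    12 * b₁₁ ^ 2 * v₁ * v₂ - 6 * b₁₁ * b₁₃ * v₁ - 6 * b₁₁ * b₁₂ * v₂ + 2 * b₁₂ * b₁₃ +
      4 * b₁₁ * u₁ * v₂ - 2 * b₁₃ * u₁ + 4 * b₁₁ * u₂ * v₁ - 2 * b₁₂ * u₂ + 2 * a₁₁ * v₁ * v₂ -
      a₁₂ * v₂ - a₁₃ * v₁ + a₂₃ + 2 * b₁₁ * b₂₃,
    6 * b₁₁ ^ 2 * v₂ ^ 2 - 6 * b₁₁ * b₁₃ * v₂ + b₁₃ ^ 2 + 4 * b₁₁ * u₂ * v₂ - 2 * b₁₃ * u₂ +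
      a₁₁ * v₂ ^ 2 - a₁₃ * v₂ + a₃₃ + 2 * b₁₁ * b₃₃,
    b₁₁ * v₁ ^ 2 - b₁₂ * v₁ + b₂₂,
    2 * b₁₁ * v₁ * v₂ - b₁₂ * v₂ - b₁₃ * v₁ + b₂₃,
    b₁₁ * v₂ ^ 2 - b₁₃ * v₂ + b₃₃,
    add_mem hm1 (Submodule.smul_mem _ _ hm2), hm2, ?_, hεb₁, ?_, ?_, ?_, ?_, ?_, ?_⟩
  · simp [hεa₁, w11]
  · intro i
    fin_cases i <;> simp [hεX, hεu₁, hεu₂, w02, w03, w11, w12, w13]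
  · constructor <;> simp [hεu₁, hεu₂, w02, w03, w11, w12, w13]
  · refine ⟨?_, ?_, ?_, ?_, ?_, ?_⟩ <;> simp [*]
  · refine ⟨?_, ?_, ?_⟩ <;> simp [*]
  · simp only [Forms.coe_add, Forms.coe_smul, hA₁, hB₁, Matrix.cons_val_zero, Matrix.cons_val_one,
      Matrix.cons_val, map_add, map_sub, map_mul, map_pow, map_neg, map_ofNat]
    ring
  · simp only [Forms.coe_add, Forms.coe_smul, hB₁, Matrix.cons_val_zero, Matrix.cons_val_one,
      Matrix.cons_val, map_add, map_sub, map_mul, map_pow, map_neg, map_ofNat]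
    ring

end NormalForm

/-! ### Normal form of the pencil together with its space of cubics -/

section NormalForm

theorem mem_span_pair_of_range {R M : Type*} [CommRing R] [AddCommGroup M] [Module R M]
    {u : Fin 2 → M} {a : M} (ha : a ∈ Submodule.span R (Set.range u)) :
    ∃ p q : R, a = p • u 0 + q • u 1 := by
  obtain ⟨c, rfl⟩ := (Submodule.mem_span_range_iff_exists_fun R).1 ha
  exact ⟨c 0, c 1, Fin.sum_univ_two _⟩

variable {K : Type*} [Field K] {O : Type*} [CommRing O] [Algebra K O] (ε : O →ₐ[K] K)

set_option maxHeartbeats 2000000 in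
-- The combination `a x₁ - b (x₀ + 2e)` cancels every term in `x₀²` and `x₀ x₁`. It lies in the span
-- of the cubics by `hAB`, which forces it to be `t c`. The coefficients of the pencil are thereby
-- multiples of `t`, and cancelling `t` by means of `hΔ` determines the part of `c` in `x₂, x₃`.
theorem exists_blowup_normal_form (hε : ∀ r, ε r ≠ 0 → IsUnit r) (h2 : (2 : K) ≠ 0)
    (v : Basis2 K) (w : Basis3 K) (α : Fin 2 → Fin 8 → O) (β : Fin 8 → Fin 12 → O)
    {x₀ : Fin 4 → Forms K 1} (hx₀ : IsCoord x₀) {g₀ : Forms K 1} {b₀ c₀ d₀ : K}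
    (hg₀ : g₀.1 = C b₀ * (x₀ 1).1 + C c₀ * (x₀ 2).1 + C d₀ * (x₀ 3).1)
    (hne : b₀ ≠ 0 ∨ c₀ ≠ 0 ∨ d₀ ≠ 0)
    (hA : Submodule.span K (Set.range ![mul11 (x₀ 0) (x₀ 0), mul11 (x₀ 0) (x₀ 1)]) =
      chartSpan K v (fun i j => ε (α i j)))
    (hB : Submodule.span K (Set.range (cubicFrame (mul11 (x₀ 0) (x₀ 0)) (mul11 (x₀ 0) (x₀ 1)) x₀
      (mul21 (mul11 (x₀ 1) (x₀ 1)) g₀))) = chartSpan K w (fun i j => ε (β i j)))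
    (hAB : ∀ a ∈ chartSpan O v α, ∀ f : Forms O 1, mul21 a f ∈ chartSpan O w β)
    (hΔ : ∀ (τ : O) (f₀ f₁ : Forms O 1),
      (mapForms (ε : O →+* K) f₀ ≠ 0 ∨ mapForms (ε : O →+* K) f₁ ≠ 0) →
      τ • (mul21 (chartRow O v α 0) f₀ + mul21 (chartRow O v α 1) f₁) = 0 → τ = 0) :
    ∃ (a b : Forms O 2) (c : Forms O 3) (x : Fin 4 → Forms O 1)
      (e₁ e₂ t r₁ r₂ r₃ s₁ s₂ s₃ s₄ s₅ s₆ : O),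
      Submodule.span O (Set.range ![a, b]) = chartSpan O v α ∧
      Submodule.span O (Set.range (cubicFrame a b x c)) = chartSpan O w β ∧
      (∀ i, mapForms (ε : O →+* K) (x i) = x₀ i) ∧
      (ε e₁ = 0 ∧ ε e₂ = 0 ∧ ε t = 0) ∧ (ε r₁ = 0 ∧ ε r₂ = 0 ∧ ε r₃ = 0) ∧
      (ε s₁ = b₀ ∧ ε s₂ = c₀ ∧ ε s₃ = d₀) ∧ (ε s₄ = 0 ∧ ε s₅ = 0 ∧ ε s₆ = 0) ∧
      a.1 = (x 0).1 * ((x 0).1 + 2 * (C e₁ * (x 2).1 + C e₂ * (x 3).1)) +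
        C t * (C s₁ * (x 1).1 ^ 2 + C s₂ * ((x 1).1 * (x 2).1) + C s₃ * ((x 1).1 * (x 3).1) +
          C s₄ * (x 2).1 ^ 2 + C s₅ * ((x 2).1 * (x 3).1) + C s₆ * (x 3).1 ^ 2) ∧
      b.1 = (x 0).1 * (x 1).1 -
        C t * (C r₁ * (x 2).1 ^ 2 + C r₂ * ((x 2).1 * (x 3).1) + C r₃ * (x 3).1 ^ 2) ∧
      c.1 = (x 1).1 * (C s₁ * (x 1).1 ^ 2 + C s₂ * ((x 1).1 * (x 2).1) +
          C s₃ * ((x 1).1 * (x 3).1) +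
          C s₄ * (x 2).1 ^ 2 + C s₅ * ((x 2).1 * (x 3).1) + C s₆ * (x 3).1 ^ 2) +
        ((x 0).1 + 2 * (C e₁ * (x 2).1 + C e₂ * (x 3).1)) *
          (C r₁ * (x 2).1 ^ 2 + C r₂ * ((x 2).1 * (x 3).1) + C r₃ * (x 3).1 ^ 2) := by
  -- the pencil
  obtain ⟨a₁, ha₁, hεa₁⟩ := exists_lift_mem_chartSpan ε v α
    (g := mul11 (x₀ 0) (x₀ 0)) (hA ▸ Submodule.subset_span ⟨0, rfl⟩)
  obtain ⟨b₁, hb₁, hεb₁⟩ := exists_lift_mem_chartSpan ε v α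
    (g := mul11 (x₀ 0) (x₀ 1)) (hA ▸ Submodule.subset_span ⟨1, rfl⟩)
  obtain ⟨a, b, x, e₁, e₂, q₁₁, q₁₂, q₁₃, q₂₂, q₂₃, q₃₃, p₂₂, p₂₃, p₃₃, hma, hmb, hεa, hεb, hεx,
    ⟨he₁, he₂⟩, ⟨hq₁₁, hq₁₂, hq₁₃, hq₂₂, hq₂₃, hq₃₃⟩, ⟨hp₂₂, hp₂₃, hp₃₃⟩, ha, hb⟩ :=
    exists_normal_pencil ε hε h2 hx₀ a₁ b₁ hεa₁ hεb₁
  have hle : Submodule.span O {a₁, b₁} ≤ chartSpan O v α := by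
    rw [Submodule.span_le]
    rintro _ (rfl | rfl) <;> assumption
  replace hma := hle hma
  replace hmb := hle hmb
  have hx : IsCoord x := isCoord_of_residue ε hε hx₀ hεx
  have hεx' : ∀ i, MvPolynomial.map (ε : O →+* K) (x i).1 = (x₀ i).1 := fun i =>
    congrArg Subtype.val (hεx i)
  have hspanA : Submodule.span O (Set.range ![a, b]) = chartSpan O v α := by
    apply span_eq_chartSpan_of_residue ε hε
    · intro i; fin_cases i <;> assumption
    · rw [← hA]
      apply le_of_eq
      congr 2
      funext i
      fin_cases i
      · exact hεa.symm
      · exact hεb.symm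
  -- the cubic
  obtain ⟨c₁, hc₁, hεc₁⟩ := exists_lift_mem_chartSpan ε w β
    (g := mul21 (mul11 (x₀ 1) (x₀ 1)) g₀) (hB ▸ Submodule.subset_span ⟨7, rfl⟩)
  obtain ⟨c000, c001, c002, c003, c011, c012, c013, c022, c023, c033,
      c111, c112, c113, c122, c123, c133, c222, c223, c233, c333, hc⟩ := hx.exists_degree_three c₁
  have hεc₁' : MvPolynomial.map (ε : O →+* K) c₁.1 = (x₀ 1).1 * (x₀ 1).1 * g₀.1 :=
    congrArg Subtype.val hεc₁
  obtain ⟨z000, z001, z002, z003, z011, z012, z013, z022, z023, z033,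
      z111, z112, z113, z122, z123, z133, z222, z223, z233, z333⟩ :
      ε c000 = 0 ∧ ε c001 = 0 ∧ ε c002 = 0 ∧ ε c003 = 0 ∧ ε c011 = 0 ∧ ε c012 = 0 ∧ ε c013 = 0 ∧
      ε c022 = 0 ∧ ε c023 = 0 ∧ ε c033 = 0 ∧ ε c111 - b₀ = 0 ∧ ε c112 - c₀ = 0 ∧
      ε c113 - d₀ = 0 ∧ ε c122 = 0 ∧ ε c123 = 0 ∧ ε c133 = 0 ∧ ε c222 = 0 ∧ ε c223 = 0 ∧
      ε c233 = 0 ∧ ε c333 = 0 := by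
    apply hx₀.degree_three_unique
    rw [hc, hg₀] at hεc₁'
    simp only [map_add, map_mul, map_pow, map_C, hεx', RingHom.coe_coe] at hεc₁'
    simp only [map_sub]
    linear_combination hεc₁'
  rw [sub_eq_zero] at z111 z112 z113
  -- The seven products remove from `c₁` the seven monomials divisible by `x₀²` or `x₀ x₁`. The
  -- corrections by `e₁, e₂, q₁₁, q₁₂, q₁₃` account for the other such monomials in `a x₀`.
  obtain ⟨c, hcdef⟩ : ∃ c : Forms O 3, c = c₁ - (c000 • mul21 a (x 0) +
      (c002 - 2 * e₁ * c000) • mul21 a (x 2) + (c003 - 2 * e₂ * c000) • mul21 a (x 3) +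
      c001 • mul21 b (x 0) + (c011 - q₁₁ * c000) • mul21 b (x 1) +
      (c012 - q₁₂ * c000) • mul21 b (x 2) + (c013 - q₁₃ * c000) • mul21 b (x 3)) := ⟨_, rfl⟩
  have hmc : c ∈ chartSpan O w β := by
    rw [hcdef]
    refine sub_mem hc₁ ?_
    repeat' refine add_mem ?_ ?_
    all_goals exact Submodule.smul_mem _ _ (hAB _ (by assumption) _)
  have hεc : mapForms (ε : O →+* K) c = mul21 (mul11 (x₀ 1) (x₀ 1)) g₀ := by
    rw [hcdef, ← hεc₁]
    simp [z000, z001, z002, z003, z011, z012, z013]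
  have hspanB : Submodule.span O (Set.range (cubicFrame a b x c)) = chartSpan O w β := by
    apply span_eq_chartSpan_of_residue ε hε
    · intro i
      fin_cases i
      exacts [hAB _ hma _, hAB _ hma _, hAB _ hma _, hAB _ hmb _, hAB _ hmb _, hAB _ hmb _,
        hAB _ hmb _, hmc]
    · rw [← hB]
      apply le_of_eq
      congr 2
      funext i
      rw [mapForms_cubicFrame, hεa, hεb, hεc]
      simp only [hεx]
  obtain ⟨r₁, r₂, r₃, s₁, s₂, s₃, s₄, s₅, s₆, w₁, w₂, w₃, w₄, ⟨hr₁, hr₂, hr₃⟩, ⟨hs₁, hs₂, hs₃⟩,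
      ⟨hs₄, hs₅, hs₆⟩, hcf⟩ : ∃ r₁ r₂ r₃ s₁ s₂ s₃ s₄ s₅ s₆ w₁ w₂ w₃ w₄ : O,
      (ε r₁ = 0 ∧ ε r₂ = 0 ∧ ε r₃ = 0) ∧ (ε s₁ = b₀ ∧ ε s₂ = c₀ ∧ ε s₃ = d₀) ∧
      (ε s₄ = 0 ∧ ε s₅ = 0 ∧ ε s₆ = 0) ∧
      c.1 = (x 0).1 * (C r₁ * (x 2).1 ^ 2 + C r₂ * ((x 2).1 * (x 3).1) + C r₃ * (x 3).1 ^ 2) +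
        (x 1).1 * (C s₁ * (x 1).1 ^ 2 + C s₂ * ((x 1).1 * (x 2).1) +
          C s₃ * ((x 1).1 * (x 3).1) +
          C s₄ * (x 2).1 ^ 2 + C s₅ * ((x 2).1 * (x 3).1) + C s₆ * (x 3).1 ^ 2) +
        (C w₁ * (x 2).1 ^ 3 + C w₂ * ((x 2).1 ^ 2 * (x 3).1) + C w₃ * ((x 2).1 * (x 3).1 ^ 2) +
          C w₄ * (x 3).1 ^ 3) := by
    refine ⟨c022 - c000 * q₂₂ - 2 * c002 * e₁ + 4 * c000 * e₁ ^ 2 - c001 * p₂₂,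
      c023 - c000 * q₂₃ - 2 * c002 * e₂ + 8 * c000 * e₁ * e₂ - 2 * c003 * e₁ - c001 * p₂₃,
      c033 - c000 * q₃₃ - 2 * c003 * e₂ + 4 * c000 * e₂ ^ 2 - c001 * p₃₃,
      c111, c112 - c002 * q₁₁ + 2 * c000 * e₁ * q₁₁, c113 - c003 * q₁₁ + 2 * c000 * e₂ * q₁₁,
      c122 - c002 * q₁₂ + 2 * c000 * e₁ * q₁₂ - c011 * p₂₂ + c000 * p₂₂ * q₁₁,
      c123 - c002 * q₁₃ + 2 * c000 * e₁ * q₁₃ - c003 * q₁₂ + 2 * c000 * e₂ * q₁₂ - c011 * p₂₃ +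
        c000 * p₂₃ * q₁₁,
      c133 - c003 * q₁₃ + 2 * c000 * e₂ * q₁₃ - c011 * p₃₃ + c000 * p₃₃ * q₁₁,
      c222 - c002 * q₂₂ + 2 * c000 * e₁ * q₂₂ - c012 * p₂₂ + c000 * p₂₂ * q₁₂,
      c223 - c002 * q₂₃ + 2 * c000 * e₁ * q₂₃ - c003 * q₂₂ + 2 * c000 * e₂ * q₂₂ - c012 * p₂₃ +
        c000 * p₂₃ * q₁₂ - c013 * p₂₂ + c000 * p₂₂ * q₁₃,
      c233 - c002 * q₃₃ + 2 * c000 * e₁ * q₃₃ - c003 * q₂₃ + 2 * c000 * e₂ * q₂₃ - c012 * p₃₃ +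
        c000 * p₃₃ * q₁₂ - c013 * p₂₃ + c000 * p₂₃ * q₁₃,
      c333 - c003 * q₃₃ + 2 * c000 * e₂ * q₃₃ - c013 * p₃₃ + c000 * p₃₃ * q₁₃,
      ⟨?_, ?_, ?_⟩, ⟨z111, ?_, ?_⟩, ⟨?_, ?_, ?_⟩, ?_⟩
    iterate 8 simp [*]
    rw [hcdef]
    simp only [Forms.coe_sub, Forms.coe_add, Forms.coe_smul, coe_mul21, hc, ha, hb, map_add,
      map_sub, map_mul, map_pow, map_ofNat]
    ring
  -- the relation between the pencil and the cubic
  have hmem : mul21 a (x 1) - mul21 b (x 0 + (2 * e₁) • x 2 + (2 * e₂) • x 3) ∈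
      Submodule.span O (Set.range (cubicFrame a b x c)) := by
    rw [hspanB]
    exact sub_mem (hAB _ hma _) (hAB _ hmb _)
  obtain ⟨k, hk⟩ := (Submodule.mem_span_range_iff_exists_fun O).1 hmem
  obtain ⟨t, ht⟩ : ∃ t, t = k 7 := ⟨_, rfl⟩
  have hk' := congrArg Subtype.val hk
  simp only [Fin.sum_univ_eight, cubicFrame, Forms.coe_add, Forms.coe_smul, Forms.coe_sub,
    coe_mul21, Matrix.cons_val_zero, Matrix.cons_val_one, Matrix.cons_val, ← ht, hcf, ha, hb,
    map_mul, map_ofNat] at hk'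
  -- Neither the left side nor `c` contains a monomial divisible by `x₀²` or `x₀ x₁`, whereas the
  -- first seven frame elements lead with these. Hence `k 0, …, k 6` vanish, and the remaining
  -- coefficients express `q` and `p` through `t`.
  obtain ⟨E000, E001, E002, E003, E011, E012, E013, E022, E023, E033,
      E111, E112, E113, E122, E123, E133, E222, E223, E233, E333⟩ :
      -k 0 = 0 ∧ -k 3 = 0 ∧ -(2 * e₁ * k 0) - k 1 = 0 ∧ -(2 * e₂ * k 0) - k 2 = 0 ∧
      -(k 0 * q₁₁) - k 4 = 0 ∧ -(k 0 * q₁₂) - k 5 = 0 ∧ -(k 0 * q₁₃) - k 6 = 0 ∧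
      -p₂₂ - k 0 * q₂₂ - 2 * e₁ * k 1 - k 3 * p₂₂ - r₁ * t = 0 ∧
      -p₂₃ - k 0 * q₂₃ - 2 * e₂ * k 1 - 2 * e₁ * k 2 - k 3 * p₂₃ - r₂ * t = 0 ∧
      -p₃₃ - k 0 * q₃₃ - 2 * e₂ * k 2 - k 3 * p₃₃ - r₃ * t = 0 ∧
      q₁₁ - s₁ * t = 0 ∧ q₁₂ - k 1 * q₁₁ - s₂ * t = 0 ∧ q₁₃ - k 2 * q₁₁ - s₃ * t = 0 ∧
      q₂₂ - k 1 * q₁₂ - k 4 * p₂₂ - s₄ * t = 0 ∧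
      q₂₃ - k 1 * q₁₃ - k 2 * q₁₂ - k 4 * p₂₃ - s₅ * t = 0 ∧
      q₃₃ - k 2 * q₁₃ - k 4 * p₃₃ - s₆ * t = 0 ∧
      -(2 * e₁ * p₂₂) - k 1 * q₂₂ - k 5 * p₂₂ - t * w₁ = 0 ∧
      -(2 * e₁ * p₂₃) - 2 * e₂ * p₂₂ - k 1 * q₂₃ - k 2 * q₂₂ - k 5 * p₂₃ - k 6 * p₂₂ - t * w₂ = 0 ∧
      -(2 * e₁ * p₃₃) - 2 * e₂ * p₂₃ - k 1 * q₃₃ - k 2 * q₂₃ - k 5 * p₃₃ - k 6 * p₂₃ - t * w₃ = 0 ∧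
      -(2 * e₂ * p₃₃) - k 2 * q₃₃ - k 6 * p₃₃ - t * w₄ = 0 := by
    apply hx.degree_three_unique
    simp only [map_sub, map_mul, map_neg, map_ofNat]
    linear_combination -hk'
  have k0 : k 0 = 0 := by linear_combination -E000
  have k3 : k 3 = 0 := by linear_combination -E001
  rw [k0] at E002 E003 E011 E012 E013
  have k1 : k 1 = 0 := by linear_combination -E002
  have k2 : k 2 = 0 := by linear_combination -E003
  have k4 : k 4 = 0 := by linear_combination -E011
  have k5 : k 5 = 0 := by linear_combination -E012
  have k6 : k 6 = 0 := by linear_combination -E013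
  rw [k0, k1, k3] at E022
  rw [k0, k1, k2, k3] at E023
  rw [k0, k2, k3] at E033
  rw [k1] at E112
  rw [k2] at E113
  rw [k1, k4] at E122
  rw [k1, k2, k4] at E123
  rw [k2, k4] at E133
  rw [k1, k5] at E222
  rw [k1, k2, k5, k6] at E223 E233
  rw [k2, k6] at E333
  have P22 : p₂₂ = -(t * r₁) := by linear_combination -E022
  have P23 : p₂₃ = -(t * r₂) := by linear_combination -E023
  have P33 : p₃₃ = -(t * r₃) := by linear_combination -E033
  have Q11 : q₁₁ = t * s₁ := by linear_combination E111
  have Q12 : q₁₂ = t * s₂ := by linear_combination E112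
  have Q13 : q₁₃ = t * s₃ := by linear_combination E113
  have Q22 : q₂₂ = t * s₄ := by linear_combination E122
  have Q23 : q₂₃ = t * s₅ := by linear_combination E123
  have Q33 : q₃₃ = t * s₆ := by linear_combination E133
  have hg : mul21 a (x 1) - mul21 b (x 0 + (2 * e₁) • x 2 + (2 * e₂) • x 3) = t • c := by
    rw [← hk, Fin.sum_univ_eight]
    simp only [k0, k1, k2, k3, k4, k5, k6, zero_smul, zero_add, ← ht]
    rfl
  have hεt : ε t = 0 := by
    have h1 := congrArg ε Q11
    have h2 := congrArg ε Q12
    have h3 := congrArg ε Q13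
    rw [hq₁₁, map_mul, hs₁] at h1
    rw [hq₁₂, map_mul, hs₂] at h2
    rw [hq₁₃, map_mul, hs₃] at h3
    rcases hne with h | h | h
    · exact (mul_eq_zero.1 h1.symm).resolve_right h
    · exact (mul_eq_zero.1 h2.symm).resolve_right h
    · exact (mul_eq_zero.1 h3.symm).resolve_right h
  -- `t` is not a zero divisor
  have hcancel : ∀ τ : O, t * τ = 0 → τ = 0 := by
    intro τ hτ
    obtain ⟨P₀, P₁, hP⟩ := mem_span_pair_of_range (u := chartRow O v α) hma
    obtain ⟨Q₀, Q₁, hQ⟩ := mem_span_pair_of_range (u := chartRow O v α) hmb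
    -- This is `τ (a x₁ - b (x₀ + 2e)) = τ t c = 0` written in the rows of the chart. If both linear
    -- coefficients had zero residue, then so would `P₀` and `P₁`, and `a` would reduce to zero.
    refine hΔ τ (P₀ • x 1 - Q₀ • (x 0 + (2 * e₁) • x 2 + (2 * e₂) • x 3))
      (P₁ • x 1 - Q₁ • (x 0 + (2 * e₁) • x 2 + (2 * e₂) • x 3)) ?_ ?_
    · by_contra! hcon
      have hz : ∀ P Q : O, mapForms (ε : O →+* K)
          (P • x 1 - Q • (x 0 + (2 * e₁) • x 2 + (2 * e₂) • x 3)) = 0 → ε P = 0 := by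
        intro P Q h
        have h1 : C (ε P) * (x₀ 1).1 - C (ε Q) * (x₀ 0).1 = 0 := by
          simpa [hεx', he₁, he₂] using congrArg Subtype.val h
        refine (hx₀.degree_two_unique (c00 := -ε Q) (c01 := ε P) (c02 := 0) (c03 := 0) (c11 := 0)
          (c12 := 0) (c13 := 0) (c22 := 0) (c23 := 0) (c33 := 0) ?_).2.1
        simp only [map_neg, map_zero]
        linear_combination (x₀ 0).1 * h1
      have h0 := hz _ _ hcon.1
      have h1 := hz _ _ hcon.2
      have h3 : mapForms (ε : O →+* K) a = 0 := by
        rw [hP]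
        simp [h0, h1]
      rw [hεa] at h3
      have h4 : (x₀ 0).1 * (x₀ 0).1 = 0 := congrArg Subtype.val h3
      refine one_ne_zero (hx₀.degree_two_unique (c00 := 1) (c01 := 0) (c02 := 0) (c03 := 0)
        (c11 := 0) (c12 := 0) (c13 := 0) (c22 := 0) (c23 := 0) (c33 := 0) ?_).1
      simp only [map_one, map_zero]
      linear_combination h4
    · have : mul21 (chartRow O v α 0) (P₀ • x 1 - Q₀ • (x 0 + (2 * e₁) • x 2 + (2 * e₂) • x 3)) +
          mul21 (chartRow O v α 1) (P₁ • x 1 - Q₁ • (x 0 + (2 * e₁) • x 2 + (2 * e₂) • x 3)) =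
          t • c := by
        rw [← hg, hP, hQ]
        apply Forms.ext
        simp only [Forms.coe_sub, Forms.coe_add, Forms.coe_smul, coe_mul21]
        ring
      rw [this, smul_smul, mul_comm, hτ, zero_smul]
  -- The part of the relation in `x₂, x₃` alone reads `t w = 2 e (t r)`, and `t` can be cancelled.
  have W1 : w₁ = 2 * e₁ * r₁ := by
    rw [← sub_eq_zero]
    apply hcancel
    linear_combination -E222 - 2 * e₁ * P22
  have W2 : w₂ = 2 * e₁ * r₂ + 2 * e₂ * r₁ := by
    rw [← sub_eq_zero]
    apply hcancel
    linear_combination -E223 - 2 * e₁ * P23 - 2 * e₂ * P22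
  have W3 : w₃ = 2 * e₁ * r₃ + 2 * e₂ * r₂ := by
    rw [← sub_eq_zero]
    apply hcancel
    linear_combination -E233 - 2 * e₁ * P33 - 2 * e₂ * P23
  have W4 : w₄ = 2 * e₂ * r₃ := by
    rw [← sub_eq_zero]
    apply hcancel
    linear_combination -E333 - 2 * e₂ * P33
  refine ⟨a, b, c, x, e₁, e₂, t, r₁, r₂, r₃, s₁, s₂, s₃, s₄, s₅, s₆, hspanA, hspanB, hεx,
    ⟨he₁, he₂, hεt⟩, ⟨hr₁, hr₂, hr₃⟩, ⟨hs₁, hs₂, hs₃⟩, ⟨hs₄, hs₅, hs₆⟩, ?_, ?_, ?_⟩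
  · rw [ha, Q11, Q12, Q13, Q22, Q23, Q33]
    simp only [map_mul]
    ring
  · rw [hb, P22, P23, P33]
    simp only [map_mul, map_neg]
    ring
  · rw [hcf, W1, W2, W3, W4]
    simp only [map_mul, map_add, map_ofNat]
    ring

end NormalForm

/-! ### Linear relations modulo an ideal of minors -/

section Relation

variable {K : Type*} [Field K] {O : Type*} [CommRing O] [Algebra K O] (ε : O →ₐ[K] K)

/-- Extension of scalars of a linear functional on forms. -/
def extendDual (R : Type*) [CommRing R] [Algebra K R] {d : ℕ} (f : Dual K (Forms K d)) :
    Dual R (Forms R d) :=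
  (monBasis R d).constr R fun m => algebraMap K R (f (monBasis K d m))

theorem extendDual_map {S : Type*} [CommRing S] [Algebra K S] (φ : O →ₐ[K] S) {d : ℕ}
    (f : Dual K (Forms K d)) (q : Forms O d) :
    φ (extendDual O f q) = extendDual S f (mapForms (φ : O →+* S) q) := by
  simp [extendDual, Basis.constr_apply_fintype, monBasis_repr, coeff_map]

theorem extendDual_self {d : ℕ} (f : Dual K (Forms K d)) : extendDual K f = f := by
  apply (monBasis K d).ext
  intro m
  simp [extendDual]

theorem exists_dual_family {V ι : Type*} [AddCommGroup V] [Module K V] [DecidableEq ι] {u : ι → V}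
    (hind : LinearIndependent K u) :
    ∃ F : ι → Dual K V, ∀ i j, F j (u i) = if i = j then 1 else 0 := by
  classical
  refine ⟨fun j => (Basis.extend hind.linearIndepOn_id).coord
    ⟨u j, Basis.subset_extend _ ⟨j, rfl⟩⟩, fun i j => ?_⟩
  rw [Basis.coord_apply]
  have : u i = Basis.extend hind.linearIndepOn_id ⟨u i, Basis.subset_extend _ ⟨i, rfl⟩⟩ := by
    rw [Basis.extend_apply_self]
  rw [this, Basis.repr_self, Finsupp.single_apply]
  simp only [Subtype.mk.injEq, hind.injective.eq_iff]

/-- If `n` vectors are independent at the residue field and all minors of order `n + 1` of a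
submodule containing them lie in `I`, then modulo `I` this submodule is spanned by them. -/
theorem exists_relation_of_minors (hε : ∀ r, ε r ≠ 0 → IsUnit r) {d n : ℕ}
    (W : Submodule O (Forms O d)) (I : Ideal O)
    (hI : ∀ u : Fin (n + 1) → Forms O d, (∀ i, u i ∈ W) →
      ∀ f : Fin (n + 1) → Dual O (Forms O d), (Matrix.of fun i j => f j (u i)).det ∈ I)
    (u : Fin n → Forms O d) (hu : ∀ i, u i ∈ W) {g : Forms O d} (hg : g ∈ W)
    (hind : LinearIndependent K fun i => mapForms (ε : O →+* K) (u i)) :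
    ∃ k : Fin n → O, ∀ m, coeff m (g - ∑ i, k i • u i).1 ∈ I := by
  obtain ⟨F, hF⟩ : ∃ F : Fin n → Dual K (Forms K d), ∀ i j,
      F j (mapForms (ε : O →+* K) (u i)) = if i = j then 1 else 0 :=
    exists_dual_family hind
  set M : Matrix (Fin n) (Fin n) O := Matrix.of fun i j => extendDual O (F j) (u i) with hM
  have hMu : IsUnit M.det := by
    apply hε
    have h1 : (ε : O →+* K) M.det = 1 := by
      rw [RingHom.map_det, RingHom.mapMatrix_apply]
      have : M.map (ε : O →+* K) = 1 := by
        ext i j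
        rw [Matrix.map_apply, hM, Matrix.of_apply, RingHom.coe_coe, extendDual_map,
          extendDual_self, hF, Matrix.one_apply]
      rw [this, Matrix.det_one]
    intro h
    exact one_ne_zero (h1.symm.trans h)
  -- This choice makes the remainder `g'` vanish under every functional extending an `F j`.
  set k := Matrix.vecMul (fun j => extendDual O (F j) g) M⁻¹ with hk
  refine ⟨k, fun m => ?_⟩
  set g' := g - ∑ i, k i • u i with hg'
  have hg'W : g' ∈ W := sub_mem hg (Submodule.sum_mem _ fun i _ => Submodule.smul_mem _ _ (hu i))
  have hz : ∀ j, extendDual O (F j) g' = 0 := by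
    intro j
    have h1 : Matrix.vecMul k M = fun j => extendDual O (F j) g := by
      rw [hk, Matrix.vecMul_vecMul, Matrix.nonsing_inv_mul _ hMu, Matrix.vecMul_one]
    have h2 := congrFun h1 j
    simp only [Matrix.vecMul, dotProduct, hM, Matrix.of_apply] at h2
    rw [hg', map_sub, map_sum, sub_eq_zero, ← h2]
    simp
  by_cases hm : m.degree = d
  · obtain ⟨ℓ, hℓ⟩ : ∃ ℓ : Dual O (Forms O d), ∀ f, ℓ f = coeff m f.1 :=
      ⟨(monBasis O d).coord ⟨m, (mem_mon_iff _).2 hm⟩, fun f => monBasis_repr _ _⟩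
    -- The first row of this matrix is `(ℓ g', 0, …, 0)`, so the minor equals `ℓ g'` times the unit
    -- `M.det`.
    have h1 := hI (Fin.cons g' u) (by
      intro i
      refine Fin.cases ?_ ?_ i
      · exact hg'W
      · exact hu) (Fin.cons ℓ fun j => extendDual O (F j))
    rw [Matrix.det_succ_row_zero, Fin.sum_univ_succ, Finset.sum_eq_zero, add_zero] at h1
    · simp only [Fin.val_zero, pow_zero, one_mul, Matrix.of_apply, Fin.cons_zero, hℓ] at h1
      have h3 : ((Matrix.of fun i j => (Fin.cons ℓ fun j => extendDual O (F j) :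
          Fin (n + 1) → Dual O (Forms O d)) j
          ((Fin.cons g' u : Fin (n + 1) → Forms O d) i)).submatrix Fin.succ
          (Fin.succAbove 0)) = M := by
        ext i j
        simp [hM]
      rw [h3] at h1
      exact (Ideal.mul_unit_mem_iff_mem I hMu).1 h1
    · intro j _
      simp [hz]
  · rw [g'.isHomogeneous.coeff_eq_zero hm]
    exact I.zero_mem

theorem sum_univ_eleven {M : Type*} [AddCommMonoid M] (f : Fin 11 → M) :
    ∑ i, f i = f 0 + f 1 + f 2 + f 3 + f 4 + f 5 + f 6 + f 7 + f 8 + f 9 + f 10 := by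
  rw [Fin.sum_univ_castSucc, Fin.sum_univ_castSucc, Fin.sum_univ_castSucc, Fin.sum_univ_eight]
  rfl

/-- Eleven products of elements of the pencil `(a, b)` and of the corresponding cubics. -/
def quinticFrame {R : Type*} [CommRing R] (a b : Forms R 2) (x : Fin 4 → Forms R 1)
    (c : Forms R 3) : Fin 11 → Forms R 5 :=
  ![mul23 a (mul21 a (x 0)), mul23 a (mul21 a (x 2)), mul23 a (mul21 a (x 3)),
    mul23 a (mul21 b (x 0)), mul23 a (mul21 b (x 2)), mul23 a (mul21 b (x 3)),
    mul23 b (mul21 b (x 0)), mul23 b (mul21 b (x 1)), mul23 b (mul21 b (x 2)),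
    mul23 b (mul21 b (x 3)), mul23 b c]

theorem mapForms_quinticFrame {R S : Type*} [CommRing R] [CommRing S] (φ : R →+* S)
    (a b : Forms R 2) (x : Fin 4 → Forms R 1) (c : Forms R 3) (i : Fin 11) :
    mapForms φ (quinticFrame a b x c i) =
      quinticFrame (mapForms φ a) (mapForms φ b) (fun j => mapForms φ (x j)) (mapForms φ c) i := by
  fin_cases i <;> simp [quinticFrame]

/-- The first ten products are distinct monomials, all divisible by `x₀²`. The last is `x₀ x₁³ g`
with `g` free of `x₀`, and it contains none of them. -/
theorem linearIndependent_quinticFrame {x : Fin 4 → Forms K 1} (hx : IsCoord x)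
    {g : Forms K 1} {b₀ c₀ d₀ : K}
    (hg : g.1 = C b₀ * (x 1).1 + C c₀ * (x 2).1 + C d₀ * (x 3).1)
    (hne : b₀ ≠ 0 ∨ c₀ ≠ 0 ∨ d₀ ≠ 0) :
    LinearIndependent K (quinticFrame (mul11 (x 0) (x 0)) (mul11 (x 0) (x 1)) x
      (mul21 (mul11 (x 1) (x 1)) g)) := by
  rw [Fintype.linearIndependent_iff]
  intro k hk
  have hk' := congrArg Subtype.val hk
  obtain ⟨τ, hτ⟩ := hx.exists_inverse
  replace hk' := congrArg τ hk'
  have key : C (k 0) * mono K 5 0 0 0 +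
      C (k 1) * mono K 4 0 1 0 +
      C (k 2) * mono K 4 0 0 1 +
      C (k 3) * mono K 4 1 0 0 +
      C (k 4) * mono K 3 1 1 0 +
      C (k 5) * mono K 3 1 0 1 +
      C (k 6) * mono K 3 2 0 0 +
      C (k 7) * mono K 2 3 0 0 +
      C (k 8) * mono K 2 2 1 0 +
      C (k 9) * mono K 2 2 0 1 +
      C (k 10 * b₀) * mono K 1 4 0 0 +
      C (k 10 * c₀) * mono K 1 3 1 0 +
      C (k 10 * d₀) * mono K 1 3 0 1 = 0 := by
    simp only [sum_univ_eleven, quinticFrame, Forms.coe_add, Forms.coe_smul,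
      Forms.coe_zero, coe_mul11, coe_mul21, coe_mul23, Matrix.cons_val_zero, Matrix.cons_val_one, Matrix.cons_val,
      hg, map_add, map_mul, hτ, algHom_C, algebraMap_eq, map_zero] at hk'
    simp only [mono, C_mul]
    linear_combination hk'
  have h0 : k 0 = 0 := by
    have := congrArg (coeff (expo 5 0 0 0)) key
    simpa only [coeff_add, coeff_mono, coeff_zero, Nat.reduceEqDiff, OfNat.ofNat_ne_zero, OfNat.zero_ne_ofNat,
        OfNat.ofNat_ne_one, OfNat.one_ne_ofNat, zero_ne_one, one_ne_zero, and_self, and_false, false_and, if_true,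
        if_false, add_zero, zero_add] using this
  have h1 : k 1 = 0 := by
    have := congrArg (coeff (expo 4 0 1 0)) key
    simpa only [coeff_add, coeff_mono, coeff_zero, Nat.reduceEqDiff, OfNat.ofNat_ne_zero, OfNat.zero_ne_ofNat,
        OfNat.ofNat_ne_one, OfNat.one_ne_ofNat, zero_ne_one, one_ne_zero, and_self, and_false, false_and, if_true,
        if_false, add_zero, zero_add] using this
  have h2 : k 2 = 0 := by
    have := congrArg (coeff (expo 4 0 0 1)) key
    simpa only [coeff_add, coeff_mono, coeff_zero, Nat.reduceEqDiff, OfNat.ofNat_ne_zero, OfNat.zero_ne_ofNat,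
        OfNat.ofNat_ne_one, OfNat.one_ne_ofNat, zero_ne_one, one_ne_zero, and_self, and_false, false_and, if_true,
        if_false, add_zero, zero_add] using this
  have h3 : k 3 = 0 := by
    have := congrArg (coeff (expo 4 1 0 0)) key
    simpa only [coeff_add, coeff_mono, coeff_zero, Nat.reduceEqDiff, OfNat.ofNat_ne_zero, OfNat.zero_ne_ofNat,
        OfNat.ofNat_ne_one, OfNat.one_ne_ofNat, zero_ne_one, one_ne_zero, and_self, and_false, false_and, if_true,
        if_false, add_zero, zero_add] using this
  have h4 : k 4 = 0 := by
    have := congrArg (coeff (expo 3 1 1 0)) key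
    simpa only [coeff_add, coeff_mono, coeff_zero, Nat.reduceEqDiff, OfNat.ofNat_ne_zero, OfNat.zero_ne_ofNat,
        OfNat.ofNat_ne_one, OfNat.one_ne_ofNat, zero_ne_one, one_ne_zero, and_self, and_false, false_and, if_true,
        if_false, add_zero, zero_add] using this
  have h5 : k 5 = 0 := by
    have := congrArg (coeff (expo 3 1 0 1)) key
    simpa only [coeff_add, coeff_mono, coeff_zero, Nat.reduceEqDiff, OfNat.ofNat_ne_zero, OfNat.zero_ne_ofNat,
        OfNat.ofNat_ne_one, OfNat.one_ne_ofNat, zero_ne_one, one_ne_zero, and_self, and_false, false_and, if_true,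
        if_false, add_zero, zero_add] using this
  have h6 : k 6 = 0 := by
    have := congrArg (coeff (expo 3 2 0 0)) key
    simpa only [coeff_add, coeff_mono, coeff_zero, Nat.reduceEqDiff, OfNat.ofNat_ne_zero, OfNat.zero_ne_ofNat,
        OfNat.ofNat_ne_one, OfNat.one_ne_ofNat, zero_ne_one, one_ne_zero, and_self, and_false, false_and, if_true,
        if_false, add_zero, zero_add] using this
  have h7 : k 7 = 0 := by
    have := congrArg (coeff (expo 2 3 0 0)) key
    simpa only [coeff_add, coeff_mono, coeff_zero, Nat.reduceEqDiff, OfNat.ofNat_ne_zero, OfNat.zero_ne_ofNat,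
        OfNat.ofNat_ne_one, OfNat.one_ne_ofNat, zero_ne_one, one_ne_zero, and_self, and_false, false_and, if_true,
        if_false, add_zero, zero_add] using this
  have h8 : k 8 = 0 := by
    have := congrArg (coeff (expo 2 2 1 0)) key
    simpa only [coeff_add, coeff_mono, coeff_zero, Nat.reduceEqDiff, OfNat.ofNat_ne_zero, OfNat.zero_ne_ofNat,
        OfNat.ofNat_ne_one, OfNat.one_ne_ofNat, zero_ne_one, one_ne_zero, and_self, and_false, false_and, if_true,
        if_false, add_zero, zero_add] using this
  have h9 : k 9 = 0 := by
    have := congrArg (coeff (expo 2 2 0 1)) key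
    simpa only [coeff_add, coeff_mono, coeff_zero, Nat.reduceEqDiff, OfNat.ofNat_ne_zero, OfNat.zero_ne_ofNat,
        OfNat.ofNat_ne_one, OfNat.one_ne_ofNat, zero_ne_one, one_ne_zero, and_self, and_false, false_and, if_true,
        if_false, add_zero, zero_add] using this
  have h10 : k 10 * b₀ = 0 := by
    have := congrArg (coeff (expo 1 4 0 0)) key
    simpa only [coeff_add, coeff_mono, coeff_zero, Nat.reduceEqDiff, OfNat.ofNat_ne_zero, OfNat.zero_ne_ofNat,
        OfNat.ofNat_ne_one, OfNat.one_ne_ofNat, zero_ne_one, one_ne_zero, and_self, and_false, false_and, if_true,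
        if_false, add_zero, zero_add] using this
  have h11 : k 10 * c₀ = 0 := by
    have := congrArg (coeff (expo 1 3 1 0)) key
    simpa only [coeff_add, coeff_mono, coeff_zero, Nat.reduceEqDiff, OfNat.ofNat_ne_zero, OfNat.zero_ne_ofNat,
        OfNat.ofNat_ne_one, OfNat.one_ne_ofNat, zero_ne_one, one_ne_zero, and_self, and_false, false_and, if_true,
        if_false, add_zero, zero_add] using this
  have h12 : k 10 * d₀ = 0 := by
    have := congrArg (coeff (expo 1 3 0 1)) key
    simpa only [coeff_add, coeff_mono, coeff_zero, Nat.reduceEqDiff, OfNat.ofNat_ne_zero, OfNat.zero_ne_ofNat,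
        OfNat.ofNat_ne_one, OfNat.one_ne_ofNat, zero_ne_one, one_ne_zero, and_self, and_false, false_and, if_true,
        if_false, add_zero, zero_add] using this
  have h13 : k 10 = 0 := by
    rcases hne with h | h | h
    · exact (mul_eq_zero.1 h10).resolve_right h
    · exact (mul_eq_zero.1 h11).resolve_right h
    · exact (mul_eq_zero.1 h12).resolve_right h
  intro i
  fin_cases i <;> assumption

end Relation

/-! ### The scheme of zeros of the minors near a point of `𝕄` -/

section LocalStructure

variable {K : Type*} [Field K] {O : Type*} [CommRing O] [Algebra K O] (ε : O →ₐ[K] K)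

/-- In the normal form, the ideal of the nine parameters transversal to `𝕄` is contained in any
ideal containing the minors of order `12` of the products. -/
theorem normal_form_parameters_mem (hε : ∀ r, ε r ≠ 0 → IsUnit r) (h2 : (2 : K) ≠ 0)
    (W : Submodule O (Forms O 5)) (I : Ideal O)
    (hI : ∀ u : Fin 12 → Forms O 5, (∀ i, u i ∈ W) →
      ∀ f : Fin 12 → Dual O (Forms O 5), (Matrix.of fun i j => f j (u i)).det ∈ I)
    {x₀ : Fin 4 → Forms K 1} (hx₀ : IsCoord x₀) {b₀ c₀ d₀ : K}
    (hne : b₀ ≠ 0 ∨ c₀ ≠ 0 ∨ d₀ ≠ 0)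
    (a b : Forms O 2) (c : Forms O 3) (x : Fin 4 → Forms O 1)
    (haW : ∀ f, mul23 a (mul21 a f) ∈ W) (habW : ∀ f, mul23 a (mul21 b f) ∈ W)
    (hbW : ∀ f, mul23 b (mul21 b f) ∈ W) (hacW : mul23 a c ∈ W) (hbcW : mul23 b c ∈ W)
    (hx : ∀ i, mapForms (ε : O →+* K) (x i) = x₀ i)
    (e₁ e₂ t r₁ r₂ r₃ s₁ s₂ s₃ s₄ s₅ s₆ : O)
    (hεe : ε e₁ = 0 ∧ ε e₂ = 0 ∧ ε t = 0) (hεr : ε r₁ = 0 ∧ ε r₂ = 0 ∧ ε r₃ = 0)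
    (hεs : ε s₁ = b₀ ∧ ε s₂ = c₀ ∧ ε s₃ = d₀) (hεs' : ε s₄ = 0 ∧ ε s₅ = 0 ∧ ε s₆ = 0)
    (ha : a.1 = (x 0).1 * ((x 0).1 + 2 * (C e₁ * (x 2).1 + C e₂ * (x 3).1)) +
        C t * (C s₁ * (x 1).1 ^ 2 + C s₂ * ((x 1).1 * (x 2).1) + C s₃ * ((x 1).1 * (x 3).1) +
          C s₄ * (x 2).1 ^ 2 + C s₅ * ((x 2).1 * (x 3).1) + C s₆ * (x 3).1 ^ 2))
    (hb : b.1 = (x 0).1 * (x 1).1 -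
        C t * (C r₁ * (x 2).1 ^ 2 + C r₂ * ((x 2).1 * (x 3).1) + C r₃ * (x 3).1 ^ 2))
    (hc : c.1 = (x 1).1 * (C s₁ * (x 1).1 ^ 2 + C s₂ * ((x 1).1 * (x 2).1) +
          C s₃ * ((x 1).1 * (x 3).1) +
          C s₄ * (x 2).1 ^ 2 + C s₅ * ((x 2).1 * (x 3).1) + C s₆ * (x 3).1 ^ 2) +
        ((x 0).1 + 2 * (C e₁ * (x 2).1 + C e₂ * (x 3).1)) *
          (C r₁ * (x 2).1 ^ 2 + C r₂ * ((x 2).1 * (x 3).1) + C r₃ * (x 3).1 ^ 2)) :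
    Ideal.span {e₁, e₂, t, r₁, r₂, r₃, s₄, s₅, s₆} ≤ I := by
  obtain ⟨he₁, he₂, ht⟩ := hεe
  obtain ⟨hr₁, hr₂, hr₃⟩ := hεr
  obtain ⟨hs₁, hs₂, hs₃⟩ := hεs
  obtain ⟨hs₄, hs₅, hs₆⟩ := hεs'
  have hx' : ∀ i, MvPolynomial.map (ε : O →+* K) (x i).1 = (x₀ i).1 := fun i =>
    congrArg Subtype.val (hx i)
  set N : Ideal O := Ideal.span {e₁, e₂, t, r₁, r₂, r₃, s₄, s₅, s₆} with hN
  set m : Ideal O := RingHom.ker (ε : O →+* K) with hm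
  -- By Nakayama's lemma it suffices that `N ≤ I ⊔ m • N`. This permits computing modulo all
  -- products of two of the nine parameters.
  refine Submodule.le_of_le_smul_of_le_jacobson_bot (I := m)
    (Submodule.fg_span (Set.toFinite _))
    (isUnit_of_residue ε hε) ?_
  set J : Ideal O := I ⊔ m • N with hJ
  -- the relation modulo `I`
  obtain ⟨g, hg⟩ : ∃ g : Forms K 1, g.1 = C b₀ * (x₀ 1).1 + C c₀ * (x₀ 2).1 + C d₀ * (x₀ 3).1 :=
    ⟨b₀ • x₀ 1 + c₀ • x₀ 2 + d₀ • x₀ 3, by simp⟩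
  have hεa : mapForms (ε : O →+* K) a = mul11 (x₀ 0) (x₀ 0) := Forms.ext (by
    simp [ha, hx', he₁, he₂, ht])
  have hεb : mapForms (ε : O →+* K) b = mul11 (x₀ 0) (x₀ 1) := Forms.ext (by
    simp [hb, hx', ht])
  have hεc : mapForms (ε : O →+* K) c = mul21 (mul11 (x₀ 1) (x₀ 1)) g := Forms.ext (by
    simp only [coe_mapForms, hc, hg, hx', he₁, he₂, hr₁, hr₂, hr₃, hs₁, hs₂, hs₃, hs₄, hs₅, hs₆,
      map_add, map_mul, map_pow, map_C, RingHom.coe_coe, coe_mul21, coe_mul11, map_zero]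
    ring)
  obtain ⟨k, hk⟩ := exists_relation_of_minors ε hε W I hI (quinticFrame a b x c)
    (by intro i; fin_cases i <;> simp [quinticFrame, haW, habW, hbW, hbcW]) hacW (by
      simp only [mapForms_quinticFrame, hεa, hεb, hεc, hx]
      exact linearIndependent_quinticFrame hx₀ hg hne)
  -- the relation over the quotient ring
  set π := Ideal.Quotient.mk J with hπ
  have hπN : ∀ p ∈ N, ∀ q ∈ N, ε p = 0 → π p * π q = 0 := by
    intro p hp q hq h
    rw [← map_mul, hπ, Ideal.Quotient.eq_zero_iff_mem]
    exact Ideal.mem_sup_right (Submodule.smul_mem_smul h hq)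
  have me₁ : e₁ ∈ N := Ideal.subset_span (by simp)
  have me₂ : e₂ ∈ N := Ideal.subset_span (by simp)
  have mt : t ∈ N := Ideal.subset_span (by simp)
  have mr₁ : r₁ ∈ N := Ideal.subset_span (by simp)
  have mr₂ : r₂ ∈ N := Ideal.subset_span (by simp)
  have mr₃ : r₃ ∈ N := Ideal.subset_span (by simp)
  have ms₄ : s₄ ∈ N := Ideal.subset_span (by simp)
  have ms₅ : s₅ ∈ N := Ideal.subset_span (by simp)
  have ms₆ : s₆ ∈ N := Ideal.subset_span (by simp)
  have hC : ∀ p ∈ N, ∀ q ∈ N, ε p = 0 →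
      (C (π p) : MvPolynomial (Fin 4) (O ⧸ J)) * C (π q) = 0 := by
    intro p hp q hq h
    rw [← C_mul, hπN p hp q hq h, C_0]
  obtain ⟨τ, hτ⟩ := (isCoord_of_residue ε hε hx₀ hx |>.mapForms π).exists_inverse
  have hτ' : ∀ i, τ (MvPolynomial.map π (x i).1) = X i := hτ
  have hrel : MvPolynomial.map π (mul23 a c - ∑ i, k i • quinticFrame a b x c i).1 = 0 := by
    ext n
    rw [coeff_map, coeff_zero, hπ, Ideal.Quotient.eq_zero_iff_mem]
    exact Ideal.mem_sup_left (hk n)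
  replace hrel := congrArg τ hrel
  have h2O : IsUnit (2 : O ⧸ J) := by
    have := (hε 2 (by rwa [map_ofNat])).map π
    rwa [map_ofNat] at this
  have hunit : IsUnit (π s₁) ∨ IsUnit (π s₂) ∨ IsUnit (π s₃) := by
    rcases hne with h | h | h
    · exact Or.inl ((hε s₁ (by rwa [hs₁])).map π)
    · exact Or.inr (Or.inl ((hε s₂ (by rwa [hs₂])).map π))
    · exact Or.inr (Or.inr ((hε s₃ (by rwa [hs₃])).map π))
  -- In the quotient by `J` the products of `t` with `s₄, s₅, s₆` and the `rⱼ`, and of the `eᵢ` with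
  -- the `rⱼ`, drop out. The normal form then takes the truncated shape used in the first-order
  -- computation.
  have hfin := first_order_vanishing h2O (π e₁) (π e₂) (π t) (π r₁) (π r₂) (π r₃) (π s₄) (π s₅)
    (π s₆) (π s₁) (π s₂) (π s₃) (π (k 0)) (π (k 1)) (π (k 2)) (π (k 3)) (π (k 4)) (π (k 5))
    (π (k 6)) (π (k 7)) (π (k 8)) (π (k 9)) (π (k 10)) hunit
    (τ (MvPolynomial.map π a.1)) (τ (MvPolynomial.map π b.1)) (τ (MvPolynomial.map π c.1))
    (X 0) (X 1) (X 2) (X 3) rfl rfl rfl rfl ?_ ?_ ?_ ?_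
  · obtain ⟨⟨y₁, y₂, y₃⟩, ⟨y₄, y₅, y₆⟩, y₇, y₈, y₉⟩ := hfin
    rw [hN, Ideal.span_le]
    rintro p (rfl | rfl | rfl | rfl | rfl | rfl | rfl | rfl | rfl) <;>
      exact Ideal.Quotient.eq_zero_iff_mem.1 (by assumption)
  · simp only [ha, map_add, map_mul, map_pow, map_C, map_ofNat, hτ', algHom_C, algebraMap_eq]
    linear_combination X 2 ^ 2 * hC t mt s₄ ms₄ ht + X 2 * X 3 * hC t mt s₅ ms₅ ht +
      X 3 ^ 2 * hC t mt s₆ ms₆ ht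
  · simp only [hb, map_add, map_sub, map_mul, map_pow, map_C, hτ', algHom_C, algebraMap_eq]
    linear_combination -X 2 ^ 2 * hC t mt r₁ mr₁ ht - X 2 * X 3 * hC t mt r₂ mr₂ ht -
      X 3 ^ 2 * hC t mt r₃ mr₃ ht
  · simp only [hc, map_add, map_mul, map_pow, map_C, map_ofNat, hτ', algHom_C,
      algebraMap_eq]
    linear_combination 2 * X 2 * (X 2 ^ 2 * hC e₁ me₁ r₁ mr₁ he₁ +
        X 2 * X 3 * hC e₁ me₁ r₂ mr₂ he₁ + X 3 ^ 2 * hC e₁ me₁ r₃ mr₃ he₁) +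
      2 * X 3 * (X 2 ^ 2 * hC e₂ me₂ r₁ mr₁ he₂ +
        X 2 * X 3 * hC e₂ me₂ r₂ mr₂ he₂ + X 3 ^ 2 * hC e₂ me₂ r₃ mr₃ he₂)
  · simp only [sum_univ_eleven, quinticFrame, Forms.coe_add, Forms.coe_sub, Forms.coe_smul,
      coe_mul21, coe_mul23, Matrix.cons_val_zero, Matrix.cons_val_one, Matrix.cons_val,
      map_add, map_sub, map_mul, map_C, hτ', algHom_C, algebraMap_eq, map_zero] at hrel
    linear_combination hrel

/-- The local structure of the scheme of zeros of `⋀¹² ν` at a point of `𝕄`: on it, the pencil and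
the space of cubics have the shape of the points of `𝕄`. -/
theorem local_structure (hε : ∀ r, ε r ≠ 0 → IsUnit r) (h2 : (2 : K) ≠ 0)
    (v : Basis2 K) (w : Basis3 K) (α : Fin 2 → Fin 8 → O) (β : Fin 8 → Fin 12 → O)
    {x₀ : Fin 4 → Forms K 1} (hx₀ : IsCoord x₀) {g₀ : Forms K 1} {b₀ c₀ d₀ : K}
    (hg₀ : g₀.1 = C b₀ * (x₀ 1).1 + C c₀ * (x₀ 2).1 + C d₀ * (x₀ 3).1)
    (hne : b₀ ≠ 0 ∨ c₀ ≠ 0 ∨ d₀ ≠ 0)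
    (hA : Submodule.span K (Set.range ![mul11 (x₀ 0) (x₀ 0), mul11 (x₀ 0) (x₀ 1)]) =
      chartSpan K v (fun i j => ε (α i j)))
    (hB : Submodule.span K (Set.range (cubicFrame (mul11 (x₀ 0) (x₀ 0)) (mul11 (x₀ 0) (x₀ 1)) x₀
      (mul21 (mul11 (x₀ 1) (x₀ 1)) g₀))) = chartSpan K w (fun i j => ε (β i j)))
    (hAB : ∀ a ∈ chartSpan O v α, ∀ f : Forms O 1, mul21 a f ∈ chartSpan O w β)
    (hΔ : ∀ (τ : O) (f₀ f₁ : Forms O 1),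
      (mapForms (ε : O →+* K) f₀ ≠ 0 ∨ mapForms (ε : O →+* K) f₁ ≠ 0) →
      τ • (mul21 (chartRow O v α 0) f₀ + mul21 (chartRow O v α 1) f₁) = 0 → τ = 0)
    (I : Ideal O)
    (hI : ∀ u : Fin 12 → Forms O 5, (∀ i, u i ∈ mulSpan (chartSpan O v α) (chartSpan O w β)) →
      ∀ f : Fin 12 → Dual O (Forms O 5), (Matrix.of fun i j => f j (u i)).det ∈ I) :
    ∃ (a b : Forms O 2) (c : Forms O 3) (x : Fin 4 → Forms O 1) (g : Forms O 1),
      Submodule.span O (Set.range ![a, b]) = chartSpan O v α ∧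
      Submodule.span O (Set.range (cubicFrame a b x c)) = chartSpan O w β ∧
      mapForms (Ideal.Quotient.mk I) a =
        mapForms (Ideal.Quotient.mk I) (mul11 (x 0) (x 0)) ∧
      mapForms (Ideal.Quotient.mk I) b =
        mapForms (Ideal.Quotient.mk I) (mul11 (x 0) (x 1)) ∧
      mapForms (Ideal.Quotient.mk I) c =
        mapForms (Ideal.Quotient.mk I) (mul21 (mul11 (x 1) (x 1)) g) := by
  obtain ⟨a, b, c, x, e₁, e₂, t, r₁, r₂, r₃, s₁, s₂, s₃, s₄, s₅, s₆, hsA, hsB, hx, hεe, hεr, hεs,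
    hεs', ha, hb, hc⟩ := exists_blowup_normal_form ε hε h2 v w α β hx₀ hg₀ hne hA hB hAB hΔ
  have hma : a ∈ chartSpan O v α := hsA ▸ Submodule.subset_span ⟨0, rfl⟩
  have hmb : b ∈ chartSpan O v α := hsA ▸ Submodule.subset_span ⟨1, rfl⟩
  have hmc : c ∈ chartSpan O w β := hsB ▸ Submodule.subset_span ⟨7, rfl⟩
  have hle := normal_form_parameters_mem ε hε h2 (mulSpan (chartSpan O v α) (chartSpan O w β)) I hI
    hx₀ hne a b c x (fun f => mul_mem_mulSpan hma (hAB _ hma f))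
    (fun f => mul_mem_mulSpan hma (hAB _ hmb f)) (fun f => mul_mem_mulSpan hmb (hAB _ hmb f))
    (mul_mem_mulSpan hma hmc) (mul_mem_mulSpan hmb hmc) hx e₁ e₂ t r₁ r₂ r₃ s₁ s₂ s₃ s₄ s₅ s₆
    hεe hεr hεs hεs' ha hb hc
  have hz : ∀ p ∈ ({e₁, e₂, t, r₁, r₂, r₃, s₄, s₅, s₆} : Set O), Ideal.Quotient.mk I p = 0 :=
    fun p hp => Ideal.Quotient.eq_zero_iff_mem.2 (hle (Ideal.subset_span hp))
  have ze₁ := hz e₁ (by simp)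
  have ze₂ := hz e₂ (by simp)
  have zt := hz t (by simp)
  have zr₁ := hz r₁ (by simp)
  have zr₂ := hz r₂ (by simp)
  have zr₃ := hz r₃ (by simp)
  have zs₄ := hz s₄ (by simp)
  have zs₅ := hz s₅ (by simp)
  have zs₆ := hz s₆ (by simp)
  -- Once the nine parameters vanish, `Q` is `x₁` times this linear form.
  refine ⟨a, b, c, x, s₁ • x 1 + s₂ • x 2 + s₃ • x 3, hsA, hsB, Forms.ext ?_, Forms.ext ?_,
    Forms.ext ?_⟩
  · simp [ha, ze₁, ze₂, zt]
  · simp [hb, zt]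
  · simp only [coe_mapForms, hc, map_add, map_mul, map_pow, map_C, ze₁, ze₂, zr₁, zr₂, zr₃, zs₄,
      zs₅, zs₆, coe_mul21, coe_mul11, Forms.coe_add, Forms.coe_smul, map_zero]
    ring

end LocalStructure

universe u

/-! ## Coordinates of frames in a chart -/

section Closure

/-- Homogenization: a polynomial in fractions `p / δ`, with denominators cleared. -/
theorem exists_homogenization {K : Type u} [Field K] {σ : Type} (f : MvPolynomial σ K) :
    ∃ (n : ℕ) (F : MvPolynomial (Option σ) K), ∀ (S : Type u) [CommRing S] [Algebra K S]
      (δ : S) (c p : σ → S), (∀ s, p s = δ * c s) →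
        aeval (fun o : Option σ => o.elim δ p) F = δ ^ n * aeval c f := by
  induction f using MvPolynomial.induction_on with
  | C a => exact ⟨0, C a, fun S _ _ δ c p _ => by simp⟩
  | add f g hf hg =>
    obtain ⟨n, F, hF⟩ := hf
    obtain ⟨m, G, hG⟩ := hg
    refine ⟨n + m, X none ^ m * F + X none ^ n * G, fun S _ _ δ c p h => ?_⟩
    simp only [map_add, map_mul, map_pow, aeval_X, hF S δ c p h, hG S δ c p h, Option.elim_none]
    ring
  | mul_X f i hf =>
    obtain ⟨n, F, hF⟩ := hf
    refine ⟨n + 1, F * X (some i), fun S _ _ δ c p h => ?_⟩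
    simp only [map_mul, aeval_X, hF S δ c p h, Option.elim_some, h]
    ring

variable {K : Type u} [Field K] (v : Basis2 K) (w : Basis3 K)

/-- The coordinates of a pair of matrices, as a function on `Coord`. -/
def pairCoord {S : Type*} (α : Fin 2 → Fin 8 → S) (β : Fin 8 → Fin 12 → S) : Coord → S :=
  Sum.elim (fun s => α s.1 s.2) fun s => β s.1 s.2

theorem pairCoord_self {S : Type*} (x : Coord → S) :
    pairCoord (fun i j => x (Sum.inl (i, j))) (fun i j => x (Sum.inr (i, j))) = x := by
  funext s
  rcases s with s | s <;> rfl

section Frame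

variable {S : Type*} [CommRing S] [Algebra K S] {T : Type*} [CommRing T] [Algebra K T]

/-- The common denominator of the chart coordinates of a pair of frames. -/
def frameDet (a : Fin 2 → Forms S 2) (b : Fin 8 → Forms S 3) : S :=
  (inlMatrix S v a).det * (inlMatrix S w b).det

/-- The numerators of the chart coordinates of a pair of frames. -/
def frameNum (a : Fin 2 → Forms S 2) (b : Fin 8 → Forms S 3) : Coord → S :=
  pairCoord
    (fun i j => (inlMatrix S w b).det * ((inlMatrix S v a).adjugate * inrMatrix S v a) i j)
    (fun i j => (inlMatrix S v a).det * ((inlMatrix S w b).adjugate * inrMatrix S w b) i j)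

theorem frameDet_map (φ : S →ₐ[K] T) (a : Fin 2 → Forms S 2) (b : Fin 8 → Forms S 3) :
    frameDet v w (fun i => mapForms (φ : S →+* T) (a i)) (fun i => mapForms (φ : S →+* T) (b i)) =
      φ (frameDet v w a b) := by
  rw [frameDet, frameDet, inlMatrix_map, inlMatrix_map, map_mul, AlgHom.map_det, AlgHom.map_det]
  rfl

theorem frameNum_map (φ : S →ₐ[K] T) (a : Fin 2 → Forms S 2) (b : Fin 8 → Forms S 3) (s : Coord) :
    frameNum v w (fun i => mapForms (φ : S →+* T) (a i)) (fun i => mapForms (φ : S →+* T) (b i)) s =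
      φ (frameNum v w a b s) := by
  have key : ∀ {r m d : ℕ} (v : Basis (Fin r ⊕ Fin m) K (Forms K d)) (a : Fin r → Forms S d)
      (i : Fin r) (j : Fin m),
      ((inlMatrix T v fun i => mapForms (φ : S →+* T) (a i)).adjugate *
        inrMatrix T v fun i => mapForms (φ : S →+* T) (a i)) i j =
      φ (((inlMatrix S v a).adjugate * inrMatrix S v a) i j) := by
    intro r m d v a i j
    rw [inlMatrix_map, inrMatrix_map]
    have h : ((inlMatrix S v a).map φ).adjugate = (inlMatrix S v a).adjugate.map φ :=
      (AlgHom.map_adjugate φ (inlMatrix S v a)).symm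
    rw [h, ← Matrix.map_mul]
    rfl
  have key' : ∀ {r m d : ℕ} (v : Basis (Fin r ⊕ Fin m) K (Forms K d)) (a : Fin r → Forms S d),
      (inlMatrix T v fun i => mapForms (φ : S →+* T) (a i)).det = φ (inlMatrix S v a).det := by
    intro r m d v a
    rw [inlMatrix_map, AlgHom.map_det]
    rfl
  rcases s with s | s <;> simp [frameNum, pairCoord, key, key']

variable {α : Fin 2 → Fin 8 → S} {β : Fin 8 → Fin 12 → S}
  {a : Fin 2 → Forms S 2} {b : Fin 8 → Forms S 3}

/-- From `M A = N` follows `adj(M) N = det(M) A` over any ring. The determinant of the other frame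
brings both blocks to the common denominator. -/
theorem frameNum_eq (ha : inlMatrix S v a * Matrix.of α = inrMatrix S v a)
    (hb : inlMatrix S w b * Matrix.of β = inrMatrix S w b) (s : Coord) :
    frameNum v w a b s = frameDet v w a b * pairCoord α β s := by
  have key : ∀ {r m : ℕ} (M : Matrix (Fin r) (Fin r) S) (N A : Matrix (Fin r) (Fin m) S)
      (_ : M * A = N) (i : Fin r) (j : Fin m), (M.adjugate * N) i j = M.det * A i j := by
    rintro r m M N A rfl i j
    rw [← Matrix.mul_assoc, Matrix.adjugate_mul]
    simp
  rcases s with ⟨i, j⟩ | ⟨i, j⟩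
  · simp only [frameNum, frameDet, pairCoord, Sum.elim_inl, key _ _ _ ha i j, Matrix.of_apply]
    ring
  · simp only [frameNum, frameDet, pairCoord, Sum.elim_inr, key _ _ _ hb i j, Matrix.of_apply]
    ring

theorem isUnit_frameDet (ha : Submodule.span S (Set.range a) = chartSpan S v α)
    (hb : Submodule.span S (Set.range b) = chartSpan S w β) : IsUnit (frameDet v w a b) :=
  (isUnit_det_inlMatrix v α a ha).mul (isUnit_det_inlMatrix w β b hb)

theorem inlMatrix_mul_of_span {d r m : ℕ} (v : Basis (Fin r ⊕ Fin m) K (Forms K d))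
    {α : Fin r → Fin m → S} {a : Fin r → Forms S d}
    (ha : Submodule.span S (Set.range a) = chartSpan S v α) :
    inlMatrix S v a * Matrix.of α = inrMatrix S v a :=
  inlMatrix_mul v α a fun i => ha ▸ Submodule.subset_span ⟨i, rfl⟩

/-- Being a frame of the chart module amounts to a unit determinant and a matrix equation, both
preserved by base change. -/
theorem span_map_eq_chartSpan {d r m : ℕ} (v : Basis (Fin r ⊕ Fin m) K (Forms K d))
    {α : Fin r → Fin m → S} {a : Fin r → Forms S d} (φ : S →ₐ[K] T)
    (ha : Submodule.span S (Set.range a) = chartSpan S v α) :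
    Submodule.span T (Set.range fun i => mapForms (φ : S →+* T) (a i)) =
      chartSpan T v fun i j => φ (α i j) := by
  apply span_eq_chartSpan
  · have h : (inlMatrix T v fun i => mapForms (φ : S →+* T) (a i)).det =
        φ (inlMatrix S v a).det := by
      rw [inlMatrix_map, AlgHom.map_det]
      rfl
    rw [h]
    exact (isUnit_det_inlMatrix v α a ha).map φ
  · rw [inlMatrix_map, inrMatrix_map, ← inlMatrix_mul_of_span v ha, Matrix.map_mul]
    rfl

theorem exists_chart_of_frameDet_ne_zero {a : Fin 2 → Forms K 2} {b : Fin 8 → Forms K 3}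
    (h : frameDet v w a b ≠ 0) : ∃ x : Coord → K,
      Submodule.span K (Set.range a) = chartSpan K v (fun i j => x (Sum.inl (i, j))) ∧
      Submodule.span K (Set.range b) = chartSpan K w (fun i j => x (Sum.inr (i, j))) := by
  have ha : IsUnit (inlMatrix K v a).det := (left_ne_zero_of_mul h).isUnit
  have hb : IsUnit (inlMatrix K w b).det := (right_ne_zero_of_mul h).isUnit
  refine ⟨pairCoord (fun i j => ((inlMatrix K v a)⁻¹ * inrMatrix K v a) i j)
    (fun i j => ((inlMatrix K w b)⁻¹ * inrMatrix K w b) i j), ?_, ?_⟩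
  · apply span_eq_chartSpan v _ _ ha
    change inlMatrix K v a * ((inlMatrix K v a)⁻¹ * inrMatrix K v a) = _
    rw [← Matrix.mul_assoc, Matrix.mul_nonsing_inv _ ha, Matrix.one_mul]
  · apply span_eq_chartSpan w _ _ hb
    change inlMatrix K w b * ((inlMatrix K w b)⁻¹ * inrMatrix K w b) = _
    rw [← Matrix.mul_assoc, Matrix.mul_nonsing_inv _ hb, Matrix.one_mul]

end Frame

/-- The same `n` and `F` serve all rings and frames, so the identity may be used at points of a
family and again after specialization to another ring. -/
theorem exists_clear_denominators (f : MvPolynomial Coord K) :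
    ∃ (n : ℕ) (F : MvPolynomial (Option Coord) K), ∀ (S : Type u) [CommRing S] [Algebra K S]
      (a : Fin 2 → Forms S 2) (b : Fin 8 → Forms S 3) (α : Fin 2 → Fin 8 → S)
      (β : Fin 8 → Fin 12 → S), Submodule.span S (Set.range a) = chartSpan S v α →
      Submodule.span S (Set.range b) = chartSpan S w β →
        aeval (fun o : Option Coord => o.elim (frameDet v w a b) (frameNum v w a b)) F =
          frameDet v w a b ^ n * aeval (pairCoord α β) f := by
  obtain ⟨n, F, hF⟩ := exists_homogenization f
  exact ⟨n, F, fun S _ _ a b α β ha hb => hF S _ _ _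
    (frameNum_eq v w (inlMatrix_mul_of_span v ha) (inlMatrix_mul_of_span w hb))⟩

theorem aeval_frame_map {S T : Type u} [CommRing S] [Algebra K S] [CommRing T] [Algebra K T]
    (φ : S →ₐ[K] T) (a : Fin 2 → Forms S 2) (b : Fin 8 → Forms S 3)
    (F : MvPolynomial (Option Coord) K) :
    φ (aeval (fun o : Option Coord => o.elim (frameDet v w a b) (frameNum v w a b)) F) =
      aeval (fun o : Option Coord => o.elim
        (frameDet v w (fun i => mapForms (φ : S →+* T) (a i))
          (fun i => mapForms (φ : S →+* T) (b i)))
        (frameNum v w (fun i => mapForms (φ : S →+* T) (a i))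
          (fun i => mapForms (φ : S →+* T) (b i)))) F := by
  rw [← AlgHom.comp_apply, comp_aeval]
  congr 2
  funext o
  rcases o with _ | s
  · exact (frameDet_map v w φ a b).symm
  · exact (frameNum_map v w φ a b s).symm

/-- A polynomial that vanishes at the chart coordinates of the general members of a family of
frames parametrized by an affine space vanishes at the coordinates of every specialization. -/
theorem aeval_eq_zero_of_family [Infinite K] {ι : Type} (f : MvPolynomial Coord K)
    (a : Fin 2 → Forms (MvPolynomial ι K) 2) (b : Fin 8 → Forms (MvPolynomial ι K) 3)
    {g : MvPolynomial ι K} (hg : g ≠ 0)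
    (h : ∀ y : ι → K, aeval y g ≠ 0 → ∀ x : Coord → K,
      Submodule.span K (Set.range fun i =>
        mapForms ((aeval y : MvPolynomial ι K →ₐ[K] K) : MvPolynomial ι K →+* K) (a i)) =
          chartSpan K v (fun i j => x (Sum.inl (i, j))) →
      Submodule.span K (Set.range fun i =>
        mapForms ((aeval y : MvPolynomial ι K →ₐ[K] K) : MvPolynomial ι K →+* K) (b i)) =
          chartSpan K w (fun i j => x (Sum.inr (i, j))) → aeval x f = 0)
    {S : Type u} [CommRing S] [Algebra K S] (φ : MvPolynomial ι K →ₐ[K] S)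
    (α : Fin 2 → Fin 8 → S) (β : Fin 8 → Fin 12 → S)
    (ha : Submodule.span S (Set.range fun i => mapForms (φ : MvPolynomial ι K →+* S) (a i)) =
      chartSpan S v α)
    (hb : Submodule.span S (Set.range fun i => mapForms (φ : MvPolynomial ι K →+* S) (b i)) =
      chartSpan S w β) :
    aeval (pairCoord α β) f = 0 := by
  obtain ⟨n, F, hF⟩ := exists_clear_denominators v w f
  -- The product vanishes at every `y`: trivially where `g` or the determinant does, by `h`
  -- elsewhere. As `K` is infinite it is the zero polynomial. Cancelling `g` before applying `φ`
  -- matters, since `φ g` may be zero; the determinant becomes a unit afterwards.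
  have h1 : g * (frameDet v w a b *
      aeval (fun o : Option Coord => o.elim (frameDet v w a b) (frameNum v w a b)) F) = 0 := by
    apply MvPolynomial.funext
    intro y
    rw [map_zero, ← coe_aeval_eq_eval, RingHom.coe_coe, map_mul, map_mul, aeval_frame_map,
      ← frameDet_map]
    by_cases hgy : aeval y g = 0
    · rw [hgy, zero_mul]
    by_cases hd : frameDet v w
        (fun i => mapForms ((aeval y : MvPolynomial ι K →ₐ[K] K) : MvPolynomial ι K →+* K) (a i))
        (fun i => mapForms ((aeval y : MvPolynomial ι K →ₐ[K] K) : MvPolynomial ι K →+* K) (b i))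
          = 0
    · rw [hd, zero_mul, mul_zero]
    obtain ⟨x, hxa, hxb⟩ := exists_chart_of_frameDet_ne_zero v w hd
    rw [hF K _ _ _ _ hxa hxb, pairCoord_self, h y hgy x hxa hxb, mul_zero, mul_zero, mul_zero]
  have h2 := (mul_eq_zero.1 h1).resolve_left hg
  have h3 := congrArg φ h2
  rw [map_mul, aeval_frame_map, ← frameDet_map, hF S _ _ _ _ ha hb, map_zero] at h3
  have hu := isUnit_frameDet v w ha hb
  exact ((hu.pow n).mul_right_eq_zero).1 ((hu.mul_right_eq_zero).1 h3)

/-! ## The closure in a chart -/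

theorem chart₂_eq_iff {v v' : Basis2 K} {w w' : Basis3 K} {x x' : Coord → K} :
    chart₂ v w x = chart₂ v' w' x' ↔
      (chartSpan K v (fun i j => x (Sum.inl (i, j))) =
        chartSpan K v' (fun i j => x' (Sum.inl (i, j)))) ∧
      (chartSpan K w (fun i j => x (Sum.inr (i, j))) =
        chartSpan K w' (fun i j => x' (Sum.inr (i, j)))) := by
  rw [chart₂, chart₂, Prod.mk.injEq]
  exact and_congr Subtype.ext_iff Subtype.ext_iff

/-- In a second chart, the coordinates of the first are fractions with denominator `frameDet`.
Clearing denominators gives a polynomial equation, and the extra factor `frameDet` admits the points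
outside the first chart, where the condition is vacuous. -/
theorem isZariskiClosed_of_poly (f : MvPolynomial Coord K) :
    IsZariskiClosed {p : Gr K 2 2 × Gr K 3 8 | ∀ x, chart₂ v w x = p → aeval x f = 0} := by
  intro v' w'
  obtain ⟨n, F, hF⟩ := exists_clear_denominators v w f
  set a : Fin 2 → Forms (MvPolynomial Coord K) 2 :=
    chartRow (MvPolynomial Coord K) v' fun i j => X (Sum.inl (i, j)) with ha
  set b : Fin 8 → Forms (MvPolynomial Coord K) 3 :=
    chartRow (MvPolynomial Coord K) w' fun i j => X (Sum.inr (i, j)) with hb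
  refine ⟨Ideal.span {frameDet v w a b *
    aeval (fun o : Option Coord => o.elim (frameDet v w a b) (frameNum v w a b)) F}, ?_⟩
  have hsa : ∀ x' : Coord → K, Submodule.span K (Set.range fun i =>
      mapForms ((aeval x' : MvPolynomial Coord K →ₐ[K] K) : MvPolynomial Coord K →+* K) (a i)) =
      chartSpan K v' (fun i j => x' (Sum.inl (i, j))) := fun x' => by
    simp only [ha, mapForms_chartRow, aeval_X, chartSpan_eq]
  have hsb : ∀ x' : Coord → K, Submodule.span K (Set.range fun i =>
      mapForms ((aeval x' : MvPolynomial Coord K →ₐ[K] K) : MvPolynomial Coord K →+* K) (b i)) =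
      chartSpan K w' (fun i j => x' (Sum.inr (i, j))) := fun x' => by
    simp only [hb, mapForms_chartRow, aeval_X, chartSpan_eq]
  ext x'
  rw [zeroLocus_span]
  simp only [inChart, Set.mem_ofPred_eq, Set.mem_singleton_iff, forall_eq, map_mul]
  rw [aeval_frame_map, ← frameDet_map]
  constructor
  · intro h
    by_cases hd : frameDet v w
        (fun i => mapForms ((aeval x' : MvPolynomial Coord K →ₐ[K] K) :
          MvPolynomial Coord K →+* K) (a i))
        (fun i => mapForms ((aeval x' : MvPolynomial Coord K →ₐ[K] K) :
          MvPolynomial Coord K →+* K) (b i)) = 0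
    · rw [hd, zero_mul]
    obtain ⟨x, hxa, hxb⟩ := exists_chart_of_frameDet_ne_zero v w hd
    rw [hF K _ _ _ _ hxa hxb, pairCoord_self, h x, mul_zero, mul_zero]
    rw [chart₂_eq_iff, ← hxa, ← hxb, hsa, hsb]
    exact ⟨rfl, rfl⟩
  · intro h x hx
    rw [chart₂_eq_iff, ← hsa, ← hsb] at hx
    have hu := isUnit_frameDet v w hx.1.symm hx.2.symm
    rw [hF K _ _ _ _ hx.1.symm hx.2.symm, pairCoord_self] at h
    exact ((hu.pow n).mul_right_eq_zero).1 ((hu.mul_right_eq_zero).1 h)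

theorem graphKappa_subset_Xtilde : graphKappa K ⊆ Xtilde K :=
  Set.subset_sInter fun _ hT => hT.2

/-- The part of the graph of `κ` in a chart is dense in the part of its closure in this chart. -/
theorem aeval_eq_zero_of_graph {f : MvPolynomial Coord K}
    (hf : ∀ x ∈ inChart (graphKappa K) v w, aeval x f = 0) {x : Coord → K}
    (hx : x ∈ inChart (Xtilde K) v w) : aeval x f = 0 := by
  refine hx {p | ∀ x, chart₂ v w x = p → aeval x f = 0} ⟨isZariskiClosed_of_poly v w f, ?_⟩ x rfl
  rintro p hp x rfl
  exact hf x hp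

/-- Each closed set containing the graph is the zero locus in the chart of an ideal, all of whose
elements vanish on `X̃`. -/
theorem zeroLocus_vanishingIdeal_Xtilde {x : Coord → K}
    (hx : x ∈ zeroLocus K (vanishingIdeal K (inChart (Xtilde K) v w))) :
    x ∈ inChart (Xtilde K) v w := by
  intro T hT
  obtain ⟨I, hI⟩ := hT.1 v w
  have h1 : inChart (Xtilde K) v w ⊆ zeroLocus K I := by
    rw [← hI]
    exact fun y hy => hy T hT
  have h2 : x ∈ inChart T v w := by
    rw [hI]
    intro p hp
    exact hx p fun y hy => h1 hy p hp
  exact h2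

/-! ## Charts at a point -/

/-- A basis adapted to `W` and a complement makes `W` the origin of its chart. -/
theorem exists_chartSpan_eq {d r m : ℕ} (hd : finrank K (Forms K d) = r + m)
    (W : Submodule K (Forms K d)) (hW : finrank K W = r) :
    ∃ (v : Basis (Fin r ⊕ Fin m) K (Forms K d)) (a : Fin r → Fin m → K), chartSpan K v a = W := by
  obtain ⟨U, hU⟩ := Submodule.exists_isCompl W
  have hfU : finrank K U = m := by
    have := Submodule.finrank_add_eq_of_isCompl hU
    omega
  refine ⟨((finBasisOfFinrankEq K W hW).prod (finBasisOfFinrankEq K U hfU)).map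
    (Submodule.prodEquivOfIsCompl W U hU), 0, ?_⟩
  have : ∀ i, chartRow K (((finBasisOfFinrankEq K W hW).prod (finBasisOfFinrankEq K U hfU)).map
      (Submodule.prodEquivOfIsCompl W U hU)) (0 : Fin r → Fin m → K) i =
      W.subtype (finBasisOfFinrankEq K W hW i) := by
    intro i
    simp [chartRow, extend_self]
  rw [chartSpan_eq, funext this, Set.range_comp', ← Submodule.map_span, Basis.span_eq,
    Submodule.map_top, Submodule.range_subtype]

theorem exists_chart₂_eq (p : Gr K 2 2 × Gr K 3 8) :
    ∃ (v : Basis2 K) (w : Basis3 K) (x : Coord → K), chart₂ v w x = p := by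
  obtain ⟨v, α, hα⟩ := exists_chartSpan_eq (r := 2) (m := 8) (by rw [finrank_forms]; rfl)
    p.1.1 p.1.2
  obtain ⟨w, β, hβ⟩ := exists_chartSpan_eq (r := 8) (m := 12) (by rw [finrank_forms]; rfl)
    p.2.1 p.2.2
  exact ⟨v, w, pairCoord α β, Prod.ext (Subtype.ext hα) (Subtype.ext hβ)⟩

end Closure

/-! ## Divisibility of forms over a field -/

section Divisibility

variable {K : Type*} [Field K]

theorem homogeneousComponent_mul_form {n d : ℕ} (h : MvPolynomial (Fin 4) K) (q : Forms K d) :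
    homogeneousComponent (n + d) (h * q.1) = homogeneousComponent n h * q.1 := by
  conv_lhs => rw [← sum_homogeneousComponent h, Finset.sum_mul, map_sum]
  have hi : ∀ i, homogeneousComponent (n + d) (homogeneousComponent i h * q.1) =
      if n = i then homogeneousComponent i h * q.1 else 0 := by
    intro i
    rw [homogeneousComponent_of_mem ((homogeneousComponent_isHomogeneous i h).mul q.2)]
    simp
  simp only [hi]
  rw [Finset.sum_ite_eq]
  split_ifs with hn
  · rfl
  · rw [Finset.mem_range, not_lt] at hn
    rw [homogeneousComponent_eq_zero _ _ (by omega), zero_mul]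

/-- Only the component of degree `n` of a cofactor contributes in degree `n + d`. -/
theorem exists_form_of_dvd {n d : ℕ} {f : Forms K d} {q : Forms K (n + d)} (h : f.1 ∣ q.1) :
    ∃ g : Forms K n, q.1 = g.1 * f.1 := by
  obtain ⟨p, hp⟩ := h
  refine ⟨mkForm _ (homogeneousComponent_isHomogeneous n p), ?_⟩
  have h1 := homogeneousComponent_mul_form (n := n) p f
  rw [mul_comm p, ← hp, homogeneousComponent_eq_self q.2] at h1
  exact h1

theorem Forms.coe_ne_zero {d : ℕ} {f : Forms K d} (hf : f ≠ 0) : f.1 ≠ 0 := fun h =>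
  hf (Forms.ext h)

theorem prime_of_linear {f : Forms K 1} (hf : f ≠ 0) : Prime f.1 := by
  rw [← irreducible_iff_prime]
  refine irreducible_of_totalDegree_eq_one (f.isHomogeneous.totalDegree (Forms.coe_ne_zero hf))
    fun x hx => ?_
  rw [isUnit_iff_ne_zero]
  rintro rfl
  apply hf
  apply Forms.ext
  ext m
  exact zero_dvd_iff.1 (hx m)

theorem exists_smul_of_dvd {d : ℕ} {f g : Forms K d} (h : f.1 ∣ g.1) : ∃ c : K, g = c • f := by
  obtain ⟨p, hp⟩ := exists_form_of_dvd (n := 0) (f := f) (q := mkForm g.1 (by simpa using g.2)) h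
  obtain ⟨c, hc⟩ : ∃ c, p.1 = C c :=
    ⟨_, totalDegree_eq_zero_iff_eq_C.1 (Nat.le_zero.1 p.isHomogeneous.totalDegree_le)⟩
  refine ⟨c, Forms.ext ?_⟩
  rw [Forms.coe_smul, ← hc]
  exact hp

theorem mem_span_singleton_of_dvd {d : ℕ} {f g : Forms K d} (h : f.1 ∣ g.1) :
    g ∈ Submodule.span K {f} := by
  obtain ⟨c, hc⟩ := exists_smul_of_dvd h
  exact Submodule.mem_span_singleton.2 ⟨c, hc.symm⟩

end Divisibility

/-! ## Products of spans of forms -/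

section Spans

variable {R : Type*} [CommRing R]

theorem mem_mulSpan_span_singleton {d e : ℕ} {h : Forms R d} {W : Submodule R (Forms R e)}
    {f : Forms R (d + e)} :
    f ∈ mulSpan (Submodule.span R {h}) W ↔ ∃ g ∈ W, f.1 = h.1 * g.1 := by
  constructor
  · intro hf
    refine (mulSpan_le (V := W.map (mulForms R d e h))).2 ?_ hf |>.imp ?_
    · intro p hp q hq
      obtain ⟨c, rfl⟩ := Submodule.mem_span_singleton.1 hp
      exact ⟨c • q, W.smul_mem c hq, by simp⟩
    · rintro g ⟨hg, rfl⟩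
      exact ⟨hg, rfl⟩
  · rintro ⟨g, hg, hf⟩
    rw [Forms.ext (g := mulForms R d e h g) hf]
    exact mul_mem_mulSpan (Submodule.mem_span_singleton_self h) hg

theorem mem_mulSpan_span_pair {d e : ℕ} {a b : Forms R d} {W : Submodule R (Forms R e)}
    {f : Forms R (d + e)} :
    f ∈ mulSpan (Submodule.span R {a, b}) W ↔ ∃ x ∈ W, ∃ y ∈ W, f.1 = a.1 * x.1 + b.1 * y.1 := by
  constructor
  · intro hf
    have : mulSpan (Submodule.span R {a, b}) W ≤
        W.map (mulForms R d e a) ⊔ W.map (mulForms R d e b) := by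
      rw [mulSpan_le]
      intro p hp q hq
      obtain ⟨c, c', rfl⟩ := Submodule.mem_span_pair.1 hp
      rw [map_add, map_smul, map_smul, LinearMap.add_apply, LinearMap.smul_apply,
        LinearMap.smul_apply]
      exact Submodule.add_mem_sup (Submodule.smul_mem _ _ ⟨q, hq, rfl⟩)
        (Submodule.smul_mem _ _ ⟨q, hq, rfl⟩)
    obtain ⟨_, ⟨x, hx, rfl⟩, _, ⟨y, hy, rfl⟩, rfl⟩ := Submodule.mem_sup.1 (this hf)
    exact ⟨x, hx, y, hy, rfl⟩
  · rintro ⟨x, hx, y, hy, hf⟩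
    rw [Forms.ext (g := mulForms R d e a x + mulForms R d e b y) hf]
    exact add_mem (mul_mem_mulSpan (Submodule.subset_span (by simp)) hx)
      (mul_mem_mulSpan (Submodule.subset_span (by simp)) hy)

theorem mulSpan_singleton_pair {d e : ℕ} (h : Forms R d) (a b : Forms R e) :
    mulSpan (Submodule.span R {h}) (Submodule.span R {a, b}) =
      Submodule.span R {mulForms R d e h a, mulForms R d e h b} := by
  rw [mulSpan_span, Set.image2_singleton_left, Set.image_pair]

end Spans

/-! ## Pencils without a fixed plane -/

section Pencils

variable {K : Type*} [Field K]

theorem exists_span_pair {M : Type*} [AddCommGroup M] [Module K M]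
    {W : Submodule K M} (hW : finrank K W = 2) :
    ∃ a b : M, W = Submodule.span K {a, b} ∧ LinearIndependent K ![a, b] := by
  have : Module.Finite K W := Module.finite_of_finrank_pos (by omega)
  obtain ⟨B⟩ : Nonempty (Basis (Fin 2) K W) := ⟨finBasisOfFinrankEq K W hW⟩
  refine ⟨(B 0 : M), (B 1 : M), ?_, ?_⟩
  · have h1 : Submodule.map W.subtype (Submodule.span K (Set.range B)) = W := by
      rw [B.span_eq, Submodule.map_top, Submodule.range_subtype]
    conv_lhs => rw [← h1]
    rw [Submodule.map_span, ← Set.range_comp]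
    congr 1
    ext z
    simp [Set.mem_range, Fin.exists_fin_two, eq_comm]
  · have h1 := B.linearIndependent.map' W.subtype W.ker_subtype
    convert! h1 using 1
    ext i
    fin_cases i <;> rfl

theorem finrank_span_pair_eq {M : Type*} [AddCommGroup M] [Module K M] {a b : M}
    (h : LinearIndependent K ![a, b]) : finrank K (Submodule.span K {a, b}) = 2 := by
  have := finrank_span_eq_card h
  rwa [Matrix.range_cons, Matrix.range_cons, Matrix.range_empty, Set.union_empty,
    Set.singleton_union, Fintype.card_fin] at this

theorem mem_Z_of_span {p : Gr K 2 2} {h a b : Forms K 1}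
    (hp : p.1 = Submodule.span K {mul11 h a, mul11 h b}) : p ∈ Z K := by
  have hfin := p.2
  have hpair : ∀ s t : K, s • mul11 h a + t • mul11 h b = 0 → s = 0 ∧ t = 0 := by
    apply LinearIndependent.pair_iff.1
    rw [linearIndependent_iff_card_eq_finrank_span]
    rw [hp] at hfin
    rw [Set.finrank, Matrix.range_cons, Matrix.range_cons, Matrix.range_empty, Set.union_empty,
      Set.singleton_union, Fintype.card_fin]
    exact hfin.symm
  have hh : h ≠ 0 := by
    rintro rfl
    exact one_ne_zero (hpair 1 0 (Forms.ext (by simp))).1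
  have hab : LinearIndependent K ![a, b] := by
    rw [LinearIndependent.pair_iff]
    intro s t hst
    apply hpair
    apply Forms.ext
    have := congrArg Subtype.val hst
    simp only [Forms.coe_add, Forms.coe_smul, coe_mul11, Forms.coe_zero] at this ⊢
    linear_combination h.1 * this
  exact ⟨⟨Submodule.span K {h}, finrank_span_singleton hh⟩,
    ⟨Submodule.span K {a, b}, finrank_span_pair_eq hab⟩,
    hp.trans (mulSpan_singleton_pair h a b).symm⟩

/-- A nonzero `α` is prime and divides `β q₂`. If it divides `β`, the quadrics are dependent. If `q₂
= g α`, then `q₁ = -β g`, and `g` is a fixed plane. -/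
theorem no_linear_syzygy {p : Gr K 2 2} (hp : p ∉ Z K) {q₁ q₂ : Forms K 2}
    (hspan : p.1 = Submodule.span K {q₁, q₂}) (hind : LinearIndependent K ![q₁, q₂])
    {α β : Forms K 1} (h : α.1 * q₁.1 + β.1 * q₂.1 = 0) : α = 0 ∧ β = 0 := by
  rw [LinearIndependent.pair_iff] at hind
  have hq₂ : q₂ ≠ 0 := by
    rintro rfl
    exact one_ne_zero (hind 0 1 (by simp)).2
  by_cases hα : α = 0
  · refine ⟨hα, Forms.ext ?_⟩
    rw [hα, Forms.coe_zero, zero_mul, zero_add] at h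
    exact (mul_eq_zero.1 h).resolve_right (Forms.coe_ne_zero hq₂)
  exfalso
  have hpr := prime_of_linear hα
  have hα' := Forms.coe_ne_zero hα
  have hdvd : α.1 ∣ β.1 * q₂.1 := ⟨-q₁.1, by linear_combination h⟩
  rcases hpr.dvd_or_dvd hdvd with h1 | h1
  · obtain ⟨c, rfl⟩ := exists_smul_of_dvd h1
    rw [Forms.coe_smul] at h
    have h2 : α.1 * (q₁.1 + C c * q₂.1) = 0 := by linear_combination h
    have h3 := (mul_eq_zero.1 h2).resolve_left hα'
    exact one_ne_zero (hind 1 c (Forms.ext (by simpa using h3))).1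
  · obtain ⟨g, hg⟩ := exists_form_of_dvd (n := 1) (d := 1) (f := α) (q := q₂) h1
    have h2 : α.1 * (q₁.1 + β.1 * g.1) = 0 := by rw [hg] at h; linear_combination h
    have h3 := (mul_eq_zero.1 h2).resolve_left hα'
    apply hp
    apply mem_Z_of_span (h := g) (a := -β) (b := α)
    rw [hspan]
    congr 2
    · apply Forms.ext
      simp only [coe_mul11, Forms.coe_neg]
      linear_combination h3
    · rw [Forms.ext (f := q₂) (g := mul11 g α) hg]

/-- A common factor of positive degree leaves cofactors `u, w` of degree at most one with `w q₁ = u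
q₂`. Their components of degree one and zero vanish by the absence of linear syzygies and by
independence. -/
theorem isRelPrime_of_not_mem_Z {p : Gr K 2 2} (hp : p ∉ Z K) {q₁ q₂ : Forms K 2}
    (hspan : p.1 = Submodule.span K {q₁, q₂}) (hind : LinearIndependent K ![q₁, q₂]) :
    IsRelPrime q₁.1 q₂.1 := by
  have hind' := LinearIndependent.pair_iff.1 hind
  have hq₁ : q₁.1 ≠ 0 := by
    intro h
    exact one_ne_zero (hind' 1 0 (Forms.ext (by simp [h]))).1
  have hq₂ : q₂.1 ≠ 0 := by
    intro h
    exact one_ne_zero (hind' 0 1 (Forms.ext (by simp [h]))).2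
  rintro d ⟨u, hu⟩ ⟨w, hw⟩
  have hd : d ≠ 0 := by rintro rfl; exact hq₁ (by rw [hu, zero_mul])
  have hu0 : u ≠ 0 := by rintro rfl; exact hq₁ (by rw [hu, mul_zero])
  have hw0 : w ≠ 0 := by rintro rfl; exact hq₂ (by rw [hw, mul_zero])
  by_cases hdeg : d.totalDegree = 0
  · rw [totalDegree_eq_zero_iff_eq_C] at hdeg
    rw [hdeg]
    refine IsUnit.map C (isUnit_iff_ne_zero.2 fun h => hd ?_)
    rw [hdeg, h, C_0]
  exfalso
  have hdu := q₁.isHomogeneous.totalDegree hq₁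
  rw [hu, totalDegree_mul_of_isDomain hd hu0] at hdu
  have hdw := q₂.isHomogeneous.totalDegree hq₂
  rw [hw, totalDegree_mul_of_isDomain hd hw0] at hdw
  have hrel : w * q₁.1 = u * q₂.1 := by rw [hu, hw]; ring
  have hrel1 := congrArg (homogeneousComponent (1 + 2)) hrel
  rw [homogeneousComponent_mul_form, homogeneousComponent_mul_form] at hrel1
  have hrel0 := congrArg (homogeneousComponent (0 + 2)) hrel
  rw [homogeneousComponent_mul_form, homogeneousComponent_mul_form, homogeneousComponent_zero,
    homogeneousComponent_zero] at hrel0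
  have h1 := no_linear_syzygy hp hspan hind
    (α := mkForm _ (homogeneousComponent_isHomogeneous 1 w))
    (β := -mkForm _ (homogeneousComponent_isHomogeneous 1 u)) (by
      simp only [Forms.coe_neg, coe_mkForm]
      linear_combination hrel1)
  have h0 := hind' (coeff 0 w) (-coeff 0 u) (Forms.ext (by
    simp only [Forms.coe_add, Forms.coe_smul, Forms.coe_zero, map_neg]
    linear_combination hrel0))
  apply hw0
  have hw1 : homogeneousComponent 1 w = 0 := congrArg Subtype.val h1.1
  rw [← sum_homogeneousComponent w]
  refine Finset.sum_eq_zero fun i hi => ?_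
  rw [Finset.mem_range] at hi
  have : i = 0 ∨ i = 1 := by omega
  rcases this with rfl | rfl
  · rw [homogeneousComponent_zero, h0.1, C_0]
  · exact hw1

/-- By coprimality `q₁` divides `z`, so `z = 0` for reasons of degree. Dividing by `q₁` leaves a
linear syzygy. -/
theorem no_quadratic_syzygy {p : Gr K 2 2} (hp : p ∉ Z K) {q₁ q₂ : Forms K 2}
    (hspan : p.1 = Submodule.span K {q₁, q₂}) (hind : LinearIndependent K ![q₁, q₂])
    {x y z : Forms K 1} (h : q₁.1 ^ 2 * x.1 + q₁.1 * q₂.1 * y.1 + q₂.1 ^ 2 * z.1 = 0) :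
    x = 0 ∧ y = 0 ∧ z = 0 := by
  have hrp := isRelPrime_of_not_mem_Z hp hspan hind
  have hind' := LinearIndependent.pair_iff.1 hind
  have hq₁ : q₁.1 ≠ 0 := by
    intro h
    exact one_ne_zero (hind' 1 0 (Forms.ext (by simp [h]))).1
  have hz : z = 0 := by
    by_contra hz
    have hdvd : q₁.1 ∣ q₂.1 * (q₂.1 * z.1) :=
      ⟨-(q₁.1 * x.1 + q₂.1 * y.1), by linear_combination h⟩
    obtain ⟨w, hw⟩ := hrp.dvd_of_dvd_mul_left (hrp.dvd_of_dvd_mul_left hdvd)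
    have hz' := Forms.coe_ne_zero hz
    have hw0 : w ≠ 0 := by rintro rfl; exact hz' (by rw [hw, mul_zero])
    have hdeg := z.isHomogeneous.totalDegree hz'
    rw [hw, totalDegree_mul_of_isDomain hq₁ hw0, q₁.isHomogeneous.totalDegree hq₁] at hdeg
    omega
  subst hz
  rw [Forms.coe_zero, mul_zero, add_zero] at h
  have h1 : q₁.1 * (x.1 * q₁.1 + y.1 * q₂.1) = 0 := by linear_combination h
  obtain ⟨hx, hy⟩ := no_linear_syzygy hp hspan hind ((mul_eq_zero.1 h1).resolve_left hq₁)
  exact ⟨hx, hy, rfl⟩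

end Pencils

/-! ## The rank of `ν` at a point -/

section Rank

variable {K : Type*} [Field K]

theorem finrank_linear : finrank K (Forms K 1) = 4 := finrank_forms

/-- The map `(x, y) ↦ q₁ x + q₂ y`. -/
def pairMap (q₁ q₂ : Forms K 2) : (Forms K 1 × Forms K 1) →ₗ[K] Forms K 3 :=
  (mulForms K 2 1 q₁).coprod (mulForms K 2 1 q₂)

theorem coe_pairMap (q₁ q₂ : Forms K 2) (x : Forms K 1 × Forms K 1) :
    (pairMap q₁ q₂ x).1 = q₁.1 * x.1.1 + q₂.1 * x.2.1 := rfl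

theorem range_pairMap (q₁ q₂ : Forms K 2) : LinearMap.range (pairMap q₁ q₂) =
    mulSpan (Submodule.span K {q₁, q₂}) (⊤ : Submodule K (Forms K 1)) := by
  ext f
  rw [mem_mulSpan_span_pair]
  constructor
  · rintro ⟨x, rfl⟩
    exact ⟨x.1, trivial, x.2, trivial, rfl⟩
  · rintro ⟨x, -, y, -, h⟩
    exact ⟨(x, y), (Forms.ext h).symm⟩

theorem finrank_mulSpan_top {p : Gr K 2 2} (hp : p ∉ Z K) :
    finrank K (mulSpan p.1 (⊤ : Submodule K (Forms K 1))) = 8 := by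
  obtain ⟨q₁, q₂, hspan, hind⟩ := exists_span_pair p.2
  rw [hspan, ← range_pairMap, LinearMap.finrank_range_of_inj, finrank_prod, finrank_linear]
  rw [injective_iff_map_eq_zero]
  rintro ⟨x, y⟩ h
  obtain ⟨rfl, rfl⟩ := no_linear_syzygy hp hspan hind (α := x) (β := y) (by
    have := congrArg Subtype.val h
    rw [coe_pairMap, Forms.coe_zero] at this
    linear_combination this)
  rfl

/-- The map `(x, y, z) ↦ q₁² x + q₁ q₂ y + q₂² z`. -/
def tripleMap (q₁ q₂ : Forms K 2) : (Forms K 1 × Forms K 1 × Forms K 1) →ₗ[K] Forms K 5 :=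
  (mulForms K 4 1 (mulForms K 2 2 q₁ q₁)).coprod
    ((mulForms K 4 1 (mulForms K 2 2 q₁ q₂)).coprod (mulForms K 4 1 (mulForms K 2 2 q₂ q₂)))

theorem coe_tripleMap (q₁ q₂ : Forms K 2) (x : Forms K 1 × Forms K 1 × Forms K 1) :
    (tripleMap q₁ q₂ x).1 =
      q₁.1 * q₁.1 * x.1.1 + (q₁.1 * q₂.1 * x.2.1.1 + q₂.1 * q₂.1 * x.2.2.1) := rfl

/-- Here `A · 𝓕₁` already has dimension 8, so it is `B`. The image of `ν` is then the injective
image of three copies of `𝓕₁`. -/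
theorem finrank_range_nu_of_not_mem_Z {p : Gr K 2 2 × Gr K 3 8} (hp : p.1 ∉ Z K)
    (hle : mulSpan p.1.1 (⊤ : Submodule K (Forms K 1)) ≤ p.2.1) :
    finrank K (LinearMap.range (nu p.1.1 p.2.1)) = 12 := by
  have hfin : Module.Finite K p.2.1 := Module.finite_of_finrank_pos (by rw [p.2.2]; omega)
  have hB : mulSpan p.1.1 (⊤ : Submodule K (Forms K 1)) = p.2.1 :=
    Submodule.eq_of_le_of_finrank_eq hle ((finrank_mulSpan_top hp).trans p.2.2.symm)
  obtain ⟨q₁, q₂, hspan, hind⟩ := exists_span_pair p.1.2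
  have hrange : LinearMap.range (nu p.1.1 p.2.1) = LinearMap.range (tripleMap q₁ q₂) := by
    rw [range_nu, ← hB, hspan]
    apply le_antisymm
    · rw [mulSpan_le]
      intro f hf g hg
      obtain ⟨s, t, rfl⟩ := Submodule.mem_span_pair.1 hf
      obtain ⟨x, -, y, -, hxy⟩ := mem_mulSpan_span_pair.1 hg
      refine ⟨(s • x, s • y + t • x, t • y), Forms.ext ?_⟩
      rw [coe_tripleMap, coe_mulForms, hxy]
      simp only [Forms.coe_add, Forms.coe_smul]
      ring
    · rintro _ ⟨⟨x, y, z⟩, rfl⟩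
      have h1 : ∀ f : Forms K 1, ∀ q ∈ Submodule.span K {q₁, q₂}, ∀ q' ∈ Submodule.span K {q₁, q₂},
          mul23 q (mul21 q' f) ∈ mulSpan (Submodule.span K {q₁, q₂})
            (mulSpan (Submodule.span K {q₁, q₂}) (⊤ : Submodule K (Forms K 1))) :=
        fun f q hq q' hq' => mul_mem_mulSpan hq (mul_mem_mulSpan hq' trivial)
      have hm₁ : q₁ ∈ Submodule.span K {q₁, q₂} := Submodule.subset_span (by simp)
      have hm₂ : q₂ ∈ Submodule.span K {q₁, q₂} := Submodule.subset_span (by simp)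
      rw [Forms.ext (f := tripleMap q₁ q₂ (x, y, z)) (g := mul23 q₁ (mul21 q₁ x) +
        mul23 q₁ (mul21 q₂ y) + mul23 q₂ (mul21 q₂ z))
        (by simp only [coe_tripleMap, Forms.coe_add, coe_mul21, coe_mul23]; ring)]
      exact add_mem (add_mem (h1 _ _ hm₁ _ hm₁) (h1 _ _ hm₁ _ hm₂)) (h1 _ _ hm₂ _ hm₂)
  rw [hrange, LinearMap.finrank_range_of_inj, finrank_prod, finrank_prod, finrank_linear]
  rw [injective_iff_map_eq_zero]
  rintro ⟨x, y, z⟩ h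
  obtain ⟨rfl, rfl, rfl⟩ := no_quadratic_syzygy hp hspan hind (x := x) (y := y) (z := z) (by
    have := congrArg Subtype.val h
    rw [coe_tripleMap, Forms.coe_zero] at this
    linear_combination this)
  rfl

/-! ### Pencils with a fixed plane -/

/-- The map `(x, y, z, s₁, s₂) ↦ h (h (l₁² x + l₁ l₂ y + l₂² z) + (s₁ l₁ + s₂ l₂) c)`. -/
def degenerateMap (h l₁ l₂ : Forms K 1) (c : Forms K 3) :
    (Forms K 1 × Forms K 1 × Forms K 1 × K × K) →ₗ[K] Forms K 5 where
  toFun x := mul23 (mul11 h l₁) (mul21 (mul11 h l₁) x.1) +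
    mul23 (mul11 h l₁) (mul21 (mul11 h l₂) x.2.1) + mul23 (mul11 h l₂) (mul21 (mul11 h l₂) x.2.2.1) +
    x.2.2.2.1 • mul23 (mul11 h l₁) c + x.2.2.2.2 • mul23 (mul11 h l₂) c
  map_add' x y := Forms.ext (by
    simp only [Forms.coe_add, Forms.coe_smul, coe_mul11, coe_mul21, coe_mul23, Prod.fst_add,
      Prod.snd_add, map_add]
    ring)
  map_smul' r x := Forms.ext (by
    simp only [Forms.coe_add, Forms.coe_smul, coe_mul11, coe_mul21, coe_mul23, Prod.smul_fst,
      Prod.smul_snd, smul_eq_mul, map_mul, RingHom.id_apply]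
    ring)

theorem coe_degenerateMap (h l₁ l₂ : Forms K 1) (c : Forms K 3) (x y z : Forms K 1) (s₁ s₂ : K) :
    (degenerateMap h l₁ l₂ c (x, y, z, s₁, s₂)).1 =
      h.1 * (h.1 * (l₁.1 ^ 2 * x.1 + l₁.1 * l₂.1 * y.1 + l₂.1 ^ 2 * z.1) +
        (C s₁ * l₁.1 + C s₂ * l₂.1) * c.1) := by
  change (mul23 (mul11 h l₁) (mul21 (mul11 h l₁) x) + mul23 (mul11 h l₁) (mul21 (mul11 h l₂) y) +
    mul23 (mul11 h l₂) (mul21 (mul11 h l₂) z) + s₁ • mul23 (mul11 h l₁) c +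
    s₂ • mul23 (mul11 h l₂) c).1 = _
  simp only [Forms.coe_add, Forms.coe_smul, coe_mul11, coe_mul21, coe_mul23]
  ring

theorem finrank_degenerateMap_domain :
    finrank K (Forms K 1 × Forms K 1 × Forms K 1 × K × K) = 14 := by
  simp only [finrank_prod, finrank_linear, finrank_self]

theorem range_degenerateMap (h l₁ l₂ : Forms K 1) (c : Forms K 3) :
    LinearMap.range (degenerateMap h l₁ l₂ c) =
      mulSpan (Submodule.span K {mul11 h l₁, mul11 h l₂})
        (mulSpan (Submodule.span K {mul11 h l₁, mul11 h l₂}) (⊤ : Submodule K (Forms K 1)) ⊔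
          Submodule.span K {c}) := by
  have hm₁ : mul11 h l₁ ∈ Submodule.span K {mul11 h l₁, mul11 h l₂} :=
    Submodule.subset_span (by simp)
  have hm₂ : mul11 h l₂ ∈ Submodule.span K {mul11 h l₁, mul11 h l₂} :=
    Submodule.subset_span (by simp)
  apply le_antisymm
  · rintro _ ⟨⟨x, y, z, s₁, s₂⟩, rfl⟩
    have h1 : ∀ f : Forms K 1, ∀ q ∈ Submodule.span K {mul11 h l₁, mul11 h l₂},
        ∀ q' ∈ Submodule.span K {mul11 h l₁, mul11 h l₂},
        mul23 q (mul21 q' f) ∈ mulSpan (Submodule.span K {mul11 h l₁, mul11 h l₂})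
        (mulSpan (Submodule.span K {mul11 h l₁, mul11 h l₂}) (⊤ : Submodule K (Forms K 1)) ⊔
          Submodule.span K {c}) := fun f q hq q' hq' =>
      mul_mem_mulSpan hq (Submodule.mem_sup_left (mul_mem_mulSpan hq' trivial))
    have h2 : ∀ q ∈ Submodule.span K {mul11 h l₁, mul11 h l₂},
        mul23 q c ∈ mulSpan (Submodule.span K {mul11 h l₁, mul11 h l₂})
        (mulSpan (Submodule.span K {mul11 h l₁, mul11 h l₂}) (⊤ : Submodule K (Forms K 1)) ⊔
          Submodule.span K {c}) := fun q hq =>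
      mul_mem_mulSpan hq (Submodule.mem_sup_right (Submodule.mem_span_singleton_self c))
    exact add_mem (add_mem (add_mem (add_mem (h1 _ _ hm₁ _ hm₁) (h1 _ _ hm₁ _ hm₂))
      (h1 _ _ hm₂ _ hm₂)) (Submodule.smul_mem _ _ (h2 _ hm₁))) (Submodule.smul_mem _ _ (h2 _ hm₂))
  · rw [mulSpan_le]
    intro f hf g hg
    obtain ⟨s, t, rfl⟩ := Submodule.mem_span_pair.1 hf
    obtain ⟨g₁, hg₁, g₂, hg₂, rfl⟩ := Submodule.mem_sup.1 hg
    obtain ⟨x, -, y, -, hxy⟩ := mem_mulSpan_span_pair.1 hg₁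
    obtain ⟨r, rfl⟩ := Submodule.mem_span_singleton.1 hg₂
    refine ⟨(s • x, s • y + t • x, t • y, s * r, t * r), Forms.ext ?_⟩
    rw [coe_degenerateMap]
    simp only [Forms.coe_add, Forms.coe_smul, coe_mul11, coe_mulForms, hxy, map_mul]
    ring

/-- The syzygies of `l₁², l₁ l₂, l₂²`. -/
theorem square_syzygy {l₁ l₂ : Forms K 1} (hind : LinearIndependent K ![l₁, l₂])
    {x y z : Forms K 1} (h : l₁.1 ^ 2 * x.1 + l₁.1 * l₂.1 * y.1 + l₂.1 ^ 2 * z.1 = 0) :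
    ∃ μ κ : K, x = -(μ • l₂) ∧ y = μ • l₁ - κ • l₂ ∧ z = κ • l₁ := by
  have hind' := LinearIndependent.pair_iff.1 hind
  have hl₁ : l₁ ≠ 0 := by
    rintro rfl
    exact one_ne_zero (hind' 1 0 (by simp)).1
  have hl₁' := Forms.coe_ne_zero hl₁
  have hpr := prime_of_linear hl₁
  have hnd : ¬ l₁.1 ∣ l₂.1 := by
    intro hd
    obtain ⟨c, rfl⟩ := exists_smul_of_dvd hd
    exact one_ne_zero (neg_eq_zero.1 (hind' c (-1) (by simp)).2)
  -- Since the prime `l₁` does not divide `l₂`, it divides `z`. Dividing the relation by `l₁` allows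
  -- the same argument for `y`.
  have hz : l₁.1 ∣ l₂.1 ^ 2 * z.1 := ⟨-(l₁.1 * x.1 + l₂.1 * y.1), by linear_combination h⟩
  obtain ⟨κ, rfl⟩ := exists_smul_of_dvd
    ((hpr.dvd_or_dvd hz).resolve_left fun h' => hnd (hpr.dvd_of_dvd_pow h'))
  rw [Forms.coe_smul] at h
  have h1 : l₁.1 * x.1 + l₂.1 * (y + κ • l₂).1 = 0 := by
    have : l₁.1 * (l₁.1 * x.1 + l₂.1 * (y + κ • l₂).1) = 0 := by
      rw [Forms.coe_add, Forms.coe_smul]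
      linear_combination h
    exact (mul_eq_zero.1 this).resolve_left hl₁'
  have hy : l₁.1 ∣ l₂.1 * (y + κ • l₂).1 := ⟨-x.1, by linear_combination h1⟩
  obtain ⟨μ, hμ⟩ := exists_smul_of_dvd ((hpr.dvd_or_dvd hy).resolve_left hnd)
  refine ⟨μ, κ, Forms.ext ?_, by rw [← hμ]; abel, rfl⟩
  rw [hμ, Forms.coe_smul] at h1
  have : l₁.1 * (x.1 + C μ * l₂.1) = 0 := by linear_combination h1
  have := (mul_eq_zero.1 this).resolve_left hl₁'
  rw [Forms.coe_neg, Forms.coe_smul]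
  linear_combination this

/-- After division by `h`, the only relation up to scalars is the Koszul relation of `l₁, l₂`; hence
the dimension is `8 - 1`. -/
theorem finrank_mulSpan_top_of_plane {h l₁ l₂ : Forms K 1} (hh : h ≠ 0)
    (hind : LinearIndependent K ![l₁, l₂]) :
    finrank K (mulSpan (Submodule.span K {mul11 h l₁, mul11 h l₂})
      (⊤ : Submodule K (Forms K 1))) = 7 := by
  rw [← range_pairMap]
  have h1 : finrank K (LinearMap.range (pairMap (mul11 h l₁) (mul11 h l₂))) +
      finrank K (LinearMap.ker (pairMap (mul11 h l₁) (mul11 h l₂))) = 8 :=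
    (LinearMap.finrank_range_add_finrank_ker _).trans (by rw [finrank_prod, finrank_linear])
  have hl₁ : l₁ ≠ 0 := by
    rintro rfl
    exact one_ne_zero (LinearIndependent.pair_iff.1 hind 1 0 (by simp)).1
  have hker : LinearMap.ker (pairMap (mul11 h l₁) (mul11 h l₂)) ≤ Submodule.span K {(-l₂, l₁)} := by
    rintro ⟨x, y⟩ hxy
    have h0 : pairMap (mul11 h l₁) (mul11 h l₂) (x, y) = 0 := LinearMap.mem_ker.1 hxy
    have h2 := congrArg Subtype.val h0
    rw [coe_pairMap, coe_mul11, coe_mul11, Forms.coe_zero] at h2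
    have h3 : h.1 * (l₁.1 * x.1 + l₂.1 * y.1) = 0 := by linear_combination h2
    have h4 := (mul_eq_zero.1 h3).resolve_left (Forms.coe_ne_zero hh)
    obtain ⟨μ, κ, hx, hy, hz⟩ := square_syzygy hind (x := x) (y := y) (z := 0)
      (by rw [Forms.coe_zero]; linear_combination l₁.1 * h4)
    have hκ := (smul_eq_zero.1 hz.symm).resolve_right hl₁
    subst hκ
    refine Submodule.mem_span_singleton.2 ⟨μ, ?_⟩
    rw [hx, hy]
    simp
  have h2 := (Submodule.finrank_mono hker).trans (finrank_span_le_card _)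
  rw [Set.toFinset_singleton, Finset.card_singleton] at h2
  have h4 : 1 ≤ finrank K (LinearMap.ker (pairMap (mul11 h l₁) (mul11 h l₂))) := by
    rw [Submodule.one_le_finrank_iff]
    intro hbot
    have hm : ((-l₂, l₁) : Forms K 1 × Forms K 1) ∈
        LinearMap.ker (pairMap (mul11 h l₁) (mul11 h l₂)) := by
      refine LinearMap.mem_ker.2 (Forms.ext ?_)
      rw [coe_pairMap]
      simp only [coe_mul11, Forms.coe_neg, Forms.coe_zero]
      ring
    rw [hbot, Submodule.mem_bot, Prod.mk_eq_zero] at hm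
    exact hl₁ hm.2
  have h3 : finrank K (LinearMap.range (pairMap (mul11 h l₁) (mul11 h l₂))) = 7 := by omega
  exact h3

/-- The hypothesis excludes relations involving `c`, which leaves the syzygies of `l₁², l₁ l₂, l₂²`.
-/
theorem finrank_ker_le_two {h l₁ l₂ : Forms K 1} {c : Forms K 3} (hh : h ≠ 0)
    (hind : LinearIndependent K ![l₁, l₂])
    (hc : ∀ (x y z : Forms K 1) (s₁ s₂ : K),
      h.1 * (l₁.1 ^ 2 * x.1 + l₁.1 * l₂.1 * y.1 + l₂.1 ^ 2 * z.1) +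
        (C s₁ * l₁.1 + C s₂ * l₂.1) * c.1 = 0 → s₁ = 0 ∧ s₂ = 0) :
    finrank K (LinearMap.ker (degenerateMap h l₁ l₂ c)) ≤ 2 := by
  classical
  have hker : LinearMap.ker (degenerateMap h l₁ l₂ c) ≤
      Submodule.span K ({(-l₂, l₁, 0, 0, 0), (0, -l₂, l₁, 0, 0)} :
        Finset (Forms K 1 × Forms K 1 × Forms K 1 × K × K)) := by
    rintro ⟨x, y, z, s₁, s₂⟩ hx
    have h0 : degenerateMap h l₁ l₂ c (x, y, z, s₁, s₂) = 0 := LinearMap.mem_ker.1 hx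
    have h2 := congrArg Subtype.val h0
    rw [coe_degenerateMap, Forms.coe_zero] at h2
    have h3 := (mul_eq_zero.1 h2).resolve_left (Forms.coe_ne_zero hh)
    obtain ⟨rfl, rfl⟩ := hc _ _ _ _ _ h3
    simp only [C_0, zero_mul, add_zero] at h3
    obtain ⟨μ, κ, rfl, rfl, rfl⟩ := square_syzygy hind
      ((mul_eq_zero.1 h3).resolve_left (Forms.coe_ne_zero hh))
    rw [Finset.coe_insert, Finset.coe_singleton, Submodule.mem_span_pair]
    exact ⟨μ, κ, by simp [sub_eq_add_neg]⟩
  exact (Submodule.finrank_mono hker).trans ((finrank_span_finset_le_card _).trans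
    Finset.card_le_two)

theorem linearIndependent_syzygies {l₁ l₂ : Forms K 1} (hl₁ : l₁ ≠ 0) :
    LinearIndependent K ![((-l₂, l₁, 0, 0, 0) : Forms K 1 × Forms K 1 × Forms K 1 × K × K),
      (0, -l₂, l₁, 0, 0)] := by
  rw [LinearIndependent.pair_iff]
  intro s t hst
  simp only [Prod.smul_mk, Prod.mk_add_mk, smul_zero, add_zero, zero_add, Prod.mk_eq_zero] at hst
  have ht := (smul_eq_zero.1 hst.2.2.1).resolve_right hl₁
  have h1 := hst.2.1
  rw [ht, zero_smul, add_zero] at h1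
  exact ⟨(smul_eq_zero.1 h1).resolve_right hl₁, ht⟩

theorem finrank_range_degenerateMap {h l₁ l₂ : Forms K 1} {c : Forms K 3} (hh : h ≠ 0)
    (hind : LinearIndependent K ![l₁, l₂])
    (hc : ∀ (x y z : Forms K 1) (s₁ s₂ : K),
      h.1 * (l₁.1 ^ 2 * x.1 + l₁.1 * l₂.1 * y.1 + l₂.1 ^ 2 * z.1) +
        (C s₁ * l₁.1 + C s₂ * l₂.1) * c.1 = 0 → s₁ = 0 ∧ s₂ = 0) :
    finrank K (LinearMap.range (degenerateMap h l₁ l₂ c)) = 12 := by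
  have h1 := LinearMap.finrank_range_add_finrank_ker (degenerateMap h l₁ l₂ c)
  rw [finrank_degenerateMap_domain] at h1
  have h2 := finrank_ker_le_two hh hind hc
  have hl₁ : l₁ ≠ 0 := by
    rintro rfl
    exact one_ne_zero (LinearIndependent.pair_iff.1 hind 1 0 (by simp)).1
  have h3 : 2 ≤ finrank K (LinearMap.ker (degenerateMap h l₁ l₂ c)) := by
    rw [← finrank_span_pair_eq (linearIndependent_syzygies (l₂ := l₂) hl₁)]
    apply Submodule.finrank_mono
    rw [Submodule.span_le]
    rintro _ (rfl | rfl)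
    · refine LinearMap.mem_ker.2 (Forms.ext ?_)
      rw [coe_degenerateMap]
      simp only [Forms.coe_neg, Forms.coe_zero, C_0]
      ring
    · refine LinearMap.mem_ker.2 (Forms.ext ?_)
      rw [coe_degenerateMap]
      simp only [Forms.coe_neg, Forms.coe_zero, C_0]
      ring
  omega

theorem exists_eq_span_singleton (H : Gr K 1 1) :
    ∃ h : Forms K 1, h ≠ 0 ∧ H.1 = Submodule.span K {h} := by
  obtain ⟨v, hv0, hv⟩ := finrank_eq_one_iff'.1 H.2
  refine ⟨v, fun h0 => hv0 (Subtype.ext h0), le_antisymm (fun w hw => ?_) ?_⟩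
  · obtain ⟨c, hc⟩ := hv ⟨w, hw⟩
    exact Submodule.mem_span_singleton.2 ⟨c, congrArg Subtype.val hc⟩
  · exact (Submodule.span_singleton_le_iff_mem _ _).2 v.2

theorem linearIndependent_pair_of_not_mem {h l : Forms K 1} (hh : h ≠ 0)
    (hl : l ∉ Submodule.span K {h}) : LinearIndependent K ![h, l] := by
  rw [LinearIndependent.pair_iff' hh]
  intro c hc
  exact hl (Submodule.mem_span_singleton.2 ⟨c, hc⟩)

theorem eq_span_pair {L : Gr K 1 2} {h l : Forms K 1} (hh : h ∈ L.1) (hl : l ∈ L.1)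
    (hind : LinearIndependent K ![h, l]) : L.1 = Submodule.span K {h, l} := by
  have : Module.Finite K L.1 := Module.finite_of_finrank_pos (by rw [L.2]; omega)
  symm
  apply Submodule.eq_of_le_of_finrank_eq
  · rw [Submodule.span_le]
    rintro _ (rfl | rfl) <;> assumption
  · rw [finrank_span_pair_eq hind, L.2]

/-- On `𝕄` the rank of `ν` is at most `11`. -/
theorem finrank_range_nu_of_mem_MM {p : Gr K 2 2 × Gr K 3 8} (hp : p ∈ MM K) :
    finrank K (LinearMap.range (nu p.1.1 p.2.1)) ≤ 11 := by
  obtain ⟨H, L, h', h'', hHL, hh', hh'H, -, hA, hB⟩ := hp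
  obtain ⟨h, hne, hspan⟩ := exists_eq_span_singleton H
  have hind : LinearIndependent K ![h, h'] :=
    linearIndependent_pair_of_not_mem hne (hspan ▸ hh'H)
  have hL : L.1 = Submodule.span K {h, h'} :=
    eq_span_pair (hHL (hspan ▸ Submodule.mem_span_singleton_self h)) hh' hind
  have hA' : p.1.1 = Submodule.span K {mul11 h h, mul11 h h'} := by
    rw [hA, hspan, hL]
    exact mulSpan_singleton_pair _ _ _
  rw [range_nu, hB, hA']
  change finrank K (mulSpan (Submodule.span K {mul11 h h, mul11 h h'})
    (mulSpan (Submodule.span K {mul11 h h, mul11 h h'}) (⊤ : Submodule K (Forms K 1)) ⊔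
      Submodule.span K {mul21 (mul11 h' h') h''})) ≤ 11
  rw [← range_degenerateMap]
  have h1 : finrank K (LinearMap.range (degenerateMap h h h' (mul21 (mul11 h' h') h''))) +
      finrank K (LinearMap.ker (degenerateMap h h h' (mul21 (mul11 h' h') h''))) = 14 :=
    (LinearMap.finrank_range_add_finrank_ker _).trans finrank_degenerateMap_domain
  -- The third relation, special to `𝕄`, is `h² · (h'² h'') = (h h')² · h''`.
  have hli : LinearIndependent K
      ![((-h', h, 0, 0, 0) : Forms K 1 × Forms K 1 × Forms K 1 × K × K),
      (0, -h', h, 0, 0), (0, 0, -h'', 1, 0)] := by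
    rw [Fintype.linearIndependent_iff]
    intro g hg
    simp only [Fin.sum_univ_three, Matrix.cons_val_zero, Matrix.cons_val_one, Matrix.cons_val,
      Prod.smul_mk, Prod.mk_add_mk, smul_zero, add_zero, zero_add, Prod.mk_eq_zero,
      smul_eq_mul, mul_one, mul_zero] at hg
    obtain ⟨-, hg2, hg3, hg4, -⟩ := hg
    rw [hg4, zero_smul, add_zero] at hg3
    have hg1 := (smul_eq_zero.1 hg3).resolve_right hne
    rw [hg1, zero_smul, add_zero] at hg2
    have hg0 := (smul_eq_zero.1 hg2).resolve_right hne
    intro i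
    fin_cases i <;> assumption
  have h3 : 3 ≤ finrank K
      (LinearMap.ker (degenerateMap h h h' (mul21 (mul11 h' h') h''))) := by
    have := (finrank_span_eq_card hli).trans (Fintype.card_fin 3)
    rw [← this]
    apply Submodule.finrank_mono
    rw [Submodule.span_le]
    rintro _ ⟨i, rfl⟩
    refine LinearMap.mem_ker.2 (Forms.ext ?_)
    fin_cases i
    · refine (coe_degenerateMap _ _ _ _ _ _ _ _ _).trans ?_
      simp only [Forms.coe_neg, Forms.coe_zero, C_0]
      ring
    · refine (coe_degenerateMap _ _ _ _ _ _ _ _ _).trans ?_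
      simp only [Forms.coe_neg, Forms.coe_zero, C_0]
      ring
    · refine (coe_degenerateMap _ _ _ _ _ _ _ _ _).trans ?_
      simp only [Forms.coe_neg, Forms.coe_zero, C_0, C_1, coe_mul21, coe_mul11]
      ring
  have h4 : finrank K (LinearMap.range (degenerateMap h h h' (mul21 (mul11 h' h') h''))) ≤ 11 := by
    omega
  exact h4

end Rank

/-! ## The rank of `ν` at a pencil with a fixed plane -/

section FixedPlane

variable {K : Type*} [Field K]

/-- The relations that involve the additional cubic `c`. -/
theorem cubic_relation {h l l' : Forms K 1} {c : Forms K 3} (hh : h ≠ 0)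
    (hind : LinearIndependent K ![l, l']) {x y z : Forms K 1}
    (hrel : h.1 * (l.1 ^ 2 * x.1 + l.1 * l'.1 * y.1 + l'.1 ^ 2 * z.1) + l.1 * c.1 = 0) :
    (∃ u u' : Forms K 1, c.1 = h.1 * l.1 * u.1 + h.1 * l'.1 * u'.1) ∨
      ∃ s : K, s ≠ 0 ∧ l = s • h := by
  have hind' := LinearIndependent.pair_iff.1 hind
  have hl : l ≠ 0 := by
    rintro rfl
    exact one_ne_zero (hind' 1 0 (by simp)).1
  have hpr := prime_of_linear hl
  have hnd : ¬ l.1 ∣ l'.1 := by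
    intro hd
    obtain ⟨c, rfl⟩ := exists_smul_of_dvd hd
    exact one_ne_zero (neg_eq_zero.1 (hind' c (-1) (by simp)).2)
  have hdvd : h.1 ∣ l.1 * c.1 :=
    ⟨-(l.1 ^ 2 * x.1 + l.1 * l'.1 * y.1 + l'.1 ^ 2 * z.1), by linear_combination hrel⟩
  rcases (prime_of_linear hh).dvd_or_dvd hdvd with h1 | ⟨q, hq⟩
  · right
    obtain ⟨s, rfl⟩ := exists_smul_of_dvd h1
    refine ⟨s, ?_, rfl⟩
    rintro rfl
    exact hl (zero_smul _ _)
  · left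
    have h2 : l.1 ^ 2 * x.1 + l.1 * l'.1 * y.1 + l'.1 ^ 2 * z.1 + l.1 * q = 0 := by
      rw [hq] at hrel
      have : h.1 * (l.1 ^ 2 * x.1 + l.1 * l'.1 * y.1 + l'.1 ^ 2 * z.1 + l.1 * q) = 0 := by
        linear_combination hrel
      exact (mul_eq_zero.1 this).resolve_left (Forms.coe_ne_zero hh)
    have h3 : l.1 ∣ l'.1 ^ 2 * z.1 := ⟨-(l.1 * x.1 + l'.1 * y.1 + q), by linear_combination h2⟩
    obtain ⟨κ, rfl⟩ := exists_smul_of_dvd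
      ((hpr.dvd_or_dvd h3).resolve_left fun h' => hnd (hpr.dvd_of_dvd_pow h'))
    rw [Forms.coe_smul] at h2
    have h4 : l.1 * (l.1 * x.1 + l'.1 * y.1 + C κ * l'.1 ^ 2 + q) = 0 := by
      linear_combination h2
    have h5 := (mul_eq_zero.1 h4).resolve_left (Forms.coe_ne_zero hl)
    refine ⟨-x, -(y + κ • l'), ?_⟩
    rw [hq]
    simp only [Forms.coe_neg, Forms.coe_add, Forms.coe_smul]
    linear_combination h.1 * h5

theorem exists_span_pair_of_mem {L : Gr K 1 2} {l : Forms K 1} (hl : l ∈ L.1) (hl0 : l ≠ 0) :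
    ∃ l' ∈ L.1, LinearIndependent K ![l, l'] := by
  have : Module.Finite K L.1 := Module.finite_of_finrank_pos (by rw [L.2]; omega)
  have hlt : Submodule.span K {l} < L.1 := by
    refine lt_of_le_of_ne ((Submodule.span_singleton_le_iff_mem _ _).2 hl) fun h => ?_
    have h2 := L.2
    rw [← h, finrank_span_singleton hl0] at h2
    omega
  obtain ⟨l', hl', hn⟩ := SetLike.exists_of_lt hlt
  exact ⟨l', hl', linearIndependent_pair_of_not_mem hl0 hn⟩

/-- The rank is `14 - 2` unless some relation involves `c`. Such a relation exhibits `H ≤ L` and a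
cubic `l'² z'` that can replace `c`, contrary to `p ∉ MM K`. -/
theorem finrank_range_nu_of_mem_Z {p : Gr K 2 2 × Gr K 3 8} (hp : p.1 ∈ Z K)
    (hle : mulSpan p.1.1 (⊤ : Submodule K (Forms K 1)) ≤ p.2.1) (hM : p ∉ MM K) :
    finrank K (LinearMap.range (nu p.1.1 p.2.1)) = 12 := by
  have hfin : Module.Finite K p.2.1 := Module.finite_of_finrank_pos (by rw [p.2.2]; omega)
  obtain ⟨H, L, hA⟩ := hp
  obtain ⟨h, hh, hH⟩ := exists_eq_span_singleton H
  obtain ⟨l₁, l₂, hL, hind⟩ := exists_span_pair L.2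
  have hA' : p.1.1 = Submodule.span K {mul11 h l₁, mul11 h l₂} := by
    rw [hA, hH, hL]
    exact mulSpan_singleton_pair _ _ _
  have h7 : finrank K (mulSpan p.1.1 (⊤ : Submodule K (Forms K 1))) = 7 := by
    rw [hA']
    exact finrank_mulSpan_top_of_plane hh hind
  have hlt : mulSpan p.1.1 (⊤ : Submodule K (Forms K 1)) < p.2.1 := by
    refine lt_of_le_of_ne hle fun h => ?_
    have h2 := p.2.2
    rw [← h] at h2
    exact absurd (h7.symm.trans h2) (by omega)
  obtain ⟨c, hcB, hcA⟩ := SetLike.exists_of_lt hlt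
  have hspan : ∀ c ∈ p.2.1, c ∉ mulSpan p.1.1 (⊤ : Submodule K (Forms K 1)) →
      p.2.1 = mulSpan p.1.1 (⊤ : Submodule K (Forms K 1)) ⊔ Submodule.span K {c} := by
    intro c hcB hcA
    have hle' : mulSpan p.1.1 (⊤ : Submodule K (Forms K 1)) ⊔ Submodule.span K {c} ≤ p.2.1 :=
      sup_le hle ((Submodule.span_singleton_le_iff_mem _ _).2 hcB)
    have hlt' : mulSpan p.1.1 (⊤ : Submodule K (Forms K 1)) <
        mulSpan p.1.1 (⊤ : Submodule K (Forms K 1)) ⊔ Submodule.span K {c} := by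
      refine lt_of_le_of_ne le_sup_left fun h => hcA ?_
      rw [h]
      exact Submodule.mem_sup_right (Submodule.mem_span_singleton_self c)
    have h3 := Submodule.finrank_lt_finrank_of_lt hlt'
    rw [h7] at h3
    exact (Submodule.eq_of_le_of_finrank_le hle' (p.2.2.le.trans h3)).symm
  have hmul : ∀ l ∈ L.1, ∀ u : Forms K 1, mul21 (mul11 h l) u ∈
      mulSpan p.1.1 (⊤ : Submodule K (Forms K 1)) := fun l hl u =>
    mul_mem_mulSpan (hA ▸ mul_mem_mulSpan (hH ▸ Submodule.mem_span_singleton_self h) hl) trivial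
  rw [range_nu, hspan c hcB hcA, hA']
  refine (congrArg (fun W : Submodule K (Forms K 5) => finrank K W)
    (range_degenerateMap h l₁ l₂ c)).symm.trans (finrank_range_degenerateMap hh hind ?_)
  intro x y z s₁ s₂ hrel
  rw [← LinearIndependent.pair_iff.1 hind |> fun hi => (⟨hi s₁ s₂, by
    rintro ⟨rfl, rfl⟩; simp⟩ : s₁ • l₁ + s₂ • l₂ = 0 ↔ s₁ = 0 ∧ s₂ = 0)]
  by_contra hl0
  have hl₁ : l₁ ∈ L.1 := hL ▸ Submodule.subset_span (by simp)
  have hl₂ : l₂ ∈ L.1 := hL ▸ Submodule.subset_span (by simp)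
  set l := s₁ • l₁ + s₂ • l₂ with hl
  have hlL : l ∈ L.1 := add_mem (Submodule.smul_mem _ _ hl₁) (Submodule.smul_mem _ _ hl₂)
  -- The relation is rewritten in a basis of `L` beginning with `l`, so that only `l` multiplies
  -- `c`.
  obtain ⟨l', hl'L, hind'⟩ := exists_span_pair_of_mem hlL hl0
  have hL' := eq_span_pair hlL hl'L hind'
  rw [hL'] at hl₁ hl₂
  obtain ⟨a, b, hab⟩ := Submodule.mem_span_pair.1 hl₁
  obtain ⟨d, e, hde⟩ := Submodule.mem_span_pair.1 hl₂
  obtain ⟨x', y', z', hw⟩ : ∃ x' y' z' : Forms K 1,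
      l₁.1 ^ 2 * x.1 + l₁.1 * l₂.1 * y.1 + l₂.1 ^ 2 * z.1 =
        l.1 ^ 2 * x'.1 + l.1 * l'.1 * y'.1 + l'.1 ^ 2 * z'.1 := by
    refine ⟨(a * a) • x + (a * d) • y + (d * d) • z,
      (2 * a * b) • x + (a * e + b * d) • y + (2 * d * e) • z,
      (b * b) • x + (b * e) • y + (e * e) • z, ?_⟩
    rw [← hab, ← hde]
    simp only [Forms.coe_add, Forms.coe_smul, map_mul, map_add, map_ofNat]
    ring
  rw [hw] at hrel
  have hrel' : h.1 * (l.1 ^ 2 * x'.1 + l.1 * l'.1 * y'.1 + l'.1 ^ 2 * z'.1) + l.1 * c.1 = 0 := by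
    rw [← hrel, hl]
    simp only [Forms.coe_add, Forms.coe_smul]
  rcases cubic_relation hh hind' hrel' with ⟨u, u', hu⟩ | ⟨s, hs, hls⟩
  · apply hcA
    have : c = mul21 (mul11 h l) u + mul21 (mul11 h l') u' := Forms.ext hu
    rw [this]
    exact add_mem (hmul l hlL u) (hmul l' hl'L u')
  · have hhL : h ∈ L.1 := by
      have : h = s⁻¹ • l := by rw [hls, smul_smul, inv_mul_cancel₀ hs, one_smul]
      rw [this]
      exact Submodule.smul_mem _ _ hlL
    -- With `l = s h`, one factor `h` can be cancelled. Modulo `A · 𝓕₁` this leaves `c` proportional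
    -- to `l'² z'`.
    have hc : c = -(s⁻¹ • (mul21 (mul11 h l) (s • x') + mul21 (mul11 h l') (s • y') +
        mul21 (mul11 l' l') z')) := by
      have h1 : h.1 * (l.1 ^ 2 * x'.1 + l.1 * l'.1 * y'.1 + l'.1 ^ 2 * z'.1 + C s * c.1) = 0 := by
        rw [← hrel']
        simp only [hls, Forms.coe_smul]
        ring
      have h2 := (mul_eq_zero.1 h1).resolve_left (Forms.coe_ne_zero hh)
      have h3 : (C s⁻¹ : MvPolynomial (Fin 4) K) * C s = 1 := by
        rw [← C_mul, inv_mul_cancel₀ hs, C_1]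
      apply Forms.ext
      simp only [Forms.coe_neg, Forms.coe_smul, Forms.coe_add, coe_mul21, coe_mul11]
      have h4 : l.1 = C s * h.1 := by rw [hls, Forms.coe_smul]
      rw [h4] at h2 ⊢
      linear_combination C s⁻¹ * h2 - c.1 * h3
    have hz'B : mul21 (mul11 l' l') z' ∈ p.2.1 := by
      have : mul21 (mul11 l' l') z' = -(s • c) - (mul21 (mul11 h l) (s • x') +
          mul21 (mul11 h l') (s • y')) := by
        rw [hc, smul_neg, smul_smul, mul_inv_cancel₀ hs, one_smul, neg_neg]
        abel
      rw [this]
      exact sub_mem (neg_mem (Submodule.smul_mem _ _ hcB))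
        (add_mem (hle (hmul l hlL _)) (hle (hmul l' hl'L _)))
    have hz'A : mul21 (mul11 l' l') z' ∉ mulSpan p.1.1 (⊤ : Submodule K (Forms K 1)) := by
      intro hmem
      apply hcA
      rw [hc]
      exact neg_mem (Submodule.smul_mem _ _
        (add_mem (add_mem (hmul l hlL _) (hmul l' hl'L _)) hmem))
    apply hM
    refine ⟨H, L, l', z', ?_, hl'L, ?_, ?_, hA, hspan _ hz'B hz'A⟩
    · rw [hH]
      exact (Submodule.span_singleton_le_iff_mem _ _).2 hhL
    · rw [hH]
      intro hmem
      obtain ⟨t, ht⟩ := Submodule.mem_span_singleton.1 hmem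
      exact hs (neg_eq_zero.1 (LinearIndependent.pair_iff.1 hind' t (-s) (by
        rw [← ht, hls, smul_smul, smul_smul, mul_comm t, neg_mul, neg_smul, add_neg_cancel])).2)
    · rw [hH]
      intro hmem
      obtain ⟨t, rfl⟩ := Submodule.mem_span_singleton.1 hmem
      apply hz'A
      have : mul21 (mul11 l' l') (t • h) = mul21 (mul11 h l') (t • l') := Forms.ext (by
        simp only [coe_mul21, coe_mul11, Forms.coe_smul]
        ring)
      rw [this]
      exact hmul l' hl'L _

end FixedPlane

/-! ## Normal forms of the points of `𝕄` -/

/-- Of the eight products of `a, b` with the coordinates, the frame omits only `a x₁`; the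
hypothesis supplies it. -/
theorem span_cubicFrame {R : Type*} [CommRing R] {a b : Forms R 2} {x : Fin 4 → Forms R 1}
    {c : Forms R 3} (hx : IsCoord x)
    (h : mul21 a (x 1) ∈ Submodule.span R (Set.range (cubicFrame a b x c))) :
    Submodule.span R (Set.range (cubicFrame a b x c)) =
      mulSpan (Submodule.span R {a, b}) (⊤ : Submodule R (Forms R 1)) ⊔ Submodule.span R {c} := by
  have hm : ∀ i, cubicFrame a b x c i ∈ Submodule.span R (Set.range (cubicFrame a b x c)) :=
    fun i => Submodule.subset_span ⟨i, rfl⟩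
  have ha : ∀ u, mul21 a u ∈
      mulSpan (Submodule.span R {a, b}) (⊤ : Submodule R (Forms R 1)) ⊔ Submodule.span R {c} :=
    fun u => Submodule.mem_sup_left (mul_mem_mulSpan (Submodule.subset_span (by simp)) trivial)
  have hb : ∀ u, mul21 b u ∈
      mulSpan (Submodule.span R {a, b}) (⊤ : Submodule R (Forms R 1)) ⊔ Submodule.span R {c} :=
    fun u => Submodule.mem_sup_left (mul_mem_mulSpan (Submodule.subset_span (by simp)) trivial)
  apply le_antisymm
  · rw [Submodule.span_le]
    rintro _ ⟨i, rfl⟩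
    fin_cases i
    exacts [ha _, ha _, ha _, hb _, hb _, hb _, hb _,
      Submodule.mem_sup_right (Submodule.mem_span_singleton_self c)]
  · refine sup_le ?_ ((Submodule.span_singleton_le_iff_mem _ _).2 (hm 7))
    have key : ∀ q : Forms R 2, (∀ i, mul21 q (x i) ∈
        Submodule.span R (Set.range (cubicFrame a b x c))) → ∀ u, mul21 q u ∈
        Submodule.span R (Set.range (cubicFrame a b x c)) := by
      intro q hq u
      obtain ⟨s, hs⟩ := hx.exists_degree_one u
      have : mul21 q u = s 0 • mul21 q (x 0) + s 1 • mul21 q (x 1) + s 2 • mul21 q (x 2) +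
          s 3 • mul21 q (x 3) := Forms.ext (by
        simp only [Forms.coe_add, Forms.coe_smul, coe_mul21, hs]
        ring)
      rw [this]
      exact add_mem (add_mem (add_mem (Submodule.smul_mem _ _ (hq 0)) (Submodule.smul_mem _ _ (hq 1)))
        (Submodule.smul_mem _ _ (hq 2))) (Submodule.smul_mem _ _ (hq 3))
    rw [mulSpan_le]
    intro f hf u _
    obtain ⟨s, t, rfl⟩ := Submodule.mem_span_pair.1 hf
    rw [map_add, map_smul, map_smul, LinearMap.add_apply, LinearMap.smul_apply,
      LinearMap.smul_apply]
    refine add_mem (Submodule.smul_mem _ _ (key a (fun i => ?_) u))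
      (Submodule.smul_mem _ _ (key b (fun i => ?_) u))
    · fin_cases i
      exacts [hm 0, h, hm 1, hm 2]
    · fin_cases i
      exacts [hm 3, hm 4, hm 5, hm 6]

section Normal

variable {K : Type*} [Field K]

theorem range_pair {M : Type*} (a b : M) : Set.range ![a, b] = {a, b} := by
  rw [Matrix.range_cons, Matrix.range_cons, Matrix.range_empty, Set.union_empty,
    Set.singleton_union]

theorem IsCoord.linearIndependent {x : Fin 4 → Forms K 1} (hx : IsCoord x) :
    LinearIndependent K x := by
  have h := Matrix.linearIndependent_rows_of_det_ne_zero hx.ne_zero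
  let F : Forms K 1 →ₗ[K] Fin 4 → K :=
    LinearMap.pi fun j => (lcoeff K (Finsupp.single j 1)).comp (toPoly K 1)
  exact LinearIndependent.of_comp F h

theorem exists_isCoord_extending {h l : Forms K 1} (hind : LinearIndependent K ![h, l]) :
    ∃ x : Fin 4 → Forms K 1, IsCoord x ∧ x 0 = h ∧ x 1 = l := by
  obtain ⟨y, hy⟩ := exists_linearIndependent_snoc_of_lt_finrank hind (by rw [finrank_linear]; omega)
  obtain ⟨z, hz⟩ := exists_linearIndependent_snoc_of_lt_finrank hy (by rw [finrank_linear]; omega)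
  exact ⟨_, isCoord_of_linearIndependent hz, rfl, rfl⟩

theorem square_frame_span {x : Fin 4 → Forms K 1} (hx : IsCoord x) (c : Forms K 3) :
    Submodule.span K (Set.range (cubicFrame (mul11 (x 0) (x 0)) (mul11 (x 0) (x 1)) x c)) =
      mulSpan (Submodule.span K {mul11 (x 0) (x 0), mul11 (x 0) (x 1)})
        (⊤ : Submodule K (Forms K 1)) ⊔ Submodule.span K {c} := by
  apply span_cubicFrame hx
  have : mul21 (mul11 (x 0) (x 0)) (x 1) = mul21 (mul11 (x 0) (x 1)) (x 0) := Forms.ext (by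
    simp only [coe_mul21, coe_mul11]
    ring)
  rw [this]
  exact Submodule.subset_span ⟨3, rfl⟩

/-- As `h'² h = (h h') h'` lies in `A · 𝓕₁`, the component of `h''` along `h` can be dropped. What
remains is nonzero because `h'' ∉ H`. -/
theorem exists_normal_form_of_mem_MM {p : Gr K 2 2 × Gr K 3 8} (hp : p ∈ MM K) :
    ∃ (x : Fin 4 → Forms K 1) (g : Forms K 1) (b c d : K), IsCoord x ∧
      g.1 = C b * (x 1).1 + C c * (x 2).1 + C d * (x 3).1 ∧ (b ≠ 0 ∨ c ≠ 0 ∨ d ≠ 0) ∧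
      Submodule.span K (Set.range ![mul11 (x 0) (x 0), mul11 (x 0) (x 1)]) = p.1.1 ∧
      Submodule.span K (Set.range (cubicFrame (mul11 (x 0) (x 0)) (mul11 (x 0) (x 1)) x
        (mul21 (mul11 (x 1) (x 1)) g))) = p.2.1 := by
  obtain ⟨H, L, h', h'', hHL, hh', hh'H, hh''H, hA, hB⟩ := hp
  obtain ⟨h, hne, hspan⟩ := exists_eq_span_singleton H
  have hind : LinearIndependent K ![h, h'] :=
    linearIndependent_pair_of_not_mem hne (hspan ▸ hh'H)
  have hL : L.1 = Submodule.span K {h, h'} :=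
    eq_span_pair (hHL (hspan ▸ Submodule.mem_span_singleton_self h)) hh' hind
  obtain ⟨x, hx, rfl, rfl⟩ := exists_isCoord_extending hind
  obtain ⟨s, hs⟩ := hx.exists_degree_one h''
  have hA' : p.1.1 = Submodule.span K {mul11 (x 0) (x 0), mul11 (x 0) (x 1)} := by
    rw [hA, hspan, hL]
    exact mulSpan_singleton_pair _ _ _
  have hg : (h'' - s 0 • x 0).1 = C (s 1) * (x 1).1 + C (s 2) * (x 2).1 + C (s 3) * (x 3).1 := by
    rw [Forms.coe_sub, hs, Forms.coe_smul]
    ring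
  refine ⟨x, h'' - s 0 • x 0, s 1, s 2, s 3, hx, hg, ?_, by rw [range_pair, hA'], ?_⟩
  · by_contra! hcon
    apply hh''H
    rw [hspan]
    refine Submodule.mem_span_singleton.2 ⟨s 0, ?_⟩
    rw [hcon.1, hcon.2.1, hcon.2.2] at hg
    apply Forms.ext
    rw [Forms.coe_sub] at hg
    simp only [C_0, zero_mul, add_zero] at hg
    exact (sub_eq_zero.1 hg).symm
  · rw [square_frame_span hx, hB, ← hA']
    have hmem : mul21 (mul11 (x 1) (x 1)) (s 0 • x 0) ∈
        mulSpan p.1.1 (⊤ : Submodule K (Forms K 1)) := by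
      have : mul21 (mul11 (x 1) (x 1)) (s 0 • x 0) = mul21 (mul11 (x 0) (x 1)) (s 0 • x 1) :=
        Forms.ext (by
          simp only [coe_mul21, coe_mul11, Forms.coe_smul]
          ring)
      rw [this, hA']
      exact mul_mem_mulSpan (Submodule.subset_span (by simp)) trivial
    have hsub : mul21 (mul11 (x 1) (x 1)) (h'' - s 0 • x 0) =
        mul21 (mul11 (x 1) (x 1)) h'' - mul21 (mul11 (x 1) (x 1)) (s 0 • x 0) := map_sub _ _ _
    rw [hsub]
    apply le_antisymm
    · refine sup_le le_sup_left ((Submodule.span_singleton_le_iff_mem _ _).2 (sub_mem ?_ ?_))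
      · exact Submodule.mem_sup_right (Submodule.mem_span_singleton_self _)
      · exact Submodule.mem_sup_left hmem
    · refine sup_le le_sup_left ((Submodule.span_singleton_le_iff_mem _ _).2 ?_)
      have h1 : mulForms K 2 1 (mulForms K 1 1 (x 1) (x 1)) h'' =
          (mul21 (mul11 (x 1) (x 1)) h'' - mul21 (mul11 (x 1) (x 1)) (s 0 • x 0)) +
          mul21 (mul11 (x 1) (x 1)) (s 0 • x 0) := (sub_add_cancel _ _).symm
      rw [h1]
      exact add_mem (Submodule.mem_sup_right (Submodule.mem_span_singleton_self _))
        (Submodule.mem_sup_left hmem)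

/-- The condition `hg` is stronger than `g ∉ H`, but it is the nonvanishing of a single determinant,
which suits a generic family. -/
theorem mem_MM_of_normal_form {p : Gr K 2 2 × Gr K 3 8} {x : Fin 4 → Forms K 1} {g : Forms K 1}
    (hx : IsCoord x) (hg : IsCoord ![x 0, g, x 2, x 3])
    (hA : Submodule.span K (Set.range ![mul11 (x 0) (x 0), mul11 (x 0) (x 1)]) = p.1.1)
    (hB : Submodule.span K (Set.range (cubicFrame (mul11 (x 0) (x 0)) (mul11 (x 0) (x 1)) x
      (mul21 (mul11 (x 1) (x 1)) g))) = p.2.1) : p ∈ MM K := by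
  have hx0 : x 0 ≠ 0 := hx.linearIndependent.ne_zero 0
  have hpair : ∀ y : Fin 4 → Forms K 1, IsCoord y → LinearIndependent K ![y 0, y 1] := by
    intro y hy
    have := hy.linearIndependent.comp ![0, 1] (by decide)
    convert! this using 1
    ext i
    fin_cases i <;> rfl
  have hnm : ∀ y : Fin 4 → Forms K 1, IsCoord y → y 1 ∉ Submodule.span K {y 0} := by
    intro y hy hmem
    obtain ⟨c, hc⟩ := Submodule.mem_span_singleton.1 hmem
    exact (LinearIndependent.pair_iff' (hy.linearIndependent.ne_zero 0)).1 (hpair y hy) c hc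
  rw [range_pair] at hA
  refine ⟨⟨Submodule.span K {x 0}, finrank_span_singleton hx0⟩,
    ⟨Submodule.span K {x 0, x 1}, finrank_span_pair_eq (hpair x hx)⟩, x 1, g, ?_, ?_, hnm x hx,
    hnm _ hg, ?_, ?_⟩
  · exact Submodule.span_mono (by simp)
  · exact Submodule.subset_span (by simp)
  · rw [← hA]
    exact (mulSpan_singleton_pair _ _ _).symm
  · rw [← hB, ← hA, square_frame_span hx]
    rfl

end Normal

/-! ## `𝕄` is contained in `X̃` -/

section Curve

variable {K : Type u} [Field K]

/-- A fixed plane divides `x₀ x₁`, so it is `x₀` or `x₁` up to a unit. The first would divide `x₁`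
or `g`, the second would divide `x₀`. -/
theorem not_mem_Z_of_curve {p : Gr K 2 2} {x : Fin 4 → Forms K 1} (hx : IsCoord x) {g : Forms K 1}
    (hg : g ∉ Submodule.span K {x 0}) {t : K} (ht : t ≠ 0)
    (hp : p.1 = Submodule.span K {mul11 (x 0) (x 0) + t • mul11 (x 1) g, mul11 (x 0) (x 1)}) :
    p ∉ Z K := by
  rintro ⟨H, L, hA⟩
  obtain ⟨h, hh, hH⟩ := exists_eq_span_singleton H
  have hx0 : x 0 ≠ 0 := hx.linearIndependent.ne_zero 0
  have hx1 : x 1 ≠ 0 := hx.linearIndependent.ne_zero 1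
  have hdvd : ∀ q ∈ p.1, h.1 ∣ q.1 := by
    intro q hq
    rw [hA, hH] at hq
    obtain ⟨u, -, hu⟩ := mem_mulSpan_span_singleton.1 hq
    exact ⟨u.1, hu⟩
  have h1 : h.1 ∣ (x 0).1 * (x 0).1 + C t * ((x 1).1 * g.1) := by
    have := hdvd (mul11 (x 0) (x 0) + t • mul11 (x 1) g)
      (hp ▸ Submodule.subset_span (by simp))
    simpa only [Forms.coe_add, Forms.coe_smul, coe_mul11] using this
  have h2 : h.1 ∣ (x 0).1 * (x 1).1 := hdvd (mul11 (x 0) (x 1))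
    (hp ▸ Submodule.subset_span (by simp))
  have hpr := prime_of_linear hh
  have hpr0 := prime_of_linear hx0
  have hpr1 := prime_of_linear hx1
  have hn01 : ¬ (x 0).1 ∣ (x 1).1 := by
    intro hd
    obtain ⟨c, hc⟩ := exists_smul_of_dvd hd
    have := LinearIndependent.pair_iff' (K := K) hx0 (y := x 1)
    have hli : LinearIndependent K ![x 0, x 1] := by
      have := hx.linearIndependent.comp ![0, 1] (by decide)
      convert! this using 1
      ext i
      fin_cases i <;> rfl
    exact this.1 hli c hc.symm
  rcases hpr.dvd_or_dvd h2 with h3 | h3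
  · have ha : (x 0).1 ∣ h.1 := (hpr.associated_of_dvd hpr0 h3).symm.dvd
    have h4 : (x 0).1 ∣ C t * ((x 1).1 * g.1) :=
      (dvd_add_right (Dvd.intro _ rfl)).1 (ha.trans h1)
    rcases hpr0.dvd_or_dvd h4 with h5 | h5
    · refine hpr0.not_isUnit (isUnit_of_dvd_unit h5 ((isUnit_iff_ne_zero.2 ht).map C))
    · rcases hpr0.dvd_or_dvd h5 with h6 | h6
      · exact hn01 h6
      · exact hg (mem_span_singleton_of_dvd h6)
  · have ha : (x 1).1 ∣ h.1 := (hpr.associated_of_dvd hpr1 h3).symm.dvd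
    have h4 : (x 1).1 ∣ (x 0).1 * (x 0).1 :=
      (dvd_add_left ⟨C t * g.1, by ring⟩).1 (ha.trans h1)
    have h5 : (x 1).1 ∣ (x 0).1 := (hpr1.dvd_or_dvd h4).elim id id
    exact hn01 (hpr1.associated_of_dvd hpr0 h5).symm.dvd

theorem mapForms_pair {R S : Type*} [CommRing R] [CommRing S] (φ : R →+* S) {d : ℕ}
    (a b : Forms R d) :
    (fun i => mapForms φ (![a, b] i)) = ![mapForms φ a, mapForms φ b] := by
  funext i
  fin_cases i <;> rfl

/-- The identity `(x₀² + t x₁ g) x₁ - (x₀ x₁) x₀ = t x₁² g` with `t` invertible shows that the last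
cubic of the frame already lies in `A · 𝓕₁`. -/
theorem mem_graphKappa_of_curve {p : Gr K 2 2 × Gr K 3 8} {x : Fin 4 → Forms K 1} (hx : IsCoord x)
    {g : Forms K 1} (hg : g ∉ Submodule.span K {x 0}) {t : K} (ht : t ≠ 0)
    (hA : Submodule.span K (Set.range
      ![mul11 (x 0) (x 0) + t • mul11 (x 1) g, mul11 (x 0) (x 1)]) = p.1.1)
    (hB : Submodule.span K (Set.range (cubicFrame (mul11 (x 0) (x 0) + t • mul11 (x 1) g)
      (mul11 (x 0) (x 1)) x (mul21 (mul11 (x 1) (x 1)) g))) = p.2.1) : p ∈ graphKappa K := by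
  rw [range_pair] at hA
  refine ⟨not_mem_Z_of_curve hx hg ht hA.symm, ?_⟩
  have hrel : mul21 (mul11 (x 0) (x 0) + t • mul11 (x 1) g) (x 1) =
      mul21 (mul11 (x 0) (x 1)) (x 0) + t • mul21 (mul11 (x 1) (x 1)) g := Forms.ext (by
    simp only [coe_mul21, coe_mul11, Forms.coe_add, Forms.coe_smul]
    ring)
  rw [← hB, span_cubicFrame hx, ← hA, sup_eq_left, Submodule.span_singleton_le_iff_mem]
  · have : mul21 (mul11 (x 1) (x 1)) g =
        t⁻¹ • (mul21 (mul11 (x 0) (x 0) + t • mul11 (x 1) g) (x 1) -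
          mul21 (mul11 (x 0) (x 1)) (x 0)) := by
      rw [hrel, add_sub_cancel_left, smul_smul, inv_mul_cancel₀ ht, one_smul]
    rw [this]
    exact Submodule.smul_mem _ _ (sub_mem
      (mul_mem_mulSpan (Submodule.subset_span (by simp)) trivial)
      (mul_mem_mulSpan (Submodule.subset_span (by simp)) trivial))
  · rw [hrel]
    exact add_mem (Submodule.subset_span ⟨3, rfl⟩)
      (Submodule.smul_mem _ _ (Submodule.subset_span ⟨7, rfl⟩))

theorem MM_subset_Xtilde [Infinite K] : MM K ⊆ Xtilde K := by
  intro p hp T hT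
  obtain ⟨x, g, b, c, d, hx, hg, hne, hA, hB⟩ := exists_normal_form_of_mem_MM hp
  obtain ⟨v, w, x₀, rfl⟩ := exists_chart₂_eq p
  obtain ⟨I, hI⟩ := hT.1 v w
  have hgn : g ∉ Submodule.span K {x 0} := by
    intro hmem
    obtain ⟨s, hs⟩ := Submodule.mem_span_singleton.1 hmem
    have h0 := Fintype.linearIndependent_iff.1 hx.linearIndependent ![-s, b, c, d] (by
      apply Forms.ext
      rw [← hs, Forms.coe_smul] at hg
      simp only [Fin.sum_univ_four, Forms.coe_add, Forms.coe_smul, Forms.coe_zero,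
        Matrix.cons_val_zero, Matrix.cons_val_one, Matrix.cons_val, map_neg]
      linear_combination -hg)
    rcases hne with h | h | h
    exacts [h (h0 1), h (h0 2), h (h0 3)]
  change x₀ ∈ inChart T v w
  rw [hI]
  intro f hf
  let P := MvPolynomial Unit K
  let x' : Fin 4 → Forms P 1 := fun i => extend P (x i)
  let g' : Forms P 1 := extend P g
  let a' : Forms P 2 := mul11 (x' 0) (x' 0) + (X () : P) • mul11 (x' 1) g'
  have hx' : ∀ (y : Unit → K) (i : Fin 4),
      mapForms ((aeval y : P →ₐ[K] K) : P →+* K) (x' i) = x i := fun y i =>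
    (mapForms_extend _ _).trans (extend_self _)
  have hg' : ∀ y : Unit → K, mapForms ((aeval y : P →ₐ[K] K) : P →+* K) g' = g := fun y =>
    (mapForms_extend _ _).trans (extend_self _)
  have ha' : ∀ y : Unit → K, mapForms ((aeval y : P →ₐ[K] K) : P →+* K) a' =
      mul11 (x 0) (x 0) + y () • mul11 (x 1) g := fun y => by
    have hX : (aeval y : P →ₐ[K] K) (X ()) = y () := aeval_X _ _
    simp only [a', mapForms_add, mapForms_smul, mapForms_mul11, hx', hg', RingHom.coe_coe, hX]
  have hfr : ∀ y : Unit → K, (fun i => mapForms ((aeval y : P →ₐ[K] K) : P →+* K)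
      (![a', mul11 (x' 0) (x' 1)] i)) =
      ![mul11 (x 0) (x 0) + y () • mul11 (x 1) g, mul11 (x 0) (x 1)] := fun y => by
    rw [mapForms_pair, ha', mapForms_mul11, hx', hx']
  have hfr' : ∀ y : Unit → K, (fun i => mapForms ((aeval y : P →ₐ[K] K) : P →+* K)
      (cubicFrame a' (mul11 (x' 0) (x' 1)) x' (mul21 (mul11 (x' 1) (x' 1)) g') i)) =
      cubicFrame (mul11 (x 0) (x 0) + y () • mul11 (x 1) g) (mul11 (x 0) (x 1)) x
        (mul21 (mul11 (x 1) (x 1)) g) := fun y => by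
    funext i
    simp only [mapForms_cubicFrame, ha', mapForms_mul11, mapForms_mul21, hx', hg']
  -- The family lives over the affine line; its members with nonzero parameter are in the graph, and
  -- the parameter `0` gives the point of `𝕄`.
  have := aeval_eq_zero_of_family v w f ![a', mul11 (x' 0) (x' 1)]
    (cubicFrame a' (mul11 (x' 0) (x' 1)) x' (mul21 (mul11 (x' 1) (x' 1)) g'))
    (g := X ()) (X_ne_zero _) ?_ (aeval (0 : Unit → K)) (fun i j => x₀ (Sum.inl (i, j)))
    (fun i j => x₀ (Sum.inr (i, j))) ?_ ?_
  · rwa [pairCoord_self] at this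
  · intro y hy z hz₁ hz₂
    rw [aeval_X] at hy
    rw [hfr] at hz₁
    rw [hfr'] at hz₂
    have hmem : z ∈ inChart T v w :=
      hT.2 (mem_graphKappa_of_curve (p := chart₂ v w z) hx hgn hy hz₁ hz₂)
    rw [hI] at hmem
    exact hmem f hf
  · rw [hfr]
    rw [Pi.zero_apply, zero_smul, add_zero]
    exact hA
  · rw [hfr']
    rw [Pi.zero_apply, zero_smul, add_zero]
    exact hB

end Curve

/-! ## The inclusion `𝒜 · 𝓕₁ ⊆ ℬ` -/

section Inclusion

variable {K : Type u} [Field K] (v : Basis2 K) (w : Basis3 K)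

/-- The products of quadrics in `𝒜` with linear forms are in `ℬ`. -/
theorem mul21_mem_chartSpan {S : Type u} [CommRing S] [Algebra K S] (φ : MvPolynomial Coord K →ₐ[K] S)
    (hφ : ∀ f ∈ vanishingIdeal K (inChart (Xtilde K) v w), φ f = 0) {a : Forms S 2}
    (ha : a ∈ chartSpan S v fun i j => φ (X (Sum.inl (i, j)))) (u : Forms S 1) :
    mul21 a u ∈ chartSpan S w fun i j => φ (X (Sum.inr (i, j))) := by
  let P := MvPolynomial Coord K
  let r : Fin 2 → Forms P 2 := chartRow P v fun i j => X (Sum.inl (i, j))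
  -- These polynomials express that row `i` times the variable `m` lies in the row span of the
  -- second matrix. They vanish on the graph, hence on its closure.
  let F : Fin 2 → Mon 1 → Fin 12 → P := fun i m j =>
    (extBasis P w).repr (mul21 (r i) (monBasis P 1 m)) (Sum.inr j) -
      ∑ k, (extBasis P w).repr (mul21 (r i) (monBasis P 1 m)) (Sum.inl k) * X (Sum.inr (k, j))
  have hmon : ∀ {T : Type u} [CommRing T] [Algebra K T] (ψ : P →ₐ[K] T) (m : Mon 1),
      mapForms (ψ : P →+* T) (monBasis P 1 m) = monBasis T 1 m := fun ψ m => Forms.ext (by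
    simp [coe_monBasis])
  have hF : ∀ {T : Type u} [CommRing T] [Algebra K T] (ψ : P →ₐ[K] T) (i : Fin 2) (m : Mon 1),
      mul21 (chartRow T v (fun i j => ψ (X (Sum.inl (i, j)))) i) (monBasis T 1 m) ∈
        chartSpan T w (fun i j => ψ (X (Sum.inr (i, j)))) ↔ ∀ j, ψ (F i m j) = 0 := by
    intro T _ _ ψ i m
    rw [mem_chartSpan_iff, ← hmon ψ, ← mapForms_chartRow, ← mapForms_mul21]
    refine forall_congr' fun j => ?_
    rw [← sub_eq_zero]
    simp only [extBasis_repr_map, F, r, map_sub, map_sum, map_mul]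
  have hvan : ∀ i m j, φ (F i m j) = 0 := by
    intro i m j
    apply hφ
    rw [mem_vanishingIdeal_iff]
    intro x hx
    refine aeval_eq_zero_of_graph v w (fun y hy => ?_) hx
    have hX : ∀ s, (aeval y : P →ₐ[K] K) (X s) = y s := aeval_X _
    refine (hF (aeval y) i m).1 ?_ j
    simp only [hX]
    have h2 : chartSpan K w (fun i j => y (Sum.inr (i, j))) =
        mulSpan (chartSpan K v (fun i j => y (Sum.inl (i, j)))) (⊤ : Submodule K (Forms K 1)) :=
      hy.2
    rw [h2]
    exact mul_mem_mulSpan (chartRow_mem v _ i) trivial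
  rw [eq_sum_chartRow v _ ha, u.eq_sum_mon]
  simp only [mul21, map_sum, map_smul, LinearMap.sum_apply, LinearMap.smul_apply]
  refine Submodule.sum_mem _ fun m _ => Submodule.smul_mem _ _ (Submodule.sum_mem _ fun i _ =>
    Submodule.smul_mem _ _ ?_)
  exact (hF φ i m).2 (hvan i m)

theorem mulSpan_top_le_of_mem_Xtilde {p : Gr K 2 2 × Gr K 3 8} (hp : p ∈ Xtilde K) :
    mulSpan p.1.1 (⊤ : Submodule K (Forms K 1)) ≤ p.2.1 := by
  obtain ⟨v, w, x, rfl⟩ := exists_chart₂_eq p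
  rw [mulSpan_le]
  intro a ha u _
  have := mul21_mem_chartSpan v w (aeval x)
    (fun f hf => (mem_vanishingIdeal_iff.1 hf) x hp) (a := a) (by simp only [aeval_X]; exact ha) u
  simp only [aeval_X] at this
  exact this

/-- The rank of `ν` is `12` outside `𝕄`. -/
theorem finrank_range_nu_of_not_mem_MM {p : Gr K 2 2 × Gr K 3 8} (hp : p ∈ Xtilde K)
    (hM : p ∉ MM K) : finrank K (LinearMap.range (nu p.1.1 p.2.1)) = 12 := by
  by_cases hZ : p.1 ∈ Z K
  · exact finrank_range_nu_of_mem_Z hZ (mulSpan_top_le_of_mem_Xtilde hp) hM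
  · exact finrank_range_nu_of_not_mem_Z hZ (mulSpan_top_le_of_mem_Xtilde hp)

end Inclusion

/-! ## Minors -/

section Minors

theorem MultilinearMap.mem_of_mem_span {R V W ι κ : Type*} [CommRing R] [AddCommGroup V]
    [Module R V] [AddCommGroup W] [Module R W] [Fintype ι] [Fintype κ]
    (M : MultilinearMap R (fun _ : ι => V) W) (N : Submodule R W) (s : κ → V)
    (h : ∀ r : ι → κ, M (fun i => s (r i)) ∈ N) {u : ι → V}
    (hu : ∀ i, u i ∈ Submodule.span R (Set.range s)) : M u ∈ N := by
  classical
  choose c hc using fun i => (Submodule.mem_span_range_iff_exists_fun R).1 (hu i)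
  have : u = fun i => ∑ k, c i k • s k := funext fun i => (hc i).symm
  rw [this, MultilinearMap.map_sum]
  refine Submodule.sum_mem _ fun r _ => ?_
  rw [MultilinearMap.map_smul_univ]
  exact Submodule.smul_mem _ _ (h r)

variable {R V : Type*} [CommRing R] [AddCommGroup V] [Module R V]

/-- The determinant of the values of `n` linear functionals on `n` vectors, as an alternating map
of the vectors. -/
def minor {ι : Type*} [Fintype ι] [DecidableEq ι] (f : ι → Dual R V) : V [⋀^ι]→ₗ[R] R :=
  Matrix.detRowAlternating.compLinearMap (LinearMap.pi f)

theorem minor_apply {ι : Type*} [Fintype ι] [DecidableEq ι] (f : ι → Dual R V) (u : ι → V) :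
    minor f u = (Matrix.of fun i j => f j (u i)).det := rfl

/-- A determinant is multilinear in the vectors and, after transposition, in the functionals; so
generators on both sides suffice. -/
theorem minor_mem {ι κ μ : Type*} [Fintype ι] [DecidableEq ι] [Fintype κ] [Fintype μ]
    (I : Ideal R) (s : κ → V) (φ : μ → Dual R V)
    (h : ∀ (r : ι → κ) (m : ι → μ), (Matrix.of fun i j => φ (m j) (s (r i))).det ∈ I)
    {u : ι → V} (hu : ∀ i, u i ∈ Submodule.span R (Set.range s)) {f : ι → Dual R V}
    (hf : ∀ i, f i ∈ Submodule.span R (Set.range φ)) :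
    (Matrix.of fun i j => f j (u i)).det ∈ I := by
  refine MultilinearMap.mem_of_mem_span (minor f).toMultilinearMap I s (fun r => ?_) hu
  change (Matrix.of fun i j => f j (s (r i))).det ∈ I
  rw [← Matrix.det_transpose]
  refine MultilinearMap.mem_of_mem_span (minor fun i => Dual.eval R V (s (r i))).toMultilinearMap
    I φ (fun m => ?_) hf
  change (Matrix.of fun i j => φ (m i) (s (r j))).det ∈ I
  rw [← Matrix.det_transpose]
  exact h r m

theorem mem_span_coord {ι : Type*} [Finite ι] (b : Basis ι R V) (f : Dual R V) :
    f ∈ Submodule.span R (Set.range b.coord) := by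
  classical
  have := b.dualBasis.span_eq
  rw [Basis.coe_dualBasis] at this
  rw [this]
  trivial

end Minors

/-! ## The ideal of the scheme of zeros of `⋀¹² ν` -/

section ZeroIdeal

variable {R : Type*} [CommRing R] {A : Submodule R (Forms R 2)} {B : Submodule R (Forms R 3)}

/-- The alternating map `minor f` is a linear form on the exterior power, and the `u i` lift to the
source of `ν`. -/
theorem minor_mem_zeroIdeal (f : Fin 12 → Dual R (Forms R 5)) {u : Fin 12 → Forms R 5}
    (hu : ∀ i, u i ∈ mulSpan A B) :
    (Matrix.of fun i j => f j (u i)).det ∈ zeroIdeal (wedgeNu A B) := by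
  rw [← range_nu] at hu
  choose t ht using hu
  refine Ideal.subset_span ⟨exteriorPower.ιMulti R 12 t,
    exteriorPower.alternatingMapLinearEquiv (minor f), ?_⟩
  rw [wedgeNu, exteriorPower.map_apply_ιMulti, exteriorPower.alternatingMapLinearEquiv_apply_ιMulti,
    minor_apply]
  congr
  funext i j
  exact congrArg (f j) (ht i)

/-- The exterior power is spanned by decomposable elements, on which a linear form restricts to an
alternating map. -/
theorem zeroIdeal_le {J : Ideal R}
    (h : ∀ (D : Forms R 5 [⋀^Fin 12]→ₗ[R] R) (u : Fin 12 → Forms R 5),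
      (∀ i, u i ∈ mulSpan A B) → D u ∈ J) : zeroIdeal (wedgeNu A B) ≤ J := by
  rw [zeroIdeal, Ideal.span_le]
  rintro _ ⟨p, l, rfl⟩
  have hp : p ∈ Submodule.span R (Set.range (exteriorPower.ιMulti R 12 (M := A ⊗[R] B))) := by
    rw [exteriorPower.ιMulti_span]
    trivial
  have hle : Submodule.span R (Set.range (exteriorPower.ιMulti R 12 (M := A ⊗[R] B))) ≤
      Submodule.comap (l ∘ₗ wedgeNu A B) J := by
    rw [Submodule.span_le]
    rintro _ ⟨t, rfl⟩
    change l (wedgeNu A B (exteriorPower.ιMulti R 12 t)) ∈ J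
    rw [wedgeNu, exteriorPower.map_apply_ιMulti]
    exact h (l.compAlternatingMap (exteriorPower.ιMulti R 12)) _
      fun i => range_nu A B ▸ ⟨t i, rfl⟩
  exact hle hp

end ZeroIdeal

/-! ### Specialization of products and alternating maps -/

section Evaluation

variable {K : Type*} [Field K] {R : Type*} [CommRing R] [Algebra K R]
  {S : Type*} [CommRing S] [Algebra K S] (φ : R →ₐ[K] S)

theorem mapForms_mem_mulSpan {v : Basis2 K} {w : Basis3 K} {α : Fin 2 → Fin 8 → R}
    {β : Fin 8 → Fin 12 → R} {u : Forms R 5}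
    (hu : u ∈ mulSpan (chartSpan R v α) (chartSpan R w β)) :
    mapForms (φ : R →+* S) u ∈
      mulSpan (chartSpan S v fun i j => φ (α i j)) (chartSpan S w fun i j => φ (β i j)) := by
  let W : Submodule S (Forms S 5) :=
    mulSpan (chartSpan S v fun i j => φ (α i j)) (chartSpan S w fun i j => φ (β i j))
  let N : Submodule R (Forms R 5) :=
    { carrier := {u | mapForms (φ : R →+* S) u ∈ W}
      add_mem' := fun {a b} ha hb => by
        change mapForms (φ : R →+* S) (a + b) ∈ W
        rw [mapForms_add]
        exact W.add_mem ha hb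
      zero_mem' := by
        change mapForms (φ : R →+* S) 0 ∈ W
        rw [mapForms_zero]
        exact W.zero_mem
      smul_mem' := fun r a ha => by
        change mapForms (φ : R →+* S) (r • a) ∈ W
        rw [mapForms_smul]
        exact W.smul_mem _ ha }
  refine (mulSpan_le (V := N)).2 (fun f hf g hg => ?_) hu
  change mapForms (φ : R →+* S) (mulForms R 2 3 f g) ∈ W
  rw [mapForms_mulForms]
  exact mul_mem_mulSpan (mapForms_mem_chartSpan v α φ hf) (mapForms_mem_chartSpan w β φ hg)

theorem map_update_sum_smul {R V ι : Type*} [CommRing R] [AddCommGroup V] [Module R V]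
    [Fintype ι] [DecidableEq ι] (D : V [⋀^ι]→ₗ[R] R) (c : ι → R) (u : ι → V) (k : ι) :
    D (Function.update u k (∑ i, c i • u i)) = c k * D u := by
  rw [AlternatingMap.map_update_sum, Finset.sum_eq_single k]
  · rw [AlternatingMap.map_update_smul, Function.update_eq_self, smul_eq_mul]
  · intro i _ hi
    rw [AlternatingMap.map_update_smul, AlternatingMap.map_update_self _ _ hi.symm, smul_zero]
  · simp

/-- An alternating map vanishes at a point on vectors that are dependent at this point. -/
theorem map_alternating_eq_zero {R : Type*} [CommRing R] [Algebra K R] (e : R →ₐ[K] K) {d : ℕ}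
    {ι : Type*} [Finite ι] (D : Forms R d [⋀^ι]→ₗ[R] R) (u : ι → Forms R d)
    (h : ¬ LinearIndependent K fun i => mapForms (e : R →+* K) (u i)) : e (D u) = 0 := by
  classical
  have := Fintype.ofFinite ι
  rw [Fintype.not_linearIndependent_iff] at h
  obtain ⟨c, hc, i₀, hi₀⟩ := h
  set q : Forms R d := ∑ i, algebraMap K R (c i) • u i with hq
  have hq0 : mapForms (e : R →+* K) q = 0 := by
    rw [hq, mapForms_sum, ← hc]
    exact Finset.sum_congr rfl fun i _ => by simp
  -- Replacing `u i₀` by the combination `q` multiplies `D u` by the nonzero scalar `c i₀`. At the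
  -- point the result vanishes, because all coefficients of `q` do.
  have h1 : D (Function.update u i₀ q) = algebraMap K R (c i₀) * D u := by
    rw [hq, map_update_sum_smul D (fun i => algebraMap K R (c i)) u i₀]
  have h2 : e (D (Function.update u i₀ q)) = 0 := by
    rw [q.eq_sum_mon, AlternatingMap.map_update_sum, map_sum]
    refine Finset.sum_eq_zero fun m _ => ?_
    have hm : e (coeff m.1 q.1) = 0 := by
      have := congrArg (fun p => coeff m.1 p.1) hq0
      simpa [coeff_map] using this
    rw [AlternatingMap.map_update_smul, smul_eq_mul, map_mul, hm, zero_mul]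
  rw [h1, map_mul, AlgHom.commutes] at h2
  exact (mul_eq_zero.1 h2).resolve_left hi₀

end Evaluation

/-! ## The ideal of `𝕄` and the minors of `ν` -/

section Ideals

variable {K : Type u} [Field K]

section Products

variable {R : Type*} [CommRing R] [Algebra K R] {S : Type*} [CommRing S] [Algebra K S]
  (v : Basis2 K) (w : Basis3 K)

/-- The products of the rows of the matrices of a point of a chart. -/
def rowProduct (R : Type*) [CommRing R] [Algebra K R] (v : Basis2 K) (w : Basis3 K)
    (α : Fin 2 → Fin 8 → R) (β : Fin 8 → Fin 12 → R) (k : Fin 2 × Fin 8) : Forms R 5 :=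
  mul23 (chartRow R v α k.1) (chartRow R w β k.2)

theorem mulSpan_chartSpan (α : Fin 2 → Fin 8 → R) (β : Fin 8 → Fin 12 → R) :
    mulSpan (chartSpan R v α) (chartSpan R w β) =
      Submodule.span R (Set.range (rowProduct R v w α β)) := by
  rw [chartSpan_eq, chartSpan_eq, mulSpan_span, Set.image2_range]
  rfl

theorem mapForms_rowProduct (φ : R →ₐ[K] S) (α : Fin 2 → Fin 8 → R) (β : Fin 8 → Fin 12 → R)
    (k : Fin 2 × Fin 8) : mapForms (φ : R →+* S) (rowProduct R v w α β k) =
      rowProduct S v w (fun i j => φ (α i j)) (fun i j => φ (β i j)) k := by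
  rw [rowProduct, mapForms_mul23, mapForms_chartRow, mapForms_chartRow, rowProduct]

theorem map_minor_coord (φ : R →ₐ[K] S) {ι : Type*} [Fintype ι] [DecidableEq ι] {d : ℕ}
    (m : ι → Mon d) (u : ι → Forms R d) :
    φ (Matrix.of fun i j => (monBasis R d).coord (m j) (u i)).det =
      (Matrix.of fun i j => (monBasis S d).coord (m j) (mapForms (φ : R →+* S) (u i))).det := by
  rw [AlgHom.map_det]
  congr 1

/-- The products of the rows of the matrix of a pencil with the variables. -/
def rowMultiple (R : Type*) [CommRing R] [Algebra K R] (v : Basis2 K) (α : Fin 2 → Fin 8 → R)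
    (k : Fin 2 × Mon 1) : Forms R 3 :=
  mul21 (chartRow R v α k.1) (monBasis R 1 k.2)

theorem mapForms_rowMultiple (φ : R →ₐ[K] S) (α : Fin 2 → Fin 8 → R) (k : Fin 2 × Mon 1) :
    mapForms (φ : R →+* S) (rowMultiple R v α k) = rowMultiple S v (fun i j => φ (α i j)) k := by
  rw [rowMultiple, mapForms_mul21, mapForms_chartRow, rowMultiple]
  congr 1
  apply Forms.ext
  simp [coe_monBasis]

theorem mulSpan_chartSpan_top (α : Fin 2 → Fin 8 → R) :
    mulSpan (chartSpan R v α) (⊤ : Submodule R (Forms R 1)) =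
      Submodule.span R (Set.range (rowMultiple R v α)) := by
  rw [chartSpan_eq, ← (monBasis R 1).span_eq, mulSpan_span, Set.image2_range]
  rfl

/-- Eight vectors span a space of dimension eight. -/
theorem linearIndependent_rowMultiple {α : Fin 2 → Fin 8 → K} (h : chart v α ∉ Z K) :
    LinearIndependent K (rowMultiple K v α) := by
  rw [linearIndependent_iff_card_eq_finrank_span, Set.finrank, Fintype.card_prod, card_mon,
    Fintype.card_fin]
  have h1 := finrank_mulSpan_top h
  have h2 := congrArg (fun W : Submodule K (Forms K 3) => finrank K W) (mulSpan_chartSpan_top v α)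
  exact (h2.symm.trans h1).symm

theorem sum_smul_rowMultiple (α : Fin 2 → Fin 8 → R) (f : Fin 2 → Forms R 1) :
    ∑ k : Fin 2 × Mon 1, coeff k.2.1 (f k.1).1 • rowMultiple R v α k =
      mul21 (chartRow R v α 0) (f 0) + mul21 (chartRow R v α 1) (f 1) := by
  rw [Fintype.sum_prod_type, Fin.sum_univ_two]
  have : ∀ i, ∑ m : Mon 1, coeff m.1 (f i).1 • rowMultiple R v α (i, m) =
      mul21 (chartRow R v α i) (f i) := by
    intro i
    conv_rhs => rw [(f i).eq_sum_mon, mul21, map_sum]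
    refine Finset.sum_congr rfl fun m _ => ?_
    rw [map_smul]
    rfl
  rw [← this 0, ← this 1]

end Products

variable (v : Basis2 K) (w : Basis3 K)

/-- Evaluation of regular functions at a point of `X̃`. -/
def evalPoint {x : Coord → K} (hx : x ∈ inChart (Xtilde K) v w) : coordRing v w →ₐ[K] K :=
  Ideal.Quotient.liftₐ _ (aeval x) fun _ hf => mem_vanishingIdeal_iff.1 hf x hx

theorem evalPoint_mk {x : Coord → K} (hx : x ∈ inChart (Xtilde K) v w) (f : MvPolynomial Coord K) :
    evalPoint v w hx (Ideal.Quotient.mk _ f) = aeval x f := rfl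

theorem evalPoint_coordFun {x : Coord → K} (hx : x ∈ inChart (Xtilde K) v w) (s : Coord) :
    evalPoint v w hx (coordFun v w s) = x s := by
  rw [coordFun, evalPoint_mk, aeval_X]

/-- The coordinate ring is defined by a vanishing ideal, so its elements are determined by their
values, and the graph is dense. -/
theorem eq_zero_of_evalPoint {r : coordRing v w}
    (h : ∀ (x : Coord → K) (hx : x ∈ inChart (graphKappa K) v w),
      evalPoint v w (graphKappa_subset_Xtilde hx) r = 0) : r = 0 := by
  obtain ⟨f, rfl⟩ := Ideal.Quotient.mk_surjective r
  rw [Ideal.Quotient.eq_zero_iff_mem, mem_vanishingIdeal_iff]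
  exact fun x hx => aeval_eq_zero_of_graph v w (fun y hy => h y hy) hx

theorem mapForms_mem_mulSpan_chart {x : Coord → K} (hx : x ∈ inChart (Xtilde K) v w)
    {u : Forms (coordRing v w) 5} (hu : u ∈ mulSpan (bundleA v w) (bundleB v w)) :
    mapForms (evalPoint v w hx : coordRing v w →+* K) u ∈
      mulSpan (chart₂ v w x).1.1 (chart₂ v w x).2.1 := by
  have := mapForms_mem_mulSpan (evalPoint v w hx) hu
  simp only [evalPoint_coordFun] at this
  exact this

/-- At a point of `𝕄` the products span at most 11 dimensions, so any twelve are dependent and every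
alternating map vanishes on them there. -/
theorem zeroIdeal_le_idealMM [Infinite K] :
    zeroIdeal (wedgeNu (bundleA v w) (bundleB v w)) ≤ idealMM v w := by
  refine zeroIdeal_le fun D u hu => ?_
  obtain ⟨F, hF⟩ := Ideal.Quotient.mk_surjective (D u)
  rw [← hF]
  refine Ideal.mem_map_of_mem _ ?_
  rw [mem_vanishingIdeal_iff]
  intro x hx
  have hxX : x ∈ inChart (Xtilde K) v w := MM_subset_Xtilde hx
  rw [← evalPoint_mk v w hxX, hF]
  refine map_alternating_eq_zero _ D u fun hli => ?_
  have h1 := finrank_range_nu_of_mem_MM hx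
  rw [range_nu] at h1
  have h2 : Submodule.span K (Set.range fun i =>
      mapForms (evalPoint v w hxX : coordRing v w →+* K) (u i)) ≤
      mulSpan (chart₂ v w x).1.1 (chart₂ v w x).2.1 := by
    rw [Submodule.span_le]
    rintro _ ⟨i, rfl⟩
    exact mapForms_mem_mulSpan_chart v w hxX (hu i)
  have h3 := (finrank_span_eq_card hli).symm.le.trans ((Submodule.finrank_mono h2).trans h1)
  rw [Fintype.card_fin] at h3
  omega

/-- Some minor of order `12` does not vanish at a given point outside `𝕄`. -/
theorem exists_mem_zeroIdeal_of_not_mem_MM {x : Coord → K} (hx : x ∈ inChart (Xtilde K) v w)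
    (hM : x ∉ inChart (MM K) v w) :
    ∃ r ∈ zeroIdeal (wedgeNu (bundleA v w) (bundleB v w)), evalPoint v w hx r ≠ 0 := by
  have h1 := finrank_range_nu_of_not_mem_MM hx hM
  have h2 : mulSpan (chart₂ v w x).1.1 (chart₂ v w x).2.1 =
      Submodule.span K (Set.range (rowProduct K v w (fun i j => x (Sum.inl (i, j)))
        fun i j => x (Sum.inr (i, j)))) := mulSpan_chartSpan v w _ _
  rw [range_nu, h2] at h1
  obtain ⟨f, hf, -, hli⟩ := Submodule.exists_fun_fin_finrank_span_eq K
    (Set.range (rowProduct K v w (fun i j => x (Sum.inl (i, j))) fun i j => x (Sum.inr (i, j))))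
  revert f
  rw [h1]
  intro f hf hli
  choose k hk using hf
  -- Twelve row products are independent at the point. Their minor against a dual family takes the
  -- value `1` there.
  obtain ⟨F, hF⟩ := exists_dual_family hli
  let R := coordRing v w
  let u : Fin 12 → Forms R 5 := fun i => rowProduct R v w
    (fun i j => coordFun v w (Sum.inl (i, j))) (fun i j => coordFun v w (Sum.inr (i, j))) (k i)
  refine ⟨_, minor_mem_zeroIdeal (fun j => extendDual R (F j)) (u := u) fun i =>
    mul_mem_mulSpan (chartRow_mem v _ _) (chartRow_mem w _ _), ?_⟩
  rw [AlgHom.map_det]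
  have : (evalPoint v w hx).mapMatrix (Matrix.of fun i j => extendDual R (F j) (u i)) = 1 := by
    ext i j
    have hu : mapForms (evalPoint v w hx : R →+* K) (u i) = f i := by
      rw [← hk i]
      refine (mapForms_rowProduct v w (evalPoint v w hx) _ _ _).trans ?_
      simp only [evalPoint_coordFun]
    rw [AlgHom.mapMatrix_apply, Matrix.map_apply, Matrix.of_apply]
    refine (extendDual_map (evalPoint v w hx) (F j) (u i)).trans ?_
    rw [hu, extendDual_self, hF, Matrix.one_apply]
  rw [this, Matrix.det_one]
  exact one_ne_zero

/-! ### The local rings of `X̃` -/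

section Local

variable {O : Type u} [CommRing O] [Algebra K O] (loc : coordRing v w →ₐ[K] O)

/-- Over `O`, the products of rows generate and the coordinate functionals span the dual. Both come
from the coordinate ring, so their minors are images of minors there. -/
theorem minor_mem_map_zeroIdeal {u : Fin 12 → Forms O 5}
    (hu : ∀ i, u i ∈ mulSpan (chartSpan O v fun i j => loc (coordFun v w (Sum.inl (i, j))))
      (chartSpan O w fun i j => loc (coordFun v w (Sum.inr (i, j)))))
    (f : Fin 12 → Dual O (Forms O 5)) :
    (Matrix.of fun i j => f j (u i)).det ∈
      (zeroIdeal (wedgeNu (bundleA v w) (bundleB v w))).map loc := by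
  rw [mulSpan_chartSpan] at hu
  refine minor_mem _ _ _ (fun r m => ?_) hu (fun i => mem_span_coord (monBasis O 5) (f i))
  simp only [← mapForms_rowProduct]
  rw [← map_minor_coord]
  exact Ideal.mem_map_of_mem loc (minor_mem_zeroIdeal _ fun i =>
    mul_mem_mulSpan (chartRow_mem v _ _) (chartRow_mem w _ _))

/-- The linear form with given coefficients. -/
def linearForm {R : Type*} [CommRing R] (c : Fin 4 → R) : Forms R 1 :=
  ∑ j, c j • mkForm (X j) (isHomogeneous_X R j)

theorem mapForms_linearForm {R S : Type*} [CommRing R] [CommRing S] (φ : R →+* S) (c : Fin 4 → R) :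
    mapForms φ (linearForm c) = linearForm fun j => φ (c j) := by
  rw [linearForm, mapForms_sum, linearForm]
  refine Finset.sum_congr rfl fun j _ => Forms.ext ?_
  simp

theorem linearForm_coeff {R : Type*} [CommRing R] (f : Forms R 1) :
    linearForm (fun j => coeff (Finsupp.single j 1) f.1) = f := by
  apply Forms.ext
  simp only [linearForm, Forms.coe_sum, Forms.coe_smul, coe_mkForm]
  exact (linear_eq f).symm

theorem coeffMatrix_linearForm {R : Type*} [CommRing R] (c : Fin 4 → Fin 4 → R) :
    coeffMatrix (fun i => linearForm (c i)) = Matrix.of c := by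
  ext i j
  simp [coeffMatrix, linearForm, coeff_sum, coeff_X, Finsupp.single_left_inj]

/-- Five linear forms with indeterminate coefficients. -/
def genericForm (K : Type u) [Field K] (i : Fin 5) : Forms (MvPolynomial (Fin 5 × Fin 4) K) 1 :=
  linearForm fun j => X (i, j)

/-- Specializing the five forms to `X₀, X₁, X₂, X₃, X₁` turns both matrices into the identity. -/
theorem genericForm_det_ne_zero :
    (coeffMatrix fun i => genericForm K (![0, 1, 2, 3] i)).det *
      (coeffMatrix fun i => genericForm K (![0, 4, 2, 3] i)).det ≠ 0 := by
  intro h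
  let z : Fin 5 → Fin 4 := ![0, 1, 2, 3, 1]
  have h1 := congrArg (aeval fun s : Fin 5 × Fin 4 => if z s.1 = s.2 then (1 : K) else 0) h
  rw [map_mul, AlgHom.map_det, AlgHom.map_det] at h1
  have key : ∀ q : Fin 4 → Fin 5, (∀ i, z (q i) = i) →
      (aeval fun s : Fin 5 × Fin 4 => if z s.1 = s.2 then (1 : K) else 0).mapMatrix
        (coeffMatrix fun i => genericForm K (q i)) = 1 := by
    intro q hq
    ext i j
    simp only [genericForm]
    rw [coeffMatrix_linearForm]
    simp [hq, Matrix.one_apply]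
  rw [key _ (by decide), key _ (by decide)] at h1
  simp at h1

variable (ε : O →ₐ[K] K)

/-- Modulo the minors the frames have the shape `h²`, `h l`, `l² g`, and so arise by specialization
from five linear forms with indeterminate coefficients. Functions vanishing on `𝕄` vanish on general
members of that family, hence on this specialization. -/
theorem map_idealMM_le (hε : ∀ r, ε r ≠ 0 → IsUnit r) (h2 : (2 : K) ≠ 0) [Infinite K]
    {x : Coord → K} (hx : x ∈ inChart (MM K) v w) (hloc : ∀ s, ε (loc (coordFun v w s)) = x s)
    (hΔ : ∀ (τ : O) (f₀ f₁ : Forms O 1),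
      (mapForms (ε : O →+* K) f₀ ≠ 0 ∨ mapForms (ε : O →+* K) f₁ ≠ 0) →
      τ • (mul21 (chartRow O v (fun i j => loc (coordFun v w (Sum.inl (i, j)))) 0) f₀ +
        mul21 (chartRow O v (fun i j => loc (coordFun v w (Sum.inl (i, j)))) 1) f₁) = 0 → τ = 0) :
    (idealMM v w).map loc ≤ (zeroIdeal (wedgeNu (bundleA v w) (bundleB v w))).map loc := by
  obtain ⟨x₀, g₀, b₀, c₀, d₀, hx₀, hg₀, hne, hA, hB⟩ := exists_normal_form_of_mem_MM hx
  set I := (zeroIdeal (wedgeNu (bundleA v w) (bundleB v w))).map loc with hI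
  obtain ⟨a, b, c, y, g, hab, hc, ha', hb', hc'⟩ := local_structure ε hε h2 v w
    (fun i j => loc (coordFun v w (Sum.inl (i, j)))) (fun i j => loc (coordFun v w (Sum.inr (i, j))))
    hx₀ hg₀ hne (by simp only [hloc]; exact hA) (by simp only [hloc]; exact hB)
    (fun a ha f => mul21_mem_chartSpan v w (loc.comp (Ideal.Quotient.mkₐ K _))
      (fun f hf => by
        rw [AlgHom.comp_apply, Ideal.Quotient.mkₐ_eq_mk, Ideal.Quotient.eq_zero_iff_mem.2 hf,
          map_zero]) ha f)
    hΔ I (fun u hu f => minor_mem_map_zeroIdeal v w loc hu f)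
  let π : O →ₐ[K] O ⧸ I := Ideal.Quotient.mkₐ K I
  have hπ : (π : O →+* O ⧸ I) = Ideal.Quotient.mk I := rfl
  -- The classes of the four coordinates and of `g` define the specialization `φ` of the universal
  -- coefficients.
  let z : Fin 5 → Forms (O ⧸ I) 1 := fun i =>
    mapForms (π : O →+* O ⧸ I) ((![y 0, y 1, y 2, y 3, g] : Fin 5 → Forms O 1) i)
  let φ : MvPolynomial (Fin 5 × Fin 4) K →ₐ[K] O ⧸ I :=
    aeval fun s => coeff (Finsupp.single s.2 1) (z s.1).1
  have hφ : ∀ i, mapForms (φ : MvPolynomial (Fin 5 × Fin 4) K →+* O ⧸ I) (genericForm K i) = z i := by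
    intro i
    rw [genericForm, mapForms_linearForm, ← linearForm_coeff (z i)]
    congr 1
    funext j
    exact aeval_X _ _
  let G := genericForm K
  have hfr : (fun i => mapForms (φ : MvPolynomial (Fin 5 × Fin 4) K →+* O ⧸ I)
      (![mul11 (G 0) (G 0), mul11 (G 0) (G 1)] i)) =
      fun i => mapForms (π : O →+* O ⧸ I) (![a, b] i) := by
    rw [mapForms_pair, mapForms_pair, hπ, ha', hb', mapForms_mul11, mapForms_mul11, mapForms_mul11,
      mapForms_mul11, hφ, hφ]
    rfl
  have hfr' : (fun i => mapForms (φ : MvPolynomial (Fin 5 × Fin 4) K →+* O ⧸ I)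
      (cubicFrame (mul11 (G 0) (G 0)) (mul11 (G 0) (G 1)) (fun i => G (![0, 1, 2, 3] i))
        (mul21 (mul11 (G 1) (G 1)) (G 4)) i)) =
      fun i => mapForms (π : O →+* O ⧸ I) (cubicFrame a b y c i) := by
    funext i
    rw [mapForms_cubicFrame, mapForms_cubicFrame, hπ, ha', hb', hc']
    simp only [mapForms_mul11, mapForms_mul21, G, hφ]
    have : (fun i => z (![0, 1, 2, 3] i)) = fun i => mapForms (Ideal.Quotient.mk I) (y i) := by
      funext i
      fin_cases i <;> rfl
    rw [this]
    rfl
  rw [idealMM, Ideal.map_le_iff_le_comap, Ideal.map_le_iff_le_comap]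
  intro f hf
  rw [Ideal.mem_comap, Ideal.mem_comap, ← Ideal.Quotient.eq_zero_iff_mem]
  have := aeval_eq_zero_of_family v w f ![mul11 (G 0) (G 0), mul11 (G 0) (G 1)]
    (cubicFrame (mul11 (G 0) (G 0)) (mul11 (G 0) (G 1)) (fun i => G (![0, 1, 2, 3] i))
        (mul21 (mul11 (G 1) (G 1)) (G 4))) genericForm_det_ne_zero ?_ φ
    (fun i j => π (loc (coordFun v w (Sum.inl (i, j)))))
    (fun i j => π (loc (coordFun v w (Sum.inr (i, j)))))
    (by rw [hfr]; exact span_map_eq_chartSpan v π hab)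
    (by rw [hfr']; exact span_map_eq_chartSpan w π hc)
  · rw [← this]
    have hcomp : (π.comp (loc.comp (Ideal.Quotient.mkₐ K _))) =
        aeval (pairCoord (fun i j => π (loc (coordFun v w (Sum.inl (i, j)))))
          (fun i j => π (loc (coordFun v w (Sum.inr (i, j)))))) := by
      apply MvPolynomial.algHom_ext
      intro s
      rw [aeval_X]
      rcases s with s | s <;> rfl
    exact congrArg (fun ψ : MvPolynomial Coord K →ₐ[K] O ⧸ I => ψ f) hcomp
  · intro t ht t' h1 h2
    rw [map_mul] at ht
    let Y : Fin 5 → Forms K 1 := fun i => mapForms ((aeval t :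
      MvPolynomial (Fin 5 × Fin 4) K →ₐ[K] K) : MvPolynomial (Fin 5 × Fin 4) K →+* K) (G i)
    have hcoord : ∀ q : Fin 4 → Fin 5, aeval t (coeffMatrix fun i => G (q i)).det ≠ 0 →
        IsCoord fun i => Y (q i) := by
      intro q hq
      rw [IsCoord, coeffMatrix_mapForms, ← RingHom.mapMatrix_apply, ← RingHom.map_det]
      exact isUnit_iff_ne_zero.2 hq
    refine mem_vanishingIdeal_iff.1 hf t' (mem_MM_of_normal_form (p := chart₂ v w t')
      (x := fun i => Y (![0, 1, 2, 3] i)) (g := Y 4) (hcoord _ (left_ne_zero_of_mul ht)) ?_ ?_ ?_)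
    · have h3 := hcoord _ (right_ne_zero_of_mul ht)
      convert! h3 using 1
      funext i
      fin_cases i <;> rfl
    · rw [mapForms_pair, mapForms_mul11, mapForms_mul11] at h1
      exact h1
    · simp only [mapForms_cubicFrame, mapForms_mul11, mapForms_mul21] at h2
      exact h2

open scoped Classical in
-- If the eight products of the rows with the variables have a combination killed by `τ`, with a
-- unit among its coefficients, then `τ` kills their maximal minors. These have no common zero on
-- the dense graph, so `τ = 0`. No irreducibility of `X̃` is needed.
theorem smul_eq_zero_of_relation (hε : ∀ r, ε r ≠ 0 → IsUnit r)
    (hfrac : ∀ τ, ∃ s t, IsUnit (loc s) ∧ τ * loc s = loc t)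
    (hker : ∀ t, loc t = 0 → ∃ u, IsUnit (loc u) ∧ u * t = 0)
    (τ : O) (f₀ f₁ : Forms O 1)
    (hf : mapForms (ε : O →+* K) f₀ ≠ 0 ∨ mapForms (ε : O →+* K) f₁ ≠ 0)
    (h : τ • (mul21 (chartRow O v (fun i j => loc (coordFun v w (Sum.inl (i, j)))) 0) f₀ +
      mul21 (chartRow O v (fun i j => loc (coordFun v w (Sum.inl (i, j)))) 1) f₁) = 0) : τ = 0 := by
  let α : Fin 2 → Fin 8 → coordRing v w := fun i j => coordFun v w (Sum.inl (i, j))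
  let α' : Fin 2 → Fin 8 → O := fun i j => loc (α i j)
  change τ • (mul21 (chartRow O v α' (0 : Fin 2)) f₀ + mul21 (chartRow O v α' (1 : Fin 2)) f₁) = 0 at h
  let f : Fin 2 → Forms O 1 := ![f₀, f₁]
  let c : Fin 2 × Mon 1 → O := fun k => coeff k.2.1 (f k.1).1
  have hsum : ∑ k, c k • rowMultiple O v α' k =
      mul21 (chartRow O v α' (0 : Fin 2)) f₀ + mul21 (chartRow O v α' (1 : Fin 2)) f₁ :=
    sum_smul_rowMultiple v α' f
  obtain ⟨k, hk⟩ : ∃ k, IsUnit (c k) := by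
    have key : ∀ i, mapForms (ε : O →+* K) (f i) ≠ 0 → ∃ k, IsUnit (c k) := by
      intro i hi
      by_contra! hcon
      apply hi
      apply Forms.ext_mon
      intro m
      rw [coe_mapForms, coeff_map]
      by_contra h0
      exact hcon (i, m) (hε _ h0)
    exact hf.elim (key 0) (key 1)
  let Δ : (Fin 2 × Mon 1 → Mon 3) → coordRing v w := fun m =>
    (Matrix.of fun i j => (monBasis _ 3).coord (m j) (rowMultiple (coordRing v w) v α i)).det
  have h1 : ∀ m, τ * loc (Δ m) = 0 := by
    intro m
    have h2 : loc (Δ m) = minor (fun j => (monBasis O 3).coord (m j)) (rowMultiple O v α') := by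
      rw [minor_apply]
      refine (map_minor_coord loc m (rowMultiple (coordRing v w) v α)).trans ?_
      simp only [mapForms_rowMultiple]
      rfl
    -- Replacing the `k`-th product by the whole combination multiplies the minor by the unit `c k`,
    -- while `τ` kills the new entry.
    have h3 := map_update_sum_smul (minor fun j => (monBasis O 3).coord (m j)) c
      (rowMultiple O v α') k
    rw [← h2, hsum] at h3
    have h4 : c k * (τ * loc (Δ m)) = 0 := by
      rw [mul_left_comm, ← h3, ← smul_eq_mul, ← AlternatingMap.map_update_smul, h,
        AlternatingMap.map_update_zero]
    exact hk.mul_right_eq_zero.1 h4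
  obtain ⟨s, t, hs, hst⟩ := hfrac τ
  have h2 : ∀ m, ∃ u, IsUnit (loc u) ∧ u * (t * Δ m) = 0 := by
    intro m
    apply hker
    rw [map_mul, ← hst, mul_right_comm, h1, zero_mul]
  choose u hu' hu using h2
  -- One denominator serves all minors. At a point of the graph where this product were nonzero,
  -- every `Δ m` would vanish, contradicting the independence of the eight products there.
  have h3 : (∏ m, u m) * t = 0 := by
    apply eq_zero_of_evalPoint
    intro x hx
    have hX : x ∈ inChart (Xtilde K) v w := graphKappa_subset_Xtilde hx
    by_contra hne
    have hΔ : ∀ m, evalPoint v w hX (Δ m) = 0 := by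
      intro m
      have h4 : (∏ m, u m) * t * Δ m = 0 := by
        rw [← Finset.mul_prod_erase _ _ (Finset.mem_univ m)]
        linear_combination (∏ m ∈ Finset.univ.erase m, u m) * hu m
      have h5 := congrArg (evalPoint v w hX) h4
      rw [map_mul, map_zero] at h5
      exact (mul_eq_zero.1 h5).resolve_left hne
    have hli := linearIndependent_rowMultiple v (α := fun i j => x (Sum.inl (i, j))) hx.1
    obtain ⟨F, hF⟩ := exists_dual_family hli
    have h6 : (Matrix.of fun i j => F j (rowMultiple K v (fun i j => x (Sum.inl (i, j))) i)).det ∈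
        (⊥ : Ideal K) := by
      refine minor_mem ⊥ (rowMultiple K v fun i j => x (Sum.inl (i, j))) (monBasis K 3).coord
        (fun r m => ?_) (fun i => Submodule.subset_span ⟨i, rfl⟩)
        (fun i => mem_span_coord (monBasis K 3) (F i))
      rw [Ideal.mem_bot]
      by_cases hr : Function.Injective r
      · have h7 : (Matrix.of fun i j => (monBasis K 3).coord (m j)
            (rowMultiple K v (fun i j => x (Sum.inl (i, j))) i)).det = 0 := by
          rw [← hΔ m]
          refine Eq.symm ((map_minor_coord _ m (rowMultiple (coordRing v w) v α)).trans ?_)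
          simp only [mapForms_rowMultiple]
          have hα : (fun i j => evalPoint v w hX (α i j)) = fun i j => x (Sum.inl (i, j)) := by
            funext i j
            exact evalPoint_coordFun v w hX _
          rw [hα]
        let σ := Equiv.ofBijective r (Finite.injective_iff_bijective.1 hr)
        have h8 := Matrix.det_permute σ (Matrix.of fun i j => (monBasis K 3).coord (m j)
            (rowMultiple K v (fun i j => x (Sum.inl (i, j))) i))
        rw [h7, mul_zero] at h8
        exact h8
      · obtain ⟨i, j, hij, hne⟩ := Function.not_injective_iff.1 hr
        refine Matrix.det_zero_of_row_eq hne ?_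
        funext l
        simp only [Matrix.of_apply, hij]
    have h9 : (Matrix.of fun i j => F j (rowMultiple K v (fun i j => x (Sum.inl (i, j))) i)) =
        1 := by
      ext i j
      rw [Matrix.of_apply, hF, Matrix.one_apply]
    rw [h9, Matrix.det_one, Ideal.mem_bot] at h6
    exact one_ne_zero h6
  have h4 := congrArg loc h3
  rw [map_mul, map_prod, map_zero, ← hst, mul_left_comm] at h4
  have h5 : IsUnit ((∏ m, loc (u m)) * loc s) :=
    (IsUnit.prod_univ_iff.2 hu').mul hs
  rw [mul_comm] at h4
  exact h5.mul_left_eq_zero.1 (by rw [← h4]; ring)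

end Local


/-! ### From the local rings to the coordinate ring -/

theorem exists_localization {R : Type u} [CommRing R] [Algebra K R] (P : Ideal R) [P.IsPrime] :
    ∃ (O : Type u) (_ : CommRing O) (_ : Algebra K O) (loc : R →ₐ[K] O),
      (∀ s ∉ P, IsUnit (loc s)) ∧ (∀ τ, ∃ s t, s ∉ P ∧ τ * loc s = loc t) ∧
      (∀ (J : Ideal R) (r : R), loc r ∈ J.map loc → ∃ u ∉ P, u * r ∈ J) ∧
      ∀ e : R →ₐ[K] K, (∀ s ∉ P, e s ≠ 0) → ∃ ε : O →ₐ[K] K, ∀ r, ε (loc r) = e r := by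
  refine ⟨Localization.AtPrime P, inferInstance, inferInstance,
    IsScalarTower.toAlgHom K R (Localization.AtPrime P), fun s hs => ?_, fun τ => ?_,
    fun J r hr => ?_, fun e he => ?_⟩
  · exact IsLocalization.map_units (M := P.primeCompl) _ ⟨s, hs⟩
  · obtain ⟨⟨t, s⟩, h⟩ := IsLocalization.surj P.primeCompl τ
    exact ⟨s, t, s.2, h⟩
  · obtain ⟨u, hu, hur⟩ := (IsLocalization.algebraMap_mem_map_algebraMap_iff P.primeCompl
      (Localization.AtPrime P) J r).1 hr
    exact ⟨u, hu, hur⟩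
  · have hu : ∀ y : P.primeCompl, IsUnit (e y) := fun y => isUnit_iff_ne_zero.2 (he y y.2)
    exact ⟨IsLocalization.liftAlgHom (M := P.primeCompl) hu,
      fun r => IsLocalization.lift_eq (M := P.primeCompl) hu r⟩

/-- The Nullstellensatz for the polynomial ring applies to the preimage of `P`. The resulting point
lies in `X̃` because `X̃` is closed in the chart. -/
theorem exists_point_of_isMaximal [IsAlgClosed K] (P : Ideal (coordRing v w)) (hP : P.IsMaximal) :
    ∃ (x : Coord → K) (hx : x ∈ inChart (Xtilde K) v w),
      ∀ r, r ∈ P ↔ evalPoint v w hx r = 0 := by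
  have hmax := Ideal.comap_isMaximal_of_surjective (K := P)
    (Ideal.Quotient.mk (vanishingIdeal K (inChart (Xtilde K) v w))) Ideal.Quotient.mk_surjective
  obtain ⟨x, hx⟩ := isMaximal_iff_eq_vanishingIdeal_singleton.1 hmax
  have hxX : x ∈ inChart (Xtilde K) v w := by
    apply zeroLocus_vanishingIdeal_Xtilde
    intro f hf
    have : f ∈ vanishingIdeal K {x} := by
      rw [← hx, Ideal.mem_comap, Ideal.Quotient.eq_zero_iff_mem.2 hf]
      exact P.zero_mem
    exact mem_vanishingIdeal_iff.1 this x rfl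
  refine ⟨x, hxX, fun r => ?_⟩
  obtain ⟨f, rfl⟩ := Ideal.Quotient.mk_surjective r
  rw [evalPoint_mk, ← Ideal.mem_comap, hx, mem_vanishingIdeal_iff]
  simp

theorem idealMM_le_zeroIdeal [IsAlgClosed K] (h2 : (2 : K) ≠ 0) :
    idealMM v w ≤ zeroIdeal (wedgeNu (bundleA v w) (bundleB v w)) := by
  have : Infinite K := IsAlgClosed.instInfinite
  intro r hr
  by_contra hr'
  set J := zeroIdeal (wedgeNu (bundleA v w) (bundleB v w)) with hJ
  -- The ideal of all `u` with `u r ∈ J` is proper, since `r ∉ J`. An element of it outside the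
  -- maximal ideal `P` gives a contradiction.
  obtain ⟨P, hP, hle⟩ := Ideal.exists_le_maximal (Submodule.comap (LinearMap.mulRight _ r) J)
    fun h => hr' <| by
      have h1 := (Ideal.eq_top_iff_one _).1 h
      rw [Submodule.mem_comap, LinearMap.mulRight_apply, one_mul] at h1
      exact h1
  suffices key : ∃ u ∉ P, u * r ∈ J by
    obtain ⟨u, hu, hur⟩ := key
    exact hu (hle hur)
  obtain ⟨x, hx, hxP⟩ := exists_point_of_isMaximal v w P hP
  by_cases hM : x ∈ inChart (MM K) v w
  · obtain ⟨O, _, _, loc, hunit, hfrac, hmap, hlift⟩ := exists_localization (K := K) P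
    obtain ⟨ε, hε'⟩ := hlift (evalPoint v w hx) fun s hs h => hs ((hxP s).2 h)
    have hε : ∀ r, ε r ≠ 0 → IsUnit r := by
      intro r hr
      obtain ⟨s, t, hs, hst⟩ := hfrac r
      have ht : t ∉ P := by
        intro ht
        apply hr
        have h1 := congrArg ε hst
        rw [map_mul, hε', hε', (hxP t).1 ht] at h1
        exact (mul_eq_zero.1 h1).resolve_right fun h => hs ((hxP s).2 h)
      exact isUnit_of_mul_isUnit_left (hst ▸ hunit t ht)
    refine hmap J r (map_idealMM_le v w loc ε hε h2 hM
      (fun s => (hε' _).trans (evalPoint_coordFun v w hx s))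
      (smul_eq_zero_of_relation v w loc ε hε (fun τ => ?_) fun t ht => ?_)
      (Ideal.mem_map_of_mem loc hr))
    · obtain ⟨s, t, hs, hst⟩ := hfrac τ
      exact ⟨s, t, hunit s hs, hst⟩
    · obtain ⟨u, hu, hut⟩ := hmap ⊥ t (by rw [ht]; exact zero_mem _)
      exact ⟨u, hunit u hu, hut⟩
  -- Outside `𝕄` the ideal of minors itself contains an element not in `P`.
  · obtain ⟨s, hs, hs0⟩ := exists_mem_zeroIdeal_of_not_mem_MM v w hx hM
    exact ⟨s, fun h => hs0 ((hxP s).1 h), Ideal.mul_mem_right r _ hs⟩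

end Ideals

end EllipticQuartics

end

theorem mainTheorem9 (K : Type*) [Field K] [IsAlgClosed K] [CharZero K] :
    EllipticQuartics.MM K ⊆ EllipticQuartics.Xtilde K ∧
    (∀ p ∈ EllipticQuartics.Xtilde K, p ∉ EllipticQuartics.MM K →
      Module.finrank K (LinearMap.range (EllipticQuartics.nu p.1.1 p.2.1)) = 12) ∧
    (∀ (v : EllipticQuartics.Basis2 K) (w : EllipticQuartics.Basis3 K),
      EllipticQuartics.zeroIdeal
          (EllipticQuartics.wedgeNu (EllipticQuartics.bundleA v w)
            (EllipticQuartics.bundleB v w)) =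
        EllipticQuartics.idealMM v w) := by
  have : Infinite K := IsAlgClosed.instInfinite
  exact ⟨EllipticQuartics.MM_subset_Xtilde,
    fun p hp hM => EllipticQuartics.finrank_range_nu_of_not_mem_MM hp hM,
    fun v w => le_antisymm (EllipticQuartics.zeroIdeal_le_idealMM v w)
      (EllipticQuartics.idealMM_le_zeroIdeal v w two_ne_zero)⟩
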